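/- **Setting.** Let $(\mathcal H_\tau)_{\tau\in T}$ be a family of separable complex Hilbert spaces, all continuously embedded in one of them, $\mathcal H_0:=\mathcal H_{\tau_0}$, such that: any two of them contain a common third one $\mathcal H_{\tau_3}$ with continuous inclusions; each $\mathcal H_{\tau_1}$ contains some $\mathcal H_{\tau_2}$ with Hilbert–Schmidt inclusion; and $\Phi:=\bigcap_\tau\mathcal H_\tau$ is dense in every $\mathcal H_\tau$. Give $\Phi$ the projective limit topology (a nuclear space). Let $\Phi'$ be its dual, with bilinear pairing $\langle\omega,\xi\rangle$, so that $\Phi'=\bigcup_\tau\mathcal H_{-\tau}$, where $\mathcal H_{-\tau}$ is the dual of $\mathcal H_\tau$. Let $\Phi^{\odot n}:=\operatorname{proj\,lim}_\tau\mathcal H_\tau^{\odot n}$ (symmetric Hilbert tensor powers with norms $\|\cdot\|_\tau$; $\Phi^{\odot0}=\mathbb C$), with dual $\Phi'^{\odot n}=\operatorname{ind\,lim}_\tau\mathcal H_{-\tau}^{\odot n}$ (locally convex inductive limit). For $\alpha>0$, $\mathcal E^\alpha_{\min}(\Phi')$ is the space of functions $f:\Phi'\to\mathbb C$ whose restriction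 to every $\mathcal H_{-\tau}$ is entire (continuous and Gâteaux holomorphic) and satisfies $\sup_{\omega\in\mathcal H_{-\tau}}|f(\omega)|\exp(-2^{-l}\|\omega\|_{-\tau}^\alpha)<\infty$ for all $l\in\mathbb N_0$, with the locally convex topology given by these norms ($\tau\in T$, $l\in\mathbb N_0$). Also $\mathcal E^0_{\min}(\Phi'):=\operatorname{proj\,lim}_{\alpha>0}\mathcal E^\alpha_{\min}(\Phi')$. A sequence of monic polynomials on $\Phi'$ is a sequence of maps $S^{(n)}:\Phi'\to\Phi'^{\odot n}$, $S^{(n)}(\omega)=\sum_{k=0}^nU_{n,k}\omega^{\otimes k}$, with continuous linear $U_{n,k}:\Phi'^{\odot k}\to\Phi'^{\odot n}$ and $U_{n,n}=\mathbf 1$. It is a Sheffer sequence if, as formal power series in $\xi\in\Phi$, $$\sum_{n=0}^\infty\frac1{n!}\langle S^{(n)}(\omega),\xi^{\otimes n}\rangle=\frac{\exp\langle\omega,A(\xi)\rangle}{\rho(A(\xi))},\qquad\omega\in\Phi',$$ where $A(\xi)=\sum_{k\ge1}A_k\xi^{\otimes k}$ with continuous linear $A_k:\Phi^{\odot k}\to\Phi$,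 $A_1=\mathbf 1$, and $\rho(\xi)=1+\sum_{n\ge1}\langle\rho^{(n)},\xi^{\otimes n}\rangle$ with $\rho^{(n)}\in\Phi'^{\odot n}$. A formal power series $\sum_{n\ge 1} A_n\xi^{\otimes n}$ with continuous linear $A_n:\Phi^{\odot n}\to\Phi$ is quasi-holomorphic on a neighborhood of zero if for each $\tau\in T$ there are $\tau'\in T$ and $C\ge0$ such that, for all $n\ge1$, $A_n$ extends to a bounded operator $\mathcal H_{\tau'}^{\odot n}\to\mathcal H_\tau$ of norm at most $C^n$. **Statement.** Let $(S^{(n)})_{n\ge0}$ be a Sheffer sequence as above. Assume that $\rho$ is holomorphic on a neighborhood of zero in $\Phi$, and that $A(\xi)$ and its compositional inverse $B(\xi)$ are quasi-holomorphic on a neighborhood of zero in $\Phi$. (i) Let $\alpha\in[0,1]$. Each $f\in\mathcal E^\alpha_{\min}(\Phi')$ admits a unique representation $$f(\omega)=\sum_{n=0}^\infty\langle S^{(n)}(\omega),\varphi^{(n)}\rangle,\qquad\varphi^{(n)}\in\Phi^{\odot n},$$ with the series converging in $\mathcal E^\alpha_{\min}(\Phi')$. (ii) Let $\alpha\in(0,1]$.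 For $f\in\mathcal E^\alpha_{\min}(\Phi')$ represented as in (i), and for $\tau\in T$, $l\in\mathbb N_0$, $$|||f|||_{\tau,l,\alpha}:=\sum_{n=0}^\infty(n!)^{1/\alpha}\,2^{ln}\,\|\varphi^{(n)}\|_\tau<\infty,$$ and $|||\cdot|||_{\tau,l,\alpha}$ is a norm on $\mathcal E^\alpha_{\min}(\Phi')$. If $\mathbb E^\alpha_{l,\tau}$ denotes the Banach space obtained as the completion of $\mathcal E^\alpha_{\min}(\Phi')$ in this norm, then $$\mathcal E^\alpha_{\min}(\Phi')=\operatorname{proj\,lim}_{\tau\in T,\,l\in\mathbb N_0}\mathbb E^\alpha_{l,\tau}$$ as topological spaces; that is, the canonical map from the left-hand side to the projective limit (families of elements of the completions compatible with the canonical maps $\mathbb E^\alpha_{l',\tau'}\to\mathbb E^\alpha_{l,\tau}$, which exist whenever $|||\cdot|||_{\tau,l,\alpha}\le C\,|||\cdot|||_{\tau',l',\alpha}$ for some $C$) is a homeomorphism. -/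

import Mathlib

open scoped Topology

noncomputable section

/-! ### Nuclear spaces as intersections of Hilbert spaces -/

/-- Hilbert-Schmidt operators: the squared norms of the images of an orthonormal basis
are summable. -/
def IsHilbertSchmidt {E F : Type*} [NormedAddCommGroup E] [InnerProductSpace ℂ E]
    [NormedAddCommGroup F] [InnerProductSpace ℂ F] (i : E →L[ℂ] F) : Prop :=
  ∃ (w : Set E) (b : HilbertBasis w ℂ E), Summable fun k => ‖i (b k)‖ ^ 2

/-- The data defining a nuclear space: separable complex Hilbert spaces `H τ`, `τ ∈ T`, each
continuously embedded (by `emb τ`) into the center space `H center`.  Inclusions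
`H σ ⊂ H τ` are understood inside the center space.  (The case in which all `H τ` and all embeddings are
complexifications of real ones is included.) -/
structure NuclearScale (T : Type*) where
  H : T → Type*
  [normed : ∀ τ, NormedAddCommGroup (H τ)]
  [innerProd : ∀ τ, InnerProductSpace ℂ (H τ)]
  [complete : ∀ τ, CompleteSpace (H τ)]
  [separable : ∀ τ, TopologicalSpace.SeparableSpace (H τ)]
  center : T
  emb : ∀ τ, H τ →L[ℂ] H center
  emb_injective : ∀ τ, Function.Injective (emb τ)
  emb_center : emb center = ContinuousLinearMap.id ℂ (H center)
  /-- any two of the spaces contain a common third one, with continuous inclusions -/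
  directed : ∀ τ₁ τ₂, ∃ τ₃, (∃ i : H τ₃ →L[ℂ] H τ₁, emb τ₁ ∘L i = emb τ₃) ∧
    (∃ i : H τ₃ →L[ℂ] H τ₂, emb τ₂ ∘L i = emb τ₃)
  /-- each of the spaces contains another one with Hilbert-Schmidt inclusion -/
  nuclear : ∀ τ₁, ∃ τ₂, ∃ i : H τ₂ →L[ℂ] H τ₁, emb τ₁ ∘L i = emb τ₂ ∧ IsHilbertSchmidt i
  /-- the intersection of all the spaces is dense in each of them -/
  dense : ∀ τ, Dense {x : H τ | ∀ σ, ∃ y : H σ, emb σ y = emb τ x}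

namespace NuclearScale

attribute [instance] NuclearScale.normed NuclearScale.innerProd NuclearScale.complete
  NuclearScale.separable

variable {T : Type*} (G : NuclearScale T)

/-- The nuclear space `Φ = ⋂ τ, H τ`.  An element of the intersection is recorded as the family of
its incarnations `x τ ∈ H τ`; all of them are the same vector `x center` of the center space. -/
def phiSubmodule : Submodule ℂ (∀ τ, G.H τ) where
  carrier := {x | ∀ τ, G.emb τ (x τ) = x G.center}
  add_mem' {a b} ha hb τ := by
    simp only [Set.mem_ofPred_eq] at ha hb
    simp [ha τ, hb τ]
  zero_mem' τ := by simp
  smul_mem' c a ha τ := by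
    simp only [Set.mem_ofPred_eq] at ha
    simp [ha τ]

/-- The nuclear space `Φ` as a type.  As a subspace of the product `∏ τ, H τ`, it carries the
projective limit topology. -/
abbrev Phi : Type _ := ↥G.phiSubmodule

/-- The inclusion `Φ ⊂ H τ`. -/
def incl (τ : T) : G.Phi →L[ℂ] G.H τ :=
  (ContinuousLinearMap.proj τ).comp (Submodule.subtypeL _)

/-- The co-nuclear space `Φ'`, the dual of `Φ`; the pairing `⟨ω, ξ⟩` is `ω ξ`. -/
abbrev Dual : Type _ := G.Phi →L[ℂ] ℂ

/-- `H_{-τ}` is the dual Hilbert space of `H τ` (with the dual norm); this is its inclusion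
into `Φ'`. -/
def dualIncl (τ : T) : (G.H τ →L[ℂ] ℂ) →ₗ[ℂ] G.Dual where
  toFun ω := ω.comp (G.incl τ)
  map_add' _ _ := rfl
  map_smul' _ _ := rfl

/-- The element `⟪x, ·⟫` of `H_{-τ}`, seen in `Φ'`.  By the Riesz theorem, `x ↦ ⟪x, ·⟫` is an
antilinear isometry of `H τ` onto `H_{-τ}`, mapping orthonormal systems to such. -/
def riesz (τ : T) (x : G.H τ) : G.Dual := G.dualIncl τ (innerSL ℂ x)

/-! ### Symmetric tensor powers

The Hilbert space tensor power `H τ ^{⊗ n}` is realised, as usual, as the space of `n`-linear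
Hilbert-Schmidt forms on `H_{-τ}`: the tensor `φ` is the form
`(ω₁, …, ω_n) ↦ ⟨ω₁ ⊗ … ⊗ ω_n, φ⟩`, and its norm is given by
`‖φ‖² = ∑ |⟨e_{k₁} ⊗ … ⊗ e_{k_n}, φ⟩|²` for any orthonormal basis `e` of `H_{-τ}`.
Symmetric tensors are the symmetric forms. -/

/-- Finite orthonormal systems in `H τ`. -/
def OrthoSys (τ : T) : Type _ := Σ m : ℕ, {v : Fin m → G.H τ // Orthonormal ℂ v}

/-- The values of an `n`-linear form on all `n`-tuples from a finite orthonormal system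
of `H_{-τ}`. -/
def coords {n : ℕ} {τ : T} (v : G.OrthoSys τ) :
    MultilinearMap ℂ (fun _ : Fin n => G.Dual) ℂ →ₗ[ℂ]
      EuclideanSpace ℂ (Fin n → Fin v.1) where
  toFun φ := WithLp.toLp 2 fun k => φ fun i => G.riesz τ (v.2.1 (k i))
  map_add' _ _ := rfl
  map_smul' _ _ := rfl

/-- `Φ^{⊙ n} = ⋂ τ, (H τ)^{⊙ n}`: the symmetric `n`-linear forms on `Φ' = ⋃ τ, H_{-τ}` whose
Hilbert-Schmidt norm on each `H_{-τ}` is finite. -/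
def symPow (n : ℕ) : Submodule ℂ (MultilinearMap ℂ (fun _ : Fin n => G.Dual) ℂ) where
  carrier := {φ | (∀ (σ : Equiv.Perm (Fin n)) (ω : Fin n → G.Dual), φ (ω ∘ σ) = φ ω) ∧
    ∀ τ, BddAbove (Set.range fun v : G.OrthoSys τ => ‖G.coords v φ‖)}
  add_mem' := by
    rintro φ ψ ⟨hφ, hφ'⟩ ⟨hψ, hψ'⟩
    refine ⟨fun σ ω => by simp [hφ σ ω, hψ σ ω], fun τ => ?_⟩
    obtain ⟨a, ha⟩ := hφ' τ
    obtain ⟨b, hb⟩ := hψ' τ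
    refine ⟨a + b, ?_⟩
    rintro _ ⟨v, rfl⟩
    simp only [map_add]
    exact (norm_add_le _ _).trans (add_le_add (ha ⟨v, rfl⟩) (hb ⟨v, rfl⟩))
  zero_mem' := ⟨fun _ _ => rfl, fun τ => ⟨0, by rintro _ ⟨v, rfl⟩; simp⟩⟩
  smul_mem' := by
    rintro c φ ⟨hφ, hφ'⟩
    refine ⟨fun σ ω => by simp [hφ σ ω], fun τ => ?_⟩
    obtain ⟨a, ha⟩ := hφ' τ
    refine ⟨‖c‖ * a, ?_⟩
    rintro _ ⟨v, rfl⟩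
    simp only [map_smul, norm_smul]
    exact mul_le_mul_of_nonneg_left (ha ⟨v, rfl⟩) (norm_nonneg c)

instance (τ : T) : Nonempty (G.OrthoSys τ) :=
  ⟨⟨0, fun k => k.elim0, ⟨fun k => k.elim0, fun k => k.elim0⟩⟩⟩

/-- The norm `‖·‖_τ` of `(H τ)^{⊙ n}`, on `Φ^{⊙ n}`. -/
def tnorm {n : ℕ} (τ : T) : Seminorm ℂ (G.symPow n) :=
  Seminorm.of (fun φ => ⨆ v : G.OrthoSys τ, ‖G.coords v φ.1‖)
    (fun φ ψ => by
      refine ciSup_le fun v => ?_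
      rw [Submodule.coe_add, map_add]
      exact (norm_add_le _ _).trans (add_le_add (le_ciSup (φ.2.2 τ) v) (le_ciSup (ψ.2.2 τ) v)))
    (fun c φ => by
      simp only [Submodule.coe_smul, map_smul, norm_smul]
      rw [Real.mul_iSup_of_nonneg (norm_nonneg c)])

/-- The projective limit topology on `Φ^{⊙ n}`, given by the norms `‖·‖_τ`. -/
instance symPowTopology (n : ℕ) : TopologicalSpace (G.symPow n) :=
  (SeminormFamily.moduleFilterBasis fun τ : T => G.tnorm (n := n) τ).topology

lemma symPow_withSeminorms (n : ℕ) :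
    WithSeminorms (fun τ : T => G.tnorm (n := n) τ) := ⟨rfl⟩

/-- `Φ'^{⊙ n}`, the dual of `Φ^{⊙ n}`. -/
abbrev SymDual (n : ℕ) : Type _ := G.symPow n →L[ℂ] ℂ

/-- A seminorm on `Φ'^{⊙ n} = ⋃ τ, (H_{-τ})^{⊙ n}` is admissible if its restriction to each
`(H_{-τ})^{⊙ n}`, the functionals bounded with respect to `‖·‖_τ`, is continuous for the
dual norm. -/
def IsIndSeminorm {n : ℕ} (q : Seminorm ℂ (G.SymDual n)) : Prop :=
  ∀ τ, ∃ C : ℝ, ∀ (Ψ : G.SymDual n) (M : ℝ), 0 ≤ M → (∀ φ, ‖Ψ φ‖ ≤ M * G.tnorm τ φ) → q Ψ ≤ C * M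

/-- The locally convex inductive limit topology on `Φ'^{⊙ n} = ⋃ τ, (H_{-τ})^{⊙ n}`. -/
@[reducible] def indTopology (n : ℕ) : TopologicalSpace (G.SymDual n) :=
  (SeminormFamily.moduleFilterBasis
    fun q : {q : Seminorm ℂ (G.SymDual n) // G.IsIndSeminorm q} => q.1).topology

/-! ### Symmetric tensor products of elements of `Φ` and powers of elements of `Φ'` -/

lemma coords_prod_le {n : ℕ} {τ : T} (v : G.OrthoSys τ) (ξ : Fin n → G.Phi) (σ : Equiv.Perm (Fin n)) :
    ‖(WithLp.toLp 2 fun k => ∏ i, G.riesz τ (v.2.1 (k (σ i))) (ξ i) :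
      EuclideanSpace ℂ (Fin n → Fin v.1))‖ ≤ ∏ i, ‖G.incl τ (ξ i)‖ := by
  have key : ∑ k : Fin n → Fin v.1, ∏ i, ‖G.riesz τ (v.2.1 (k (σ i))) (ξ i)‖ ^ 2 =
      ∏ i, ∑ j : Fin v.1, ‖G.riesz τ (v.2.1 j) (ξ i)‖ ^ 2 := by
    rw [Finset.prod_univ_sum, Fintype.piFinset_univ]
    exact Fintype.sum_equiv (Equiv.arrowCongr σ.symm (Equiv.refl _)) _ _ fun k => by simp
  rw [EuclideanSpace.norm_eq]
  apply Real.sqrt_le_iff.2 ⟨Finset.prod_nonneg fun i _ => norm_nonneg _, ?_⟩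
  simp only [norm_prod, ← Finset.prod_pow]
  rw [key]
  refine Finset.prod_le_prod (fun i _ => Finset.sum_nonneg fun j _ => by positivity) fun i _ => ?_
  exact v.2.2.sum_inner_products_le (x := G.incl τ (ξ i)) (s := Finset.univ)

/-- The linear functional `ω ↦ ⟨ω, ξ⟩` on `Φ'`. -/
def evalAt (ξ : G.Phi) : G.Dual →ₗ[ℂ] ℂ where
  toFun ω := ω ξ
  map_add' _ _ := rfl
  map_smul' _ _ := rfl

/-- The form `(ω₁, …, ω_n) ↦ (1 / n!) ∑ σ, ∏ i, ⟨ω_{σ i}, ξ i⟩`. -/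
def symForm {n : ℕ} (ξ : Fin n → G.Phi) : MultilinearMap ℂ (fun _ : Fin n => G.Dual) ℂ :=
  (n.factorial : ℂ)⁻¹ • ∑ σ : Equiv.Perm (Fin n),
    MultilinearMap.domDomCongr σ
      ((MultilinearMap.mkPiAlgebra ℂ (Fin n) ℂ).compLinearMap fun i => G.evalAt (ξ i))

lemma symForm_apply {n : ℕ} (ξ : Fin n → G.Phi) (ω : Fin n → G.Dual) :
    G.symForm ξ ω = (n.factorial : ℂ)⁻¹ * ∑ σ : Equiv.Perm (Fin n), ∏ i, ω (σ i) (ξ i) := by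
  simp [symForm, evalAt]

lemma symForm_mem {n : ℕ} (ξ : Fin n → G.Phi) : G.symForm ξ ∈ G.symPow n := by
  refine ⟨fun π ω => ?_, fun τ => ⟨‖(n.factorial : ℂ)⁻¹‖ *
    ∑ _σ : Equiv.Perm (Fin n), ∏ i, ‖G.incl τ (ξ i)‖, ?_⟩⟩
  · simp only [symForm_apply, Function.comp_apply]
    congr 1
    exact Fintype.sum_equiv (Equiv.mulLeft π) _ _ fun σ => rfl
  · rintro _ ⟨v, rfl⟩
    have h : G.coords v (G.symForm ξ) = (n.factorial : ℂ)⁻¹ • ∑ σ : Equiv.Perm (Fin n),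
        (WithLp.toLp 2 fun k => ∏ i, G.riesz τ (v.2.1 (k (σ i))) (ξ i) :
          EuclideanSpace ℂ (Fin n → Fin v.1)) := by
      ext k
      change G.symForm ξ _ = _
      rw [symForm_apply]
      simp
    simp only
    rw [h, norm_smul]
    gcongr
    exact (norm_sum_le _ _).trans (Finset.sum_le_sum fun σ _ => G.coords_prod_le v ξ σ)

/-- The symmetric tensor product `ξ₁ ⊙ … ⊙ ξ_n`, the symmetrization of `ξ₁ ⊗ … ⊗ ξ_n`. -/
def symTensor {n : ℕ} (ξ : Fin n → G.Phi) : G.symPow n := ⟨G.symForm ξ, G.symForm_mem ξ⟩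

/-- The power `ξ^{⊗ n}`. -/
def tpow (ξ : G.Phi) (n : ℕ) : G.symPow n := G.symTensor fun _ => ξ

lemma exists_common_bound (s : Finset T) :
    ∃ (τ : T) (C : ℝ), 0 ≤ C ∧ ∀ σ ∈ s, ∀ ξ : G.Phi, ‖G.incl σ ξ‖ ≤ C * ‖G.incl τ ξ‖ := by
  have step : ∀ τ₁ τ₂ : T, (∃ i : G.H τ₂ →L[ℂ] G.H τ₁, G.emb τ₁ ∘L i = G.emb τ₂) →
      ∃ C : ℝ, 0 ≤ C ∧ ∀ ξ : G.Phi, ‖G.incl τ₁ ξ‖ ≤ C * ‖G.incl τ₂ ξ‖ := by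
    rintro τ₁ τ₂ ⟨i, hi⟩
    refine ⟨‖i‖, norm_nonneg _, fun ξ => ?_⟩
    have h : i (G.incl τ₂ ξ) = G.incl τ₁ ξ := by
      apply G.emb_injective τ₁
      have h1 := congrArg (fun f => f (G.incl τ₂ ξ)) hi
      simp only [ContinuousLinearMap.comp_apply] at h1
      rw [h1]
      exact (ξ.2 τ₂).trans (ξ.2 τ₁).symm
    rw [← h]
    exact i.le_opNorm _
  classical
  induction s using Finset.induction_on with
  | empty => exact ⟨G.center, 0, le_rfl, by simp⟩
  | insert a s _ ih =>
    obtain ⟨τ, C, hC, h⟩ := ih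
    obtain ⟨τ₃, h1, h2⟩ := G.directed a τ
    obtain ⟨C₁, hC₁, h1⟩ := step _ _ h1
    obtain ⟨C₂, hC₂, h2⟩ := step _ _ h2
    refine ⟨τ₃, C₁ + C * C₂, by positivity, fun σ hσ ξ => ?_⟩
    have hn := norm_nonneg (G.incl τ₃ ξ)
    rcases Finset.mem_insert.1 hσ with rfl | hσ
    · have := h1 ξ
      have := mul_nonneg (mul_nonneg hC hC₂) hn
      linarith
    · have h3 := h σ hσ ξ
      have h4 := mul_le_mul_of_nonneg_left (h2 ξ) hC
      have := mul_nonneg hC₁ hn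
      linarith

/-- `Φ' = ⋃ τ, H_{-τ}`. -/
lemma exists_riesz (ω : G.Dual) : ∃ (τ : T) (x : G.H τ), G.riesz τ x = ω := by
  obtain ⟨s, C, -, h⟩ := Seminorm.bound_comp_of_isInducing
    (p := (normSeminorm ℂ ℂ).comp ω.toLinearMap) (f := G.phiSubmodule.subtype)
    (by exact ω.continuous.norm)
    (withSeminorms_pi fun τ => norm_withSeminorms ℂ (G.H τ)) Topology.IsInducing.subtypeVal
  classical
  obtain ⟨τ, D, hD, hτ⟩ := G.exists_common_bound (s.image Sigma.fst)
  have hb : ∀ ξ : G.Phi, ‖ω.toLinearMap ξ‖ ≤ C * D * ‖(G.incl τ).toLinearMap ξ‖ := fun ξ => by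
    refine (h ξ).trans ?_
    rw [mul_assoc]
    refine mul_le_mul_of_nonneg_left ?_ C.2
    refine Seminorm.finset_sup_apply_le (by positivity) fun i hi => ?_
    exact hτ i.1 (Finset.mem_image_of_mem _ hi) ξ
  have hd : DenseRange (G.incl τ).toLinearMap := by
    refine (G.dense τ).mono fun x hx => ?_
    choose y hy using hx
    have hyτ : y τ = x := G.emb_injective τ (hy τ)
    have hyc : y G.center = G.emb τ x := by
      have := hy G.center
      rwa [G.emb_center] at this
    exact ⟨⟨y, fun σ => (hy σ).trans hyc.symm⟩, hyτ⟩
  refine ⟨τ, (InnerProductSpace.toDual ℂ (G.H τ)).symm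
    (ω.toLinearMap.extendOfNorm (G.incl τ).toLinearMap), ?_⟩
  ext ξ
  have := LinearMap.extendOfNorm_eq hd ⟨_, hb⟩ ξ
  change InnerProductSpace.toDual ℂ (G.H τ) ((InnerProductSpace.toDual ℂ (G.H τ)).symm _) _ = _
  rw [LinearIsometryEquiv.apply_symm_apply]
  exact this

lemma norm_diag_le {n : ℕ} (τ : T) (x : G.H τ) (φ : G.symPow n) :
    ‖φ.1 fun _ => G.riesz τ x‖ ≤ ‖x‖ ^ n * G.tnorm τ φ := by
  have hs : ∀ (c : ℂ) (y : G.H τ), G.riesz τ (c • y) = (starRingEnd ℂ c) • G.riesz τ y :=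
    fun c y => by simp [riesz]
  have main : ∀ y : G.H τ, ‖y‖ = 1 → ‖φ.1 fun _ => G.riesz τ y‖ ≤ G.tnorm τ φ := fun y hy => by
    let v : G.OrthoSys τ := ⟨1, fun _ => y, ⟨fun _ => hy, fun i j h =>
      absurd (Subsingleton.elim i j) h⟩⟩
    refine le_trans ?_ (le_ciSup (φ.2.2 τ) v)
    exact PiLp.norm_apply_le (G.coords v φ.1) (fun _ => 0)
  rcases eq_or_ne x 0 with rfl | hx
  · rcases Nat.eq_zero_or_pos n with rfl | hn
    · let v : G.OrthoSys τ := ⟨0, fun k => k.elim0, ⟨fun k => k.elim0, fun k => k.elim0⟩⟩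
      refine le_trans ?_ (le_of_le_of_eq (le_ciSup (φ.2.2 τ) v) (by simp; rfl))
      refine le_trans (le_of_eq ?_) (PiLp.norm_apply_le (G.coords v φ.1) (fun k => k.elim0))
      change _ = ‖φ.1 _‖
      congr 2
      exact Subsingleton.elim _ _
    · have h0 : G.riesz τ (0 : G.H τ) = 0 := by simp [riesz]
      rw [h0]
      have : Nonempty (Fin n) := ⟨⟨0, hn⟩⟩
      have : φ.1 (fun _ : Fin n => (0 : G.Dual)) = 0 := φ.1.map_zero
      rw [this, norm_zero]
      exact mul_nonneg (by positivity) (apply_nonneg _ _)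
  · have hx' : (‖x‖ : ℂ) ≠ 0 := by exact_mod_cast norm_ne_zero_iff.2 hx
    have e : x = (‖x‖ : ℂ) • ((‖x‖ : ℂ)⁻¹ • x) := by rw [smul_smul, mul_inv_cancel₀ hx', one_smul]
    have hy : ‖((‖x‖ : ℂ)⁻¹ • x)‖ = 1 := by
      rw [norm_smul, norm_inv, Complex.norm_real, norm_norm,
        inv_mul_cancel₀ (norm_ne_zero_iff.2 hx)]
    have h1 : (fun _ : Fin n => G.riesz τ x) =
        fun _ : Fin n => (‖x‖ : ℂ) • G.riesz τ ((‖x‖ : ℂ)⁻¹ • x) := by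
      funext _
      conv_lhs => rw [e, hs]
      simp
    rw [h1, φ.1.map_smul_univ (fun _ => (‖x‖ : ℂ))]
    simp only [Finset.prod_const, Finset.card_univ, Fintype.card_fin, norm_smul, norm_pow,
      Complex.norm_real, norm_norm]
    exact mul_le_mul_of_nonneg_left (main _ hy) (by positivity)

/-- The power `ω^{⊗ n}`, i.e. the functional `φ ↦ ⟨ω^{⊗ n}, φ⟩ = φ(ω, …, ω)`. -/
def dpow (ω : G.Dual) (n : ℕ) : G.SymDual n where
  toFun φ := φ.1 fun _ => ω
  map_add' _ _ := rfl
  map_smul' _ _ := rfl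
  cont := by
    obtain ⟨τ, x, rfl⟩ := G.exists_riesz ω
    let f : G.symPow n →ₗ[ℂ] ℂ :=
      { toFun := fun φ => φ.1 fun _ => G.riesz τ x
        map_add' := fun _ _ => rfl
        map_smul' := fun _ _ => rfl }
    refine (G.symPow_withSeminorms n).continuous_normedSpace_rng ℂ f
      ⟨{τ}, ⟨‖x‖ ^ n, by positivity⟩, fun φ => ?_⟩
    rw [Finset.sup_singleton]
    exact G.norm_diag_le τ x φ

/-! ### Formal power series and Sheffer sequences -/

/-- Formal power series `F(ξ) = ∑ n, F_n ξ^{⊗ n}` on `Φ` with values in `X`; the constant term is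
`F 0`, evaluated at the generator `ξ^{⊗ 0}` of `Φ^{⊙ 0} = ℂ`. -/
abbrev FormalSeries (X : Type*) [AddCommGroup X] [Module ℂ X] [TopologicalSpace X] : Type _ :=
  ∀ n : ℕ, G.symPow n →L[ℂ] X

variable {G}

/-- The coefficient at `z ^ m` of the formal power series `F(A(z ξ))`, for `A` without constant term:
the sum over all `k₁ + … + k_n = m`, `k_i ≥ 1`, of
`F_n ((A_{k₁} ξ^{⊗ k₁}) ⊙ … ⊙ (A_{k_n} ξ^{⊗ k_n}))`. -/
def compCoeff {X : Type*} [AddCommGroup X] [Module ℂ X] [TopologicalSpace X]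
    (F : G.FormalSeries X) (A : G.FormalSeries G.Phi) (ξ : G.Phi) (m : ℕ) : X :=
  ∑ c : Composition m, F c.length
    (G.symTensor fun i => A (c.blocksFun i) (G.tpow ξ (c.blocksFun i)))

/-- `B` is the compositional inverse of `A`: both have no constant term, and
`A(B(ξ)) = B(A(ξ)) = ξ`. -/
def IsCompInverse (A B : G.FormalSeries G.Phi) : Prop :=
  A 0 = 0 ∧ B 0 = 0 ∧ ∀ (ξ : G.Phi) (m : ℕ),
    compCoeff A B ξ m = (if m = 1 then ξ else 0) ∧ compCoeff B A ξ m = (if m = 1 then ξ else 0)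

/-- Quasi-holomorphy on a neighborhood of zero: for each `τ` there are `τ'` and `C ≥ 0` such that
each `A_n`, `n ≥ 1`, is (on the dense subspace `Φ^{⊙ n}`, hence extends to be) a bounded operator
from `(H τ')^{⊙ n}` to `H τ` of norm at most `C ^ n`. -/
def QuasiHolomorphic (A : G.FormalSeries G.Phi) : Prop :=
  ∀ τ, ∃ (τ' : T) (C : ℝ), 0 ≤ C ∧ ∀ n, 1 ≤ n → ∀ φ : G.symPow n,
    ‖G.incl τ (A n φ)‖ ≤ C ^ n * G.tnorm τ' φ

/-- A sequence of monic polynomials on `Φ'`: maps `S n : Φ' → Φ'^{⊙ n}` of the form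
`S n ω = ∑ k ≤ n, U_{n,k} ω^{⊗ k}` with continuous linear `U_{n,k}` and `U_{n,n} = 1`. -/
def IsMonicSequence (S : ∀ n : ℕ, G.Dual → G.SymDual n) : Prop :=
  ∃ U : ∀ n k : ℕ, G.SymDual k →ₗ[ℂ] G.SymDual n,
    (∀ n k, Continuous[G.indTopology k, G.indTopology n] (U n k)) ∧
    (∀ n, U n n = LinearMap.id) ∧
    ∀ n ω, S n ω = ∑ k ∈ Finset.range (n + 1), U n k (G.dpow ω k)

/-- A Sheffer sequence with generating function
`∑ n, (1 / n!) ⟨S n ω, ξ^{⊗ n}⟩ = exp ⟨ω, A(ξ)⟩ / ρ(A(ξ))`, where `A(ξ) = ξ + ∑_{k ≥ 2} A_k ξ^{⊗ k}`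
and `ρ(ξ) = 1 + ∑_{n ≥ 1} ⟨ρ_n, ξ^{⊗ n}⟩`.  As usual, an equality of formal power series in `ξ ∈ Φ`
means that they are equal, for each `ξ`, as formal power series in `z ∈ ℂ` after replacing `ξ`
by `z ξ`. -/
structure IsSheffer (S : ∀ n : ℕ, G.Dual → G.SymDual n) (A : G.FormalSeries G.Phi)
    (ρ : G.FormalSeries ℂ) : Prop where
  monic : IsMonicSequence S
  A_zero : A 0 = 0
  A_one : ∀ ξ, A 1 (G.tpow ξ 1) = ξ
  rho_zero : ∀ ξ, ρ 0 (G.tpow ξ 0) = 1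
  generating : ∀ (ω : G.Dual) (ξ : G.Phi),
    PowerSeries.mk (fun n => (n.factorial : ℂ)⁻¹ * S n ω (G.tpow ξ n)) =
      (PowerSeries.exp ℂ).subst (PowerSeries.mk fun k => ω (A k (G.tpow ξ k))) *
        (PowerSeries.mk (compCoeff ρ A ξ))⁻¹

end NuclearScale

/-- Holomorphic functions on an open subset `U` of a topological vector space: continuous and
Gateaux holomorphic. -/
def HolomorphicOn {E : Type*} [AddCommGroup E] [Module ℂ E] [TopologicalSpace E]
    (f : E → ℂ) (U : Set E) : Prop :=
  ContinuousOn f U ∧ ∀ ξ ∈ U, ∀ η : E, ∃ r > (0 : ℝ),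
    DifferentiableOn ℂ (fun z : ℂ => f (ξ + z • η)) (Metric.ball 0 r)

namespace NuclearScale

variable {T : Type*} {G : NuclearScale T}

/-- The formal power series `ρ(ξ) = ∑ n, ⟨ρ_n, ξ^{⊗ n}⟩` is holomorphic on a neighborhood of zero
in `Φ`: it converges there, to a holomorphic function. -/
def HolomorphicNearZero (ρ : G.FormalSeries ℂ) : Prop :=
  ∃ (U : Set G.Phi) (f : G.Phi → ℂ), IsOpen U ∧ 0 ∈ U ∧ HolomorphicOn f U ∧
    ∀ ξ ∈ U, HasSum (fun n => ρ n (G.tpow ξ n)) (f ξ)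

variable (G)

/-! ### Entire functions of order at most `α` and minimal type -/

/-- The orders of growth entering the definition of the space: only `α` if `α ≠ 0`, and all
positive orders if `α = 0`. -/
def orders (α : ℝ) : Set ℝ := if α = 0 then Set.Ioi 0 else {α}

/-- The weighted absolute value `|f(ω)| exp(-2^{-l} ‖ω‖_{-τ}^β)`. -/
def weighted (β : ℝ) (τ : T) (l : ℕ) (f : G.Dual → ℂ) (ω : G.H τ →L[ℂ] ℂ) : ℝ :=
  ‖f (G.dualIncl τ ω)‖ * Real.exp (-((2 : ℝ) ^ l)⁻¹ * ‖ω‖ ^ β)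

/-- The vector space of functions `f : Φ' → ℂ` whose restriction to each Hilbert space `H_{-τ}` is
entire and satisfies `sup |f(ω)| exp(-2^{-l} ‖ω‖_{-τ}^β) < ∞` for all `l`, where `β = α` if `α > 0`,
and `β` is any positive number if `α = 0`. -/
def eminSubmodule (α : ℝ) : Submodule ℂ (G.Dual → ℂ) where
  carrier := {f | ∀ β ∈ orders α, ∀ τ, HolomorphicOn (fun ω => f (G.dualIncl τ ω)) Set.univ ∧
    ∀ l, BddAbove (Set.range (G.weighted β τ l f))}
  add_mem' := by
    intro f g hf hg β hβ τ
    obtain ⟨⟨hf1, hf2⟩, hf3⟩ := hf β hβ τ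
    obtain ⟨⟨hg1, hg2⟩, hg3⟩ := hg β hβ τ
    refine ⟨⟨hf1.add hg1, fun ξ hξ η => ?_⟩, fun l => ?_⟩
    · obtain ⟨r, hr, h⟩ := hf2 ξ hξ η
      obtain ⟨s, hs, k⟩ := hg2 ξ hξ η
      exact ⟨min r s, lt_min hr hs, (h.mono (Metric.ball_subset_ball (min_le_left _ _))).add
        (k.mono (Metric.ball_subset_ball (min_le_right _ _)))⟩
    · obtain ⟨a, ha⟩ := hf3 l
      obtain ⟨b, hb⟩ := hg3 l
      refine ⟨a + b, ?_⟩
      rintro _ ⟨ω, rfl⟩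
      refine le_trans ?_ (add_le_add (ha ⟨ω, rfl⟩) (hb ⟨ω, rfl⟩))
      simp only [weighted, ← add_mul]
      exact mul_le_mul_of_nonneg_right (norm_add_le _ _) (Real.exp_nonneg _)
  zero_mem' := by
    intro β _ τ
    refine ⟨⟨continuousOn_const, fun ξ _ η => ⟨1, one_pos, differentiableOn_const _⟩⟩,
      fun l => ⟨0, ?_⟩⟩
    rintro _ ⟨ω, rfl⟩
    simp [weighted]
  smul_mem' := by
    intro c f hf β hβ τ
    obtain ⟨⟨hf1, hf2⟩, hf3⟩ := hf β hβ τ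
    refine ⟨⟨hf1.const_smul c, fun ξ hξ η => ?_⟩, fun l => ?_⟩
    · obtain ⟨r, hr, h⟩ := hf2 ξ hξ η
      exact ⟨r, hr, h.const_smul c⟩
    · obtain ⟨a, ha⟩ := hf3 l
      refine ⟨‖c‖ * a, ?_⟩
      rintro _ ⟨ω, rfl⟩
      refine le_trans (le_of_eq ?_) (mul_le_mul_of_nonneg_left (ha ⟨ω, rfl⟩) (norm_nonneg c))
      simp [weighted, mul_assoc]

/-- The space `E^α_min(Φ')`. -/
def Emin (α : ℝ) : Type _ := ↥(G.eminSubmodule α)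

instance (α : ℝ) : AddCommGroup (G.Emin α) := inferInstanceAs (AddCommGroup (G.eminSubmodule α))

instance (α : ℝ) : Module ℂ (G.Emin α) := inferInstanceAs (Module ℂ (G.eminSubmodule α))

instance (α : ℝ) : CoeFun (G.Emin α) (fun _ => G.Dual → ℂ) := ⟨fun f => f.1⟩

/-- The norms `sup |f(ω)| exp(-2^{-l} ‖ω‖_{-τ}^β)`, the supremum being over `ω ∈ H_{-τ}`. -/
def growthNorm (α : ℝ) (i : orders α × T × ℕ) : Seminorm ℂ (G.Emin α) :=
  Seminorm.of (fun f => ⨆ ω, G.weighted i.1 i.2.1 i.2.2 f.1 ω)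
    (fun f g => by
      refine ciSup_le fun ω => ?_
      refine le_trans ?_ (add_le_add (le_ciSup ((f.2 i.1 i.1.2 i.2.1).2 i.2.2) ω)
        (le_ciSup ((g.2 i.1 i.1.2 i.2.1).2 i.2.2) ω))
      simp only [weighted, ← add_mul]
      exact mul_le_mul_of_nonneg_right (norm_add_le _ _) (Real.exp_nonneg _))
    (fun c f => by
      rw [Real.mul_iSup_of_nonneg (norm_nonneg c)]
      congr 1
      funext ω
      change ‖c * f.1 _‖ * _ = _
      rw [norm_mul, mul_assoc]
      rfl)

/-- The projective limit topology on `E^α_min(Φ')`. -/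
instance (α : ℝ) : TopologicalSpace (G.Emin α) :=
  (SeminormFamily.moduleFilterBasis (G.growthNorm α)).topology

variable {G}

/-- The representation `f(ω) = ∑ n, ⟨S n ω, φ n⟩`, the series converging in `E^α_min(Φ')`. -/
def IsExpansion (S : ∀ n : ℕ, G.Dual → G.SymDual n) {α : ℝ} (f : G.Emin α)
    (φ : ∀ n : ℕ, G.symPow n) : Prop :=
  ∃ t : ℕ → G.Emin α, (∀ n ω, t n ω = S n ω (φ n)) ∧
    Filter.Tendsto (fun N => ∑ n ∈ Finset.range N, t n) Filter.atTop (𝓝 f)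

end NuclearScale

/-! ### Projective limits of completions -/

section ProjLim

variable {V : Type*} [AddCommGroup V] [Module ℂ V]

/-- The uniform structure on `V` defined by a seminorm. -/
@[reducible] def seminormUniformSpace (p : Seminorm ℂ V) : UniformSpace V :=
  (AddGroupSeminorm.toSeminormedAddCommGroup p.toAddGroupSeminorm).toUniformSpace

/-- The completion of `V` in a norm `p`. -/
def NormCompletion (p : Seminorm ℂ V) : Type _ :=
  @UniformSpace.Completion V (seminormUniformSpace p)

instance (p : Seminorm ℂ V) : UniformSpace (NormCompletion p) :=
  @UniformSpace.Completion.uniformSpace V (seminormUniformSpace p)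

/-- The canonical map of `V` into its completion. -/
def toNormCompletion (p : Seminorm ℂ V) (x : V) : NormCompletion p :=
  @UniformSpace.Completion.coe' V (seminormUniformSpace p) x

/-- The continuous extension of the identity of `V` to a map from the completion in the norm `q` to
the completion in the norm `p`, meaningful if `p ≤ C q` for some `C`. -/
def connectingMap (p q : Seminorm ℂ V) : NormCompletion q → NormCompletion p :=
  @UniformSpace.Completion.map V (seminormUniformSpace q) V (seminormUniformSpace p) id

lemma connectingMap_coe (p q : Seminorm ℂ V) (C : ℝ) (h : ∀ x, p x ≤ C * q x) (x : V) :
    connectingMap p q (toNormCompletion q x) = toNormCompletion p x := by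
  refine @UniformSpace.Completion.map_coe V (seminormUniformSpace q) V (seminormUniformSpace p)
    id ?_ x
  let q' := AddGroupSeminorm.toSeminormedAddCommGroup q.toAddGroupSeminorm
  refine @Metric.uniformContinuous_iff V V q'.toPseudoMetricSpace
    (AddGroupSeminorm.toSeminormedAddCommGroup p.toAddGroupSeminorm).toPseudoMetricSpace id |>.2 ?_
  intro ε hε
  refine ⟨ε / (|C| + 1), by positivity, fun {a b} hab => ?_⟩
  have ha : q (-a + b) < ε / (|C| + 1) := hab
  change p (-a + b) < ε
  have h1 := h (-a + b)
  have h2 : C * q (-a + b) ≤ |C| * q (-a + b) :=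
    mul_le_mul_of_nonneg_right (le_abs_self C) (apply_nonneg q _)
  rw [lt_div_iff₀ (by positivity)] at ha
  have h3 := apply_nonneg q (-a + b)
  nlinarith

/-- The projective limit of the completions of `V` in the norms `p i`: the families of elements of
the completions that are compatible with all connecting maps, with the topology induced by the
product topology. -/
def ProjLim {ι : Type*} (p : ι → Seminorm ℂ V) : Type _ :=
  {x : ∀ i, NormCompletion (p i) //
    ∀ (i j : ι) (C : ℝ), (∀ v, p i v ≤ C * p j v) → connectingMap (p i) (p j) (x j) = x i}

instance {ι : Type*} (p : ι → Seminorm ℂ V) : TopologicalSpace (ProjLim p) :=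
  inferInstanceAs (TopologicalSpace {x : ∀ i, NormCompletion (p i) //
    ∀ (i j : ι) (C : ℝ), (∀ v, p i v ≤ C * p j v) → connectingMap (p i) (p j) (x j) = x i})

/-- The canonical map of `V` into the projective limit. -/
def toProjLim {ι : Type*} (p : ι → Seminorm ℂ V) (x : V) : ProjLim p :=
  ⟨fun i => toNormCompletion (p i) x, fun i j C h => connectingMap_coe (p i) (p j) C h x⟩

end ProjLim

end

/-! Replacing ω by cω in the generating function and comparing powers of c gives ⟨U_{n,k} ω^{⊗k},
ξ^{⊗n}⟩ = (n!/k!) [z^n] ⟨ω, A(zξ)⟩^k / ρ(A(zξ)). By transposition ⟨S^{(n)}(ω), φ⟩ = ∑_{k≤n} ⟨ω^{⊗k},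
V_{k,n} φ⟩. Since ρ is holomorphic and A quasi-holomorphic, these power series have geometric
majorants, whence ‖V_{k,n} φ‖_τ ≤ (n!/k!) 2 C^n ‖φ‖_{τ'} (`IsSheffer.exists_coeff_operators`).

Substituting ξ = B(zη) turns the generating function into ρ(zη) ∑_k ⟨S^{(k)}(ω), B(zη)^{⊗k}⟩ / k! =
exp(z⟨ω, η⟩). So monomials are combinations of Sheffer polynomials through operators W_{k,n}, which
invert the triangular matrix V. They are given on powers by the same kind of formula, with B and ρ
in place of A and 1/ρ(A), and so obey the same bounds (`IsSheffer.exists_operators`).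

These formulas only concern powers ξ^{⊗n} and ω^{⊗k}. Polarization together with a Hilbert–Schmidt
inclusion upgrades diagonal bounds to bounds in the Hilbert tensor norms, at the cost of a change of
τ and a geometric factor (`exists_norm_coords_le`, `exists_norm_le_of_tpow`).

Cauchy estimates give f(ω) = ∑ ⟨ω^{⊗n}, c_n(f)⟩ with (n!)^{1/α} L^n ‖c_n(f)‖_τ controlled by a
growth norm, for every L (`exists_taylorCoeff`); if α = 0, every positive order is used instead of
α. The Sheffer coordinates are D_k f = ∑_n W_{k,n} c_n(f). They satisfy the same estimates because
(k!)^{1/α} n!/k! ≤ (n!)^{1/α} for k ≤ n and α ≤ 1, while geometric factors are absorbed by L. The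
double series converges absolutely, which gives the expansion. Continuity of D_k and D_k⟨S^{(n)}, φ⟩
= δ_{kn} φ give its uniqueness (`IsSheffer.exists_coordinates`).

For (ii), the estimates in both directions say that the norms |||·||| and the growth norms define
the same topology. The space is complete, as locally uniform limits of entire functions are entire,
and a complete Hausdorff space is the projective limit of its completions in a directed defining
family of seminorms (`isHomeomorph_toProjLim`). -/

noncomputable section

/-! ### Polarization -/

section Polarization

variable {n : ℕ} {X Y : Type*} [AddCommGroup X] [Module ℂ X] [AddCommGroup Y] [Module ℂ Y]

/-- Polarization formula for multilinear maps. -/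
theorem MultilinearMap.sum_neg_one_pow_smul_diag
    (F : MultilinearMap ℂ (fun _ : Fin n => X) Y) (x : Fin n → X) :
    ∑ s : Finset (Fin n), ((-1 : ℤ) ^ sᶜ.card) • F (fun _ => ∑ i ∈ s, x i) =
      ∑ σ : Equiv.Perm (Fin n), F (x ∘ σ) := by
  classical
  -- Expanding F gives a sum over maps r with image in s. The alternating sum over all s containing
  -- the image of r vanishes unless r is onto, so only permutations survive.
  have h1 : ∀ s : Finset (Fin n), F (fun _ => ∑ i ∈ s, x i) =
      ∑ r : Fin n → Fin n, if Finset.univ.image r ⊆ s then F (x ∘ r) else 0 := fun s => by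
    rw [F.map_sum_finset (fun _ i => x i) (fun _ => s), ← Finset.sum_filter]
    refine Finset.sum_congr ?_ fun _ _ => rfl
    ext r
    simp [Fintype.mem_piFinset, Finset.image_subset_iff]
  have h2 : ∀ t : Finset (Fin n), ∑ s : Finset (Fin n), (if t ⊆ s then (-1 : ℤ) ^ sᶜ.card else 0) =
      if t = Finset.univ then 1 else 0 := fun t => by
    have h3 := Finset.sum_powerset_neg_one_pow_card (x := tᶜ)
    simp only [Finset.compl_eq_empty_iff] at h3
    rw [← h3, ← Finset.sum_filter]
    refine Finset.sum_bij' (fun s _ => sᶜ) (fun s _ => sᶜ) ?_ ?_ ?_ ?_ ?_ <;>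
      simp [Finset.subset_compl_comm]
  simp only [h1, Finset.smul_sum]
  rw [Finset.sum_comm]
  have h4 : ∀ r : Fin n → Fin n, ∑ s : Finset (Fin n), ((-1 : ℤ) ^ sᶜ.card) •
      (if Finset.univ.image r ⊆ s then F (x ∘ r) else 0) =
      if Finset.univ.image r = Finset.univ then F (x ∘ r) else 0 := fun r => by
    have := congrArg (fun c : ℤ => c • F (x ∘ r)) (h2 (Finset.univ.image r))
    simp only [Finset.sum_smul, ite_smul, zero_smul, one_smul] at this
    simpa only [smul_ite, smul_zero] using this
  simp only [h4]
  rw [← Finset.sum_filter]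
  refine (Finset.sum_bij (fun (σ : Equiv.Perm (Fin n)) _ => (σ : Fin n → Fin n)) ?_ ?_ ?_ ?_).symm
  · intro σ _
    simp only [Finset.mem_filter, Finset.mem_univ, true_and]
    exact Finset.image_univ_of_surjective σ.surjective
  · intro σ _ π _ h
    exact DFunLike.coe_injective h
  · intro r hr
    simp only [Finset.mem_filter, Finset.mem_univ, true_and] at hr
    have hsurj : Function.Surjective r := fun y => by
      have : y ∈ Finset.univ.image r := by rw [hr]; exact Finset.mem_univ y
      simpa using this
    exact ⟨Equiv.ofBijective r (Finite.surjective_iff_bijective.1 hsurj), Finset.mem_univ _, rfl⟩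
  · intros; rfl

theorem MultilinearMap.sum_neg_one_pow_smul_diag_of_symm
    (F : MultilinearMap ℂ (fun _ : Fin n => X) Y)
    (hF : ∀ (σ : Equiv.Perm (Fin n)) (x : Fin n → X), F (x ∘ σ) = F x) (x : Fin n → X) :
    ∑ s : Finset (Fin n), ((-1 : ℤ) ^ sᶜ.card) • F (fun _ => ∑ i ∈ s, x i) =
      (n.factorial : ℂ) • F x := by
  rw [F.sum_neg_one_pow_smul_diag]
  simp [hF, Fintype.card_perm, Nat.cast_smul_eq_nsmul]

/-- A symmetric multilinear map is determined by its values on the diagonal. -/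
theorem MultilinearMap.eq_of_diag_eq {F F' : MultilinearMap ℂ (fun _ : Fin n => X) Y}
    (hF : ∀ (σ : Equiv.Perm (Fin n)) (x : Fin n → X), F (x ∘ σ) = F x)
    (hF' : ∀ (σ : Equiv.Perm (Fin n)) (x : Fin n → X), F' (x ∘ σ) = F' x)
    (h : ∀ x, F (fun _ => x) = F' (fun _ => x)) : F = F' := by
  ext x
  have h1 := F.sum_neg_one_pow_smul_diag_of_symm hF x
  rw [← smul_right_inj (show (n.factorial : ℂ) ≠ 0 by exact_mod_cast n.factorial_ne_zero),
    ← h1, ← F'.sum_neg_one_pow_smul_diag_of_symm hF' x]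
  simp [h]

/-- Since n^n / n! ≤ e^n ≤ 3^n. It turns the constant 2^n n^n / n! of the polarization inequality
into the geometric factor 6^n. -/
theorem pow_self_mul_two_pow_le (n : ℕ) : (2 : ℝ) ^ n * (n : ℝ) ^ n ≤ 6 ^ n * n.factorial := by
  have h1 : (n : ℝ) ^ n / n.factorial ≤ Real.exp n := Real.pow_div_factorial_le_exp _ (by positivity) n
  have h2 : Real.exp n ≤ 3 ^ n := by
    rw [← mul_one (n : ℝ), Real.exp_nat_mul]
    exact pow_le_pow_left₀ (Real.exp_nonneg _) Real.exp_one_lt_three.le n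
  rw [div_le_iff₀ (by positivity)] at h1
  have h3 : (6 : ℝ) ^ n = 2 ^ n * 3 ^ n := by rw [← mul_pow]; norm_num
  rw [h3, mul_assoc]
  gcongr
  exact h1.trans (by gcongr)

/-- The polarization inequality. -/
theorem MultilinearMap.norm_le_of_norm_diag_le (p : Seminorm ℂ X) (hp : ∀ x, p x = 0 → x = 0)
    (F : MultilinearMap ℂ (fun _ : Fin n => X) ℂ)
    (hF : ∀ (σ : Equiv.Perm (Fin n)) (x : Fin n → X), F (x ∘ σ) = F x) {M : ℝ}
    (h : ∀ x, ‖F fun _ => x‖ ≤ M * p x ^ n) (x : Fin n → X) :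
    ‖F x‖ ≤ M * 6 ^ n * ∏ i, p (x i) := by
  by_cases hx : ∃ i, x i = 0
  · obtain ⟨i, hi⟩ := hx
    rw [F.map_coord_zero i hi, norm_zero, Finset.prod_eq_zero (Finset.mem_univ i) (by simp [hi]),
      mul_zero]
  push Not at hx
  have hpos : ∀ i, 0 < p (x i) := fun i =>
    lt_of_le_of_ne (apply_nonneg p _) fun h0 => hx i (hp _ h0.symm)
  let y : Fin n → X := fun i => ((p (x i))⁻¹ : ℂ) • x i
  have hpc : ∀ i, ((p (x i) : ℝ) : ℂ) ≠ 0 := fun i => by exact_mod_cast (hpos i).ne'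
  have hy : ∀ i, p (y i) = 1 := fun i => by
    have := (hpos i).ne'
    simp [y, map_smul_eq_mul, abs_of_pos (hpos i), this]
  have hxy : x = fun i => ((p (x i) : ℝ) : ℂ) • y i := by
    funext i
    simp [y, smul_smul, mul_inv_cancel₀ (hpc i)]
  have hM : 0 ≤ M := by
    rcases Nat.eq_zero_or_pos n with h0 | h0
    · subst h0
      simpa using (norm_nonneg _).trans (h 0)
    · have h1 := (norm_nonneg _).trans (h (y ⟨0, h0⟩))
      rwa [hy, one_pow, mul_one] at h1
  -- Each of the 2^n subset sums of the normalized vectors has seminorm at most n, so polarization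
  -- bounds n! ‖F y‖ by 2^n n^n M.
  have key : ‖F y‖ ≤ M * 6 ^ n := by
    have h1 := F.sum_neg_one_pow_smul_diag_of_symm hF y
    have h2 : (n.factorial : ℝ) * ‖F y‖ ≤ 2 ^ n * (M * n ^ n) := by
      have : (n.factorial : ℝ) * ‖F y‖ = ‖(n.factorial : ℂ) • F y‖ := by simp
      rw [this, ← h1]
      refine (norm_sum_le _ _).trans ((Finset.sum_le_card_nsmul _ _ (M * n ^ n) ?_).trans ?_)
      · intro s _
        have h3 : ‖((-1 : ℤ) ^ sᶜ.card) • F (fun _ => ∑ i ∈ s, y i)‖ =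
            ‖F (fun _ => ∑ i ∈ s, y i)‖ := by
          rcases neg_one_pow_eq_or ℤ sᶜ.card with h | h <;> simp [h]
        rw [h3]
        refine (h _).trans ?_
        gcongr
        refine (Finset.le_sum_of_subadditive p (by simp) (map_add_le_add p) s y).trans ?_
        simp only [hy, Finset.sum_const, nsmul_eq_mul, mul_one]
        exact_mod_cast (Finset.card_le_univ s).trans (by simp)
      · simp
    have h4 := pow_self_mul_two_pow_le n
    have h5 : (n.factorial : ℝ) * ‖F y‖ ≤ n.factorial * (M * 6 ^ n) := by
      nlinarith
    exact le_of_mul_le_mul_left h5 (by positivity)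
  have h6 : F x = (∏ i, ((p (x i) : ℝ) : ℂ)) • F y := by
    conv_lhs => rw [hxy]
    exact F.map_smul_univ _ _
  have h7 : ‖F x‖ = (∏ i, p (x i)) * ‖F y‖ := by
    rw [h6, norm_smul, norm_prod]
    congr 1
    exact Finset.prod_congr rfl fun i _ => by simp [abs_of_pos (hpos i)]
  rw [h7, mul_comm]
  exact mul_le_mul_of_nonneg_right key (Finset.prod_nonneg fun i _ => (hpos i).le)

end Polarization

/-! ### Hilbert-Schmidt operators -/

section HilbertSchmidt

variable {E F : Type*} [NormedAddCommGroup E] [InnerProductSpace ℂ E]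
  [NormedAddCommGroup F] [InnerProductSpace ℂ F]

theorem HilbertBasis.hasSum_norm_inner_sq {ι : Type*} (b : HilbertBasis ι ℂ E) (x : E) :
    HasSum (fun k => ‖inner ℂ (b k) x‖ ^ 2) (‖x‖ ^ 2) := by
  have h := b.hasSum_inner_mul_inner x x
  have h2 := Complex.hasSum_re h
  have h3 : (inner ℂ x x).re = ‖x‖ ^ 2 := by
    rw [inner_self_eq_norm_sq_to_K]; norm_cast
  rw [h3] at h2
  refine h2.congr_fun ?_ |> fun h => h
  intro k
  rw [← inner_conj_symm x (b k), Complex.conj_mul', ← Complex.ofReal_pow, Complex.ofReal_re]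

variable [CompleteSpace E] [CompleteSpace F]

/-- The adjoint of a Hilbert-Schmidt operator: the squared norms of the images of orthonormal
systems are bounded. -/
theorem IsHilbertSchmidt.exists_sum_adjoint_le {i : E →L[ℂ] F} (hi : IsHilbertSchmidt i) :
    ∃ K : ℝ, 0 ≤ K ∧ ∀ (m : ℕ) (v : Fin m → F), Orthonormal ℂ v →
      ∑ j, ‖ContinuousLinearMap.adjoint i (v j)‖ ^ 2 ≤ K ^ 2 := by
  obtain ⟨w, b, hs⟩ := hi
  have hS : 0 ≤ ∑' k, ‖i (b k)‖ ^ 2 := tsum_nonneg fun k => by positivity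
  refine ⟨Real.sqrt (∑' k, ‖i (b k)‖ ^ 2), Real.sqrt_nonneg _, fun m v hv => ?_⟩
  rw [Real.sq_sqrt hS]
  -- Parseval in E for each i*(v_j). After exchanging the sums, what remains for each k is Bessel's
  -- inequality in F for the vector i(b_k).
  have h1 : HasSum (fun k => ∑ j, ‖inner ℂ (b k) (ContinuousLinearMap.adjoint i (v j))‖ ^ 2)
      (∑ j, ‖ContinuousLinearMap.adjoint i (v j)‖ ^ 2) :=
    hasSum_sum fun j _ => b.hasSum_norm_inner_sq _
  refine hasSum_le (fun k => ?_) h1 hs.hasSum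
  have h2 := hv.sum_inner_products_le (x := i (b k)) (s := Finset.univ)
  refine le_trans (le_of_eq (Finset.sum_congr rfl fun j _ => ?_)) h2
  rw [ContinuousLinearMap.adjoint_inner_right, norm_inner_symm]

/-- The squared norms of the images of orthonormal systems under a Hilbert-Schmidt operator are
bounded. -/
theorem IsHilbertSchmidt.exists_sum_le {i : E →L[ℂ] F} (hi : IsHilbertSchmidt i) :
    ∃ K : ℝ, 0 ≤ K ∧ ∀ (m : ℕ) (v : Fin m → E), Orthonormal ℂ v →
      ∑ j, ‖i (v j)‖ ^ 2 ≤ K ^ 2 := by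
  obtain ⟨K, hK, h⟩ := hi.exists_sum_adjoint_le
  refine ⟨K, hK, fun m v hv => ?_⟩
  -- Parseval in the finite-dimensional span of the i(v_j) replaces a basis of F, and the bound for
  -- the adjoint applies to this finite orthonormal system.
  let W : Submodule ℂ F := Submodule.span ℂ (Set.range fun j => i (v j))
  have : FiniteDimensional ℂ W := FiniteDimensional.span_of_finite ℂ (Set.finite_range _)
  let e := stdOrthonormalBasis ℂ W
  have he : Orthonormal ℂ fun p => (e p : F) := e.orthonormal.comp_linearIsometry W.subtypeₗᵢ
  have h1 : ∀ j, ‖i (v j)‖ ^ 2 = ∑ p, ‖inner ℂ (v j) (ContinuousLinearMap.adjoint i (e p : F))‖ ^ 2 :=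
    fun j => by
      let y : W := ⟨i (v j), Submodule.subset_span ⟨j, rfl⟩⟩
      have h2 := e.sum_sq_norm_inner_right y
      change ‖y‖ ^ 2 = _
      rw [← h2]
      refine Finset.sum_congr rfl fun p _ => ?_
      rw [ContinuousLinearMap.adjoint_inner_right, norm_inner_symm]
      rfl
  simp only [h1]
  rw [Finset.sum_comm]
  refine le_trans (Finset.sum_le_sum fun p _ => ?_) (h _ _ he)
  exact hv.sum_inner_products_le (x := ContinuousLinearMap.adjoint i (e p : F)) (s := Finset.univ)

end HilbertSchmidt

end

noncomputable section

namespace NuclearScale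

variable {T : Type*} (G : NuclearScale T)

/-! ### The spaces `Φ`, `Φ'` and `H_{-τ}` -/

instance (n : ℕ) : IsTopologicalAddGroup (G.symPow n) :=
  (G.symPow_withSeminorms n).topologicalAddGroup

instance (n : ℕ) : ContinuousSMul ℂ (G.symPow n) :=
  (G.symPow_withSeminorms n).continuousSMul

theorem incl_injective (τ : T) : Function.Injective (G.incl τ) := fun ξ η h => by
  have h' : ξ.1 τ = η.1 τ := h
  have hc : ξ.1 G.center = η.1 G.center := by rw [← ξ.2 τ, ← η.2 τ, h']
  ext σ
  apply G.emb_injective σ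
  rw [ξ.2 σ, η.2 σ, hc]

theorem denseRange_incl (τ : T) : DenseRange (G.incl τ) := by
  refine (G.dense τ).mono fun x hx => ?_
  choose y hy using hx
  have hyτ : y τ = x := G.emb_injective τ (hy τ)
  have hyc : y G.center = G.emb τ x := by
    have := hy G.center
    rwa [G.emb_center] at this
  exact ⟨⟨y, fun σ => (hy σ).trans hyc.symm⟩, hyτ⟩

@[simp] theorem riesz_apply (τ : T) (x : G.H τ) (ξ : G.Phi) :
    G.riesz τ x ξ = inner ℂ x (G.incl τ ξ) := rfl

theorem riesz_add (τ : T) (x y : G.H τ) : G.riesz τ (x + y) = G.riesz τ x + G.riesz τ y := by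
  ext; simp

theorem riesz_smul (τ : T) (c : ℂ) (x : G.H τ) :
    G.riesz τ (c • x) = (starRingEnd ℂ c) • G.riesz τ x := by
  ext; simp [mul_comm]

theorem riesz_toDual_symm (τ : T) (ω : G.H τ →L[ℂ] ℂ) :
    G.riesz τ ((InnerProductSpace.toDual ℂ (G.H τ)).symm ω) = G.dualIncl τ ω := by
  ext ξ
  exact InnerProductSpace.toDual_symm_apply

theorem dualIncl_toDual (τ : T) (x : G.H τ) :
    G.dualIncl τ (InnerProductSpace.toDual ℂ (G.H τ) x) = G.riesz τ x := rfl

theorem norm_riesz_apply_le (τ : T) (x : G.H τ) (ξ : G.Phi) :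
    ‖G.riesz τ x ξ‖ ≤ ‖x‖ * ‖G.incl τ ξ‖ := norm_inner_le_norm _ _

/-- A functional bounded with respect to `‖·‖_τ` belongs to `H_{-τ}`. -/
theorem exists_riesz_of_bound (τ : T) (ω : G.Dual) {M : ℝ} (hM : 0 ≤ M)
    (h : ∀ ξ, ‖ω ξ‖ ≤ M * ‖G.incl τ ξ‖) : ∃ x : G.H τ, G.riesz τ x = ω ∧ ‖x‖ ≤ M := by
  refine ⟨(InnerProductSpace.toDual ℂ (G.H τ)).symm
    (ω.toLinearMap.extendOfNorm (G.incl τ).toLinearMap), ?_, ?_⟩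
  · rw [riesz_toDual_symm]
    ext ξ
    exact LinearMap.extendOfNorm_eq (e := (G.incl τ).toLinearMap) (f := ω.toLinearMap)
      (G.denseRange_incl τ) ⟨M, h⟩ ξ
  · rw [LinearIsometryEquiv.norm_map]
    exact LinearMap.opNorm_extendOfNorm_le (G.denseRange_incl τ) hM h

/-- Dualizes the domination of norms on Φ: if ‖·‖_σ ≤ C ‖·‖_τ, then H_{-σ} ⊂ H_{-τ} with the same
constant, expressed through Riesz representatives. -/
theorem exists_riesz_lift (s : Finset T) : ∃ (τ : T) (C : ℝ), 0 ≤ C ∧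
    (∀ σ ∈ s, ∀ ξ : G.Phi, ‖G.incl σ ξ‖ ≤ C * ‖G.incl τ ξ‖) ∧
    ∀ σ ∈ s, ∀ x : G.H σ, ∃ y : G.H τ, G.riesz τ y = G.riesz σ x ∧ ‖y‖ ≤ C * ‖x‖ := by
  obtain ⟨τ, C, hC, h⟩ := G.exists_common_bound s
  refine ⟨τ, C, hC, h, fun σ hσ x => G.exists_riesz_of_bound τ _ (by positivity) fun ξ => ?_⟩
  calc ‖G.riesz σ x ξ‖ ≤ ‖x‖ * ‖G.incl σ ξ‖ := G.norm_riesz_apply_le σ x ξ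
    _ ≤ ‖x‖ * (C * ‖G.incl τ ξ‖) := by gcongr; exact h σ hσ ξ
    _ = _ := by ring

/-- Finitely many elements of `Φ'` lie in a common `H_{-τ}`. -/
theorem exists_common_riesz {ι : Type*} [Finite ι] (ω : ι → G.Dual) :
    ∃ (τ : T) (x : ι → G.H τ), ∀ i, G.riesz τ (x i) = ω i := by
  classical
  cases nonempty_fintype ι
  choose σ x hx using fun i => G.exists_riesz (ω i)
  obtain ⟨τ, C, -, -, h⟩ := G.exists_riesz_lift (Finset.univ.image σ)
  choose y hy using fun i => h (σ i) (Finset.mem_image_of_mem _ (Finset.mem_univ i)) (x i)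
  exact ⟨τ, y, fun i => (hy i).1.trans (hx i)⟩

/-- Hilbert-Schmidt inclusions `H τ' ⊂ H τ` and `H_{-τ} ⊂ H_{-τ'}`. -/
theorem exists_hilbertSchmidt (τ : T) : ∃ (τ' : T) (K : ℝ), 0 ≤ K ∧
    (∀ (m : ℕ) (v : Fin m → G.H τ), Orthonormal ℂ v → ∃ y : Fin m → G.H τ',
      (∀ j, G.riesz τ' (y j) = G.riesz τ (v j)) ∧ ∑ j, ‖y j‖ ^ 2 ≤ K ^ 2) ∧
    (∀ (m : ℕ) (u : Fin m → G.Phi), Orthonormal ℂ (fun j => G.incl τ' (u j)) →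
      ∑ j, ‖G.incl τ (u j)‖ ^ 2 ≤ K ^ 2) := by
  obtain ⟨τ', i, hi, hs⟩ := G.nuclear τ
  have hincl : ∀ ξ : G.Phi, i (G.incl τ' ξ) = G.incl τ ξ := fun ξ => by
    apply G.emb_injective τ
    have h1 := congrArg (fun f => f (G.incl τ' ξ)) hi
    simp only [ContinuousLinearMap.comp_apply] at h1
    rw [h1]
    exact (ξ.2 τ').trans (ξ.2 τ).symm
  obtain ⟨K, hK, h1⟩ := hs.exists_sum_adjoint_le
  obtain ⟨L, hL, h2⟩ := hs.exists_sum_le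
  refine ⟨τ', max K L, le_max_of_le_left hK, fun m v hv => ?_, fun m u hu => ?_⟩
  · refine ⟨fun j => ContinuousLinearMap.adjoint i (v j), fun j => ?_, (h1 m v hv).trans ?_⟩
    · ext ξ
      rw [riesz_apply, ContinuousLinearMap.adjoint_inner_left, hincl]
      rfl
    · gcongr
      exact le_max_left _ _
  · have h3 := h2 m _ hu
    simp only [hincl] at h3
    refine h3.trans ?_
    gcongr
    exact le_max_right _ _

/-! ### Symmetric tensors -/

variable {G}

theorem coords_le_tnorm {n : ℕ} {τ : T} (v : G.OrthoSys τ) (φ : G.symPow n) :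
    ‖G.coords v φ.1‖ ≤ G.tnorm τ φ := le_ciSup (φ.2.2 τ) v

theorem tnorm_le {n : ℕ} {τ : T} {φ : G.symPow n} {M : ℝ}
    (h : ∀ v : G.OrthoSys τ, ‖G.coords v φ.1‖ ≤ M) : G.tnorm τ φ ≤ M := ciSup_le h

theorem norm_coords_sq {n : ℕ} {τ : T} (v : G.OrthoSys τ)
    (F : MultilinearMap ℂ (fun _ : Fin n => G.Dual) ℂ) :
    ‖G.coords v F‖ ^ 2 = ∑ k : Fin n → Fin v.1, ‖F fun i => G.riesz τ (v.2.1 (k i))‖ ^ 2 :=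
  EuclideanSpace.norm_sq_eq _

theorem sum_prod_eq_sum_pow {ι : Type*} [Fintype ι] [DecidableEq ι] (n : ℕ) (f : ι → ℝ) :
    ∑ k : Fin n → ι, ∏ i, f (k i) = (∑ j, f j) ^ n := by
  have h := Finset.prod_univ_sum (fun _ : Fin n => (Finset.univ : Finset ι)) fun _ j => f j
  rw [Fintype.piFinset_univ] at h
  rw [← h]
  simp

/-- Polarization in H_{-τ}. Because of it, all later estimates of symmetric forms need to be checked
only on the diagonal. -/
theorem norm_apply_riesz_le_of_diag {n : ℕ} {τ : T}
    (F : MultilinearMap ℂ (fun _ : Fin n => G.Dual) ℂ)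
    (hF : ∀ (σ : Equiv.Perm (Fin n)) (ω : Fin n → G.Dual), F (ω ∘ σ) = F ω) {M : ℝ}
    (h : ∀ x : G.H τ, ‖F fun _ => G.riesz τ x‖ ≤ M * ‖x‖ ^ n) (x : Fin n → G.H τ) :
    ‖F fun i => G.riesz τ (x i)‖ ≤ M * 6 ^ n * ∏ i, ‖x i‖ := by
  have h1 := (F.compLinearMap fun _ => G.dualIncl τ).norm_le_of_norm_diag_le
    (normSeminorm ℂ (G.H τ →L[ℂ] ℂ)) (fun x hx => norm_eq_zero.1 hx)
    (fun σ ω => hF σ fun i => G.dualIncl τ (ω i)) (M := M)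
    (fun ω => by
      have h2 := h ((InnerProductSpace.toDual ℂ (G.H τ)).symm ω)
      rw [riesz_toDual_symm, LinearIsometryEquiv.norm_map] at h2
      exact h2)
    fun i => InnerProductSpace.toDual ℂ (G.H τ) (x i)
  simpa [dualIncl_toDual] using h1

theorem norm_apply_riesz_le {n : ℕ} {τ : T} (φ : G.symPow n) (x : Fin n → G.H τ) :
    ‖φ.1 fun i => G.riesz τ (x i)‖ ≤ G.tnorm τ φ * 6 ^ n * ∏ i, ‖x i‖ :=
  norm_apply_riesz_le_of_diag φ.1 φ.2.1
    (fun x => by rw [mul_comm]; exact G.norm_diag_le τ x φ) x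

/-- The basic nuclear estimate: bounds on `H_{-τ'}` imply bounds for the Hilbert-Schmidt norm
on `H_{-τ}`. -/
theorem exists_norm_coords_le (τ : T) : ∃ (τ' : T) (K : ℝ), 0 ≤ K ∧ ∀ (n : ℕ)
    (F : MultilinearMap ℂ (fun _ : Fin n => G.Dual) ℂ),
    (∀ (σ : Equiv.Perm (Fin n)) (ω : Fin n → G.Dual), F (ω ∘ σ) = F ω) → ∀ M : ℝ, 0 ≤ M →
    (∀ x : G.H τ', ‖F fun _ => G.riesz τ' x‖ ≤ M * ‖x‖ ^ n) →
    ∀ v : G.OrthoSys τ, ‖G.coords v F‖ ≤ M * K ^ n := by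
  obtain ⟨τ', K, hK, h1, -⟩ := G.exists_hilbertSchmidt τ
  refine ⟨τ', 6 * K, by positivity, fun n F hF M hM0 hM v => ?_⟩
  -- Regard the orthonormal system of H_{-τ} as vectors of H_{-τ'}. Polarization bounds each
  -- coordinate by a product of the ‖y_j‖, and the sum of squares over all index tuples factorizes
  -- into the n-th power of a Hilbert–Schmidt sum.
  obtain ⟨y, hy, hys⟩ := h1 v.1 v.2.1 v.2.2
  have h2 : ‖G.coords v F‖ ^ 2 ≤ (M * (6 * K) ^ n) ^ 2 := by
    rw [norm_coords_sq]
    calc ∑ k : Fin n → Fin v.1, ‖F fun i => G.riesz τ (v.2.1 (k i))‖ ^ 2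
        ≤ ∑ k : Fin n → Fin v.1, (M * 6 ^ n) ^ 2 * ∏ i, ‖y (k i)‖ ^ 2 := by
          refine Finset.sum_le_sum fun k _ => ?_
          rw [Finset.prod_pow, ← mul_pow]
          gcongr
          have := norm_apply_riesz_le_of_diag F hF hM fun i => y (k i)
          simpa only [hy] using this
      _ = (M * 6 ^ n) ^ 2 * (∑ j, ‖y j‖ ^ 2) ^ n := by
          rw [← Finset.mul_sum]
          exact congrArg _ (sum_prod_eq_sum_pow n fun j => ‖y j‖ ^ 2)
      _ ≤ (M * 6 ^ n) ^ 2 * (K ^ 2) ^ n := by gcongr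
      _ = _ := by rw [← pow_mul, mul_comm 2 n, pow_mul, mul_pow 6 K]; ring
  exact le_of_sq_le_sq h2 (by positivity)

theorem mem_symPow_of_diag {n : ℕ} (F : MultilinearMap ℂ (fun _ : Fin n => G.Dual) ℂ)
    (hF : ∀ (σ : Equiv.Perm (Fin n)) (ω : Fin n → G.Dual), F (ω ∘ σ) = F ω)
    (h : ∀ τ, ∃ M : ℝ, ∀ x : G.H τ, ‖F fun _ => G.riesz τ x‖ ≤ M * ‖x‖ ^ n) : F ∈ G.symPow n := by
  refine ⟨hF, fun τ => ?_⟩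
  obtain ⟨τ', K, hK, hn⟩ := exists_norm_coords_le (G := G) τ
  obtain ⟨M, hM⟩ := h τ'
  refine ⟨|M| * K ^ n, ?_⟩
  rintro _ ⟨v, rfl⟩
  exact hn n F hF _ (abs_nonneg M) (fun x => (hM x).trans (by gcongr; exact le_abs_self M)) v

/-- Symmetric tensors are determined by their values on the diagonal. -/
theorem symPow_ext {n : ℕ} {φ ψ : G.symPow n}
    (h : ∀ ω : G.Dual, φ.1 (fun _ => ω) = ψ.1 (fun _ => ω)) : φ = ψ := by
  have h' : φ.1 = ψ.1 :=
    MultilinearMap.eq_of_diag_eq (X := G.Dual) (Y := ℂ) φ.2.1 ψ.2.1 h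
  exact Subtype.ext h'

theorem eq_zero_of_tnorm {n : ℕ} {φ : G.symPow n} (h : ∀ τ, G.tnorm τ φ = 0) : φ = 0 :=
  symPow_ext fun ω => by
    obtain ⟨τ, x, rfl⟩ := G.exists_riesz ω
    have := G.norm_diag_le τ x φ
    rw [h τ, mul_zero] at this
    exact norm_le_zero_iff.1 this

/-- The symmetric tensor product as a multilinear map. -/
def symTensorMap (n : ℕ) : MultilinearMap ℂ (fun _ : Fin n => G.Phi) (G.symPow n) where
  toFun ξ := G.symTensor ξ
  map_update_add' {_} ξ i x y := by
    refine Subtype.ext (MultilinearMap.ext fun ω => ?_)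
    change G.symForm _ ω = G.symForm _ ω + G.symForm _ ω
    simp only [symForm_apply, ← mul_add, ← Finset.sum_add_distrib]
    congr 1
    refine Finset.sum_congr rfl fun σ _ => ?_
    have h := ((MultilinearMap.mkPiAlgebra ℂ (Fin n) ℂ).compLinearMap
      fun i => (ω (σ i)).toLinearMap).map_update_add ξ i x y
    simp only [MultilinearMap.compLinearMap_apply, MultilinearMap.mkPiAlgebra_apply] at h
    exact h
  map_update_smul' {_} ξ i c x := by
    refine Subtype.ext (MultilinearMap.ext fun ω => ?_)
    change G.symForm _ ω = c • G.symForm _ ω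
    simp only [symForm_apply, smul_eq_mul, mul_left_comm c]
    congr 1
    rw [Finset.mul_sum]
    refine Finset.sum_congr rfl fun σ _ => ?_
    have h := ((MultilinearMap.mkPiAlgebra ℂ (Fin n) ℂ).compLinearMap
      fun i => (ω (σ i)).toLinearMap).map_update_smul ξ i c x
    simp only [MultilinearMap.compLinearMap_apply, MultilinearMap.mkPiAlgebra_apply] at h
    exact h

@[simp] theorem symTensorMap_apply {n : ℕ} (ξ : Fin n → G.Phi) :
    symTensorMap n ξ = G.symTensor ξ := rfl

theorem symTensor_comp_perm {n : ℕ} (ξ : Fin n → G.Phi) (σ : Equiv.Perm (Fin n)) :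
    G.symTensor (ξ ∘ σ) = G.symTensor ξ := by
  refine Subtype.ext (MultilinearMap.ext fun ω => ?_)
  change G.symForm _ ω = G.symForm _ ω
  simp only [symForm_apply]
  congr 1
  refine Fintype.sum_equiv (Equiv.mulRight σ⁻¹) _ _ fun π => ?_
  refine Fintype.prod_equiv σ _ _ fun i => ?_
  simp

theorem tpow_apply {n : ℕ} (ξ : G.Phi) (ω : Fin n → G.Dual) :
    (G.tpow ξ n).1 ω = ∏ i, ω i ξ := by
  change G.symForm _ ω = _
  rw [symForm_apply]
  have h : ∀ σ : Equiv.Perm (Fin n), ∏ i, ω (σ i) ξ = ∏ i, ω i ξ := fun σ =>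
    Fintype.prod_equiv σ _ _ fun i => rfl
  simp [h, Fintype.card_perm, n.factorial_ne_zero]

theorem symTensor_diag {n : ℕ} (ξ : Fin n → G.Phi) (ω : G.Dual) :
    (G.symTensor ξ).1 (fun _ => ω) = ∏ i, ω (ξ i) := by
  change G.symForm _ _ = _
  rw [symForm_apply]
  simp [Fintype.card_perm, n.factorial_ne_zero]

theorem tnorm_symTensor_le {n : ℕ} (τ : T) (ξ : Fin n → G.Phi) :
    G.tnorm τ (G.symTensor ξ) ≤ ∏ i, ‖G.incl τ (ξ i)‖ := by
  refine tnorm_le fun v => ?_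
  have h : G.coords v (G.symForm ξ) = (n.factorial : ℂ)⁻¹ • ∑ σ : Equiv.Perm (Fin n),
      (WithLp.toLp 2 fun k => ∏ i, G.riesz τ (v.2.1 (k (σ i))) (ξ i) :
        EuclideanSpace ℂ (Fin n → Fin v.1)) := by
    ext k
    change G.symForm ξ _ = _
    rw [symForm_apply]
    simp
  change ‖G.coords v (G.symForm ξ)‖ ≤ _
  rw [h, norm_smul]
  refine (mul_le_mul_of_nonneg_left ((norm_sum_le _ _).trans
    (Finset.sum_le_sum fun σ _ => G.coords_prod_le v ξ σ)) (norm_nonneg _)).trans (le_of_eq ?_)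
  simp [Fintype.card_perm, n.factorial_ne_zero]

theorem tnorm_tpow_le {n : ℕ} (τ : T) (ξ : G.Phi) :
    G.tnorm τ (G.tpow ξ n) ≤ ‖G.incl τ ξ‖ ^ n :=
  (tnorm_symTensor_le τ fun _ : Fin n => ξ).trans (by simp)

/-- The product `ω₁ ⊙ … ⊙ ω_n` of elements of `Φ'`, i.e. the functional `φ ↦ φ(ω₁, …, ω_n)`. -/
def dualTensor (n : ℕ) : MultilinearMap ℂ (fun _ : Fin n => G.Dual) (G.SymDual n) where
  toFun ω :=
    { toFun := fun φ => φ.1 ω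
      map_add' := fun _ _ => rfl
      map_smul' := fun _ _ => rfl
      cont := by
        obtain ⟨τ, x, hx⟩ := G.exists_common_riesz ω
        let f : G.symPow n →ₗ[ℂ] ℂ :=
          { toFun := fun φ => φ.1 ω
            map_add' := fun _ _ => rfl
            map_smul' := fun _ _ => rfl }
        refine (G.symPow_withSeminorms n).continuous_normedSpace_rng ℂ f
          ⟨{τ}, ⟨6 ^ n * ∏ i, ‖x i‖, by positivity⟩, fun φ => ?_⟩
        rw [Finset.sup_singleton]
        have h := norm_apply_riesz_le φ x
        simp only [hx] at h
        refine h.trans (le_of_eq ?_)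
        change _ = (6 ^ n * ∏ i, ‖x i‖) * G.tnorm τ φ
        ring }
  map_update_add' ω i x y := by
    ext φ
    exact φ.1.map_update_add ω i x y
  map_update_smul' ω i c x := by
    ext φ
    exact φ.1.map_update_smul ω i c x

@[simp] theorem dualTensor_apply {n : ℕ} (ω : Fin n → G.Dual) (φ : G.symPow n) :
    dualTensor n ω φ = φ.1 ω := rfl

theorem dpow_apply {n : ℕ} (ω : G.Dual) (φ : G.symPow n) : G.dpow ω n φ = φ.1 fun _ => ω := rfl

end NuclearScale
end

noncomputable section

namespace NuclearScale

variable {T : Type*} {G : NuclearScale T}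

/-! ### Density of the algebraic tensors -/

variable (G) in
/-- There is an orthonormal basis of `H τ` consisting of elements of `Φ`. -/
theorem exists_hilbertBasis_phi (τ : T) : ∃ (ι : Type) (e : ι → G.Phi)
    (b : HilbertBasis ι ℂ (G.H τ)), ∀ i, b i = G.incl τ (e i) := by
  classical
  have : Nonempty (Set.range (G.incl τ)) := ⟨⟨_, 0, rfl⟩⟩
  -- Gram–Schmidt applied to a dense sequence from the image of Φ stays in that linear subspace; the
  -- vectors that come out zero are discarded.
  obtain ⟨u, hu⟩ := TopologicalSpace.exists_dense_seq (Set.range (G.incl τ))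
  let f : ℕ → G.H τ := fun n => (u n : G.H τ)
  have hf : DenseRange f :=
    (G.denseRange_incl τ).denseRange_val.comp hu continuous_subtype_val
  let g := InnerProductSpace.gramSchmidtNormed ℂ f
  have hspan : Submodule.span ℂ (Set.range g) = Submodule.span ℂ (Set.range f) := by
    rw [InnerProductSpace.span_gramSchmidtNormed_range, InnerProductSpace.span_gramSchmidt]
  have hg : ∀ n, ∃ ξ : G.Phi, G.incl τ ξ = g n := fun n => by
    have h1 : g n ∈ Submodule.span ℂ (Set.range f) := hspan ▸ Submodule.subset_span ⟨n, rfl⟩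
    have h2 : Submodule.span ℂ (Set.range f) ≤ LinearMap.range (G.incl τ).toLinearMap := by
      rw [Submodule.span_le]
      rintro _ ⟨k, rfl⟩
      exact (u k).2
    exact h2 h1
  choose e he using hg
  have ho := InnerProductSpace.gramSchmidtNormed_orthonormal' (𝕜 := ℂ) f
  refine ⟨{n // g n ≠ 0}, fun n => e n, HilbertBasis.mk (v := fun n : {n // g n ≠ 0} => g n) ho ?_,
    fun i => ?_⟩
  · have h3 : Submodule.span ℂ (Set.range fun n : {n // g n ≠ 0} => g n) =
        Submodule.span ℂ (Set.range g) := by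
      refine le_antisymm (Submodule.span_mono ?_) (Submodule.span_le.2 ?_)
      · rintro _ ⟨n, rfl⟩
        exact ⟨n, rfl⟩
      · rintro _ ⟨n, rfl⟩
        by_cases h0 : g n = 0
        · rw [h0]; exact zero_mem _
        · exact Submodule.subset_span ⟨⟨n, h0⟩, rfl⟩
    rw [h3, hspan]
    intro x _
    exact closure_mono Submodule.subset_span (hf x)
  · rw [HilbertBasis.coe_mk]
    exact (he i).symm

/-- The map x ↦ l(⟪x, ·⟫) is antilinear, so its conjugate has a Riesz representative g. The left
side is then a Bessel sum for g and the right side its Parseval sum. The values are in `ENNReal` so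
that the inequality can be iterated without summability conditions. -/
theorem sum_norm_sq_le_tsum_one {τ : T} {ι : Type*} (b : HilbertBasis ι ℂ (G.H τ))
    (l : G.Dual →ₗ[ℂ] ℂ) {M : ℝ} (hl : ∀ x : G.H τ, ‖l (G.riesz τ x)‖ ≤ M * ‖x‖)
    {m : ℕ} {w : Fin m → G.H τ} (hw : Orthonormal ℂ w) :
    ∑ j, ENNReal.ofReal (‖l (G.riesz τ (w j))‖ ^ 2) ≤
      ∑' i, ENNReal.ofReal (‖l (G.riesz τ (b i))‖ ^ 2) := by
  let L : G.H τ →ₗ[ℂ] ℂ :=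
    { toFun := fun x => (starRingEnd ℂ) (l (G.riesz τ x))
      map_add' := fun x y => by rw [riesz_add, map_add, map_add]
      map_smul' := fun c x => by rw [riesz_smul, map_smul]; simp }
  let g := (InnerProductSpace.toDual ℂ (G.H τ)).symm
    (L.mkContinuous M fun x => by simpa [L] using hl x)
  have hg : ∀ x, ‖l (G.riesz τ x)‖ = ‖inner ℂ x g‖ := fun x => by
    rw [norm_inner_symm, InnerProductSpace.toDual_symm_apply]
    simp [L]
  simp only [hg]
  rw [← ENNReal.ofReal_sum_of_nonneg fun _ _ => by positivity,
    ← ENNReal.ofReal_tsum_of_nonneg (fun _ => by positivity) (b.hasSum_norm_inner_sq g).summable,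
    (b.hasSum_norm_inner_sq g).tsum_eq]
  exact ENNReal.ofReal_le_ofReal (hw.sum_inner_products_le (x := g) (s := Finset.univ))

theorem riesz_consEquiv {τ : T} {n : ℕ} {κ : Type*} (v : κ → G.H τ) (p : κ × (Fin n → κ)) :
    (fun i => G.riesz τ (v (Fin.consEquiv (fun _ => κ) p i))) =
      (Fin.cons (G.riesz τ (v p.1)) fun i => G.riesz τ (v (p.2 i)) : Fin (n + 1) → G.Dual) := by
  funext i
  refine Fin.cases ?_ (fun i => ?_) i <;> simp [Fin.consEquiv]

/-- The Hilbert-Schmidt norm can be computed in an orthonormal basis. -/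
theorem sum_norm_sq_le_tsum {τ : T} {ι : Type*} (b : HilbertBasis ι ℂ (G.H τ))
    {m : ℕ} {w : Fin m → G.H τ} (hw : Orthonormal ℂ w) {n : ℕ}
    (F : MultilinearMap ℂ (fun _ : Fin n => G.Dual) ℂ) {M : ℝ}
    (hM : ∀ x : Fin n → G.H τ, ‖F fun i => G.riesz τ (x i)‖ ≤ M * ∏ i, ‖x i‖) :
    ∑ k : Fin n → Fin m, ENNReal.ofReal (‖F fun i => G.riesz τ (w (k i))‖ ^ 2) ≤
      ∑' k : Fin n → ι, ENNReal.ofReal (‖F fun i => G.riesz τ (b (k i))‖ ^ 2) := by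
  induction n generalizing M with
  | zero =>
    rw [tsum_fintype]
    simp only [Finset.univ_unique, Finset.sum_singleton]
    refine le_of_eq ?_
    congr 4
    funext i
    exact i.elim0
  | succ n ih =>
    have hcons : ∀ (x : G.H τ) (y : Fin n → G.H τ),
        F (Fin.cons (G.riesz τ x) fun i => G.riesz τ (y i)) =
          F fun i => G.riesz τ ((Fin.cons x y : Fin (n + 1) → G.H τ) i) := fun x y => by
      congr 1
      funext i
      refine Fin.cases ?_ (fun i => ?_) i <;> simp
    -- The orthonormal system is replaced by the basis in one argument at a time: first in the
    -- argument split off here, with the others fixed, then by induction in the remaining n.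
    rw [← (Fin.consEquiv fun _ => Fin m).sum_comp, ← (Fin.consEquiv fun _ => ι).tsum_eq]
    simp only [riesz_consEquiv]
    rw [Fintype.sum_prod_type, Finset.sum_comm, ENNReal.tsum_prod']
    calc ∑ k : Fin n → Fin m, ∑ j, ENNReal.ofReal
          (‖F (Fin.cons (G.riesz τ (w j)) fun i => G.riesz τ (w (k i)))‖ ^ 2)
        ≤ ∑ k : Fin n → Fin m, ∑' a, ENNReal.ofReal
          (‖F (Fin.cons (G.riesz τ (b a)) fun i => G.riesz τ (w (k i)))‖ ^ 2) := by
          refine Finset.sum_le_sum fun k _ => ?_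
          refine sum_norm_sq_le_tsum_one b
            { toFun := fun ω => F (Fin.cons ω fun i => G.riesz τ (w (k i)))
              map_add' := fun x y => F.cons_add _ _ _
              map_smul' := fun c x => F.cons_smul _ _ _ } (M := M) (fun x => ?_) hw
          change ‖F (Fin.cons (G.riesz τ x) fun i => G.riesz τ (w (k i)))‖ ≤ _
          rw [hcons]
          refine (hM _).trans (le_of_eq ?_)
          rw [Fin.prod_univ_succ]
          simp [hw.1]
      _ = ∑' a, ∑ k : Fin n → Fin m, ENNReal.ofReal
          (‖F (Fin.cons (G.riesz τ (b a)) fun i => G.riesz τ (w (k i)))‖ ^ 2) := by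
          rw [Summable.tsum_finsetSum fun _ _ => ENNReal.summable]
      _ ≤ _ := by
          refine ENNReal.tsum_le_tsum fun a => ?_
          refine ih (F.curryLeft (G.riesz τ (b a))) (M := M) fun x => ?_
          change ‖F (Fin.cons (G.riesz τ (b a)) fun i => G.riesz τ (x i))‖ ≤ _
          rw [hcons]
          refine (hM _).trans (le_of_eq ?_)
          rw [Fin.prod_univ_succ]
          simp [b.orthonormal.1]

theorem sum_norm_sq_le_tnorm_sq {n : ℕ} {τ : T} {ι : Type*} [Fintype ι] {v : ι → G.H τ}
    (hv : Orthonormal ℂ v) (φ : G.symPow n) :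
    ∑ k : Fin n → ι, ‖φ.1 fun i => G.riesz τ (v (k i))‖ ^ 2 ≤ G.tnorm τ φ ^ 2 := by
  let e := Fintype.equivFin ι
  let w : G.OrthoSys τ := ⟨Fintype.card ι, v ∘ e.symm, hv.comp _ e.symm.injective⟩
  have h := coords_le_tnorm w φ
  have h2 : ‖G.coords w φ.1‖ ^ 2 ≤ G.tnorm τ φ ^ 2 := by gcongr
  rw [norm_coords_sq] at h2
  refine le_trans (le_of_eq ?_) h2
  refine Fintype.sum_equiv (Equiv.arrowCongr (Equiv.refl _) e) _ _ fun k => ?_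
  simp [w]

theorem symTensor_apply {n : ℕ} (ξ : Fin n → G.Phi) (ω : Fin n → G.Dual) :
    (G.symTensor ξ).1 ω =
      (n.factorial : ℂ)⁻¹ * ∑ σ : Equiv.Perm (Fin n), ∏ i, ω (σ i) (ξ i) := G.symForm_apply ξ ω

/-- The algebraic tensors are dense in `Φ^{⊙ n}`. -/
theorem exists_mem_span_symTensor {n : ℕ} (φ : G.symPow n) (τ : T) {ε : ℝ} (hε : 0 < ε) :
    ∃ ψ ∈ Submodule.span ℂ (Set.range fun ξ : Fin n → G.Phi => G.symTensor ξ),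
      G.tnorm τ (φ - ψ) ≤ ε := by
  classical
  obtain ⟨ι, e, b, hb⟩ := G.exists_hilbertBasis_phi τ
  let c : (Fin n → ι) → ℂ := fun k => φ.1 fun i => G.riesz τ (b (k i))
  have hfin : ∑' k, ENNReal.ofReal (‖c k‖ ^ 2) ≠ ⊤ := by
    have : ∑' k, ENNReal.ofReal (‖c k‖ ^ 2) ≤ ENNReal.ofReal (G.tnorm τ φ ^ 2) := by
      rw [ENNReal.tsum_eq_iSup_sum]
      refine iSup_le fun K => ?_
      let s : Finset ι := K.biUnion fun k => Finset.univ.image k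
      have hs : ∀ k ∈ K, ∀ i, k i ∈ s := fun k hk i =>
        Finset.mem_biUnion.2 ⟨k, hk, Finset.mem_image_of_mem _ (Finset.mem_univ i)⟩
      have h1 := sum_norm_sq_le_tnorm_sq (b.orthonormal.comp (fun j : s => (j : ι))
        Subtype.val_injective) φ
      rw [← ENNReal.ofReal_sum_of_nonneg fun _ _ => by positivity]
      refine ENNReal.ofReal_le_ofReal (le_trans ?_ h1)
      let g : (Fin n → s) ↪ (Fin n → ι) :=
        ⟨fun k i => k i, fun k k' h => funext fun i => Subtype.ext (congrFun h i)⟩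
      have h2 : K ⊆ Finset.univ.map g := fun k hk => by
        rw [Finset.mem_map]
        exact ⟨fun i => ⟨k i, hs k hk i⟩, Finset.mem_univ _, rfl⟩
      refine (Finset.sum_le_sum_of_subset_of_nonneg h2 fun _ _ _ => by positivity).trans ?_
      rw [Finset.sum_map]
      exact le_rfl
    exact ne_top_of_le_ne_top ENNReal.ofReal_ne_top this
  have htail := ENNReal.tendsto_tsum_compl_atTop_zero hfin
  obtain ⟨K, hK⟩ := ((tendsto_order.1 htail).2 (ENNReal.ofReal (ε ^ 2))
    (ENNReal.ofReal_pos.2 (by positivity))).exists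
  -- K is enlarged to the full cube s^n, which is invariant under permutations. As c is symmetric,
  -- symmetrizing the basis tensors then leaves the coordinates of ψ equal to those of φ on the cube
  -- and zero outside it.
  let s : Finset ι := K.biUnion fun k => Finset.univ.image k
  have hs : ∀ k ∈ K, ∀ i, k i ∈ s := fun k hk i =>
    Finset.mem_biUnion.2 ⟨k, hk, Finset.mem_image_of_mem _ (Finset.mem_univ i)⟩
  let ψ : G.symPow n := ∑ k : Fin n → s, c (fun i => k i) • G.symTensor fun i => e (k i)
  have hψ : ∀ j : Fin n → ι, ψ.1 (fun i => G.riesz τ (b (j i))) =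
      if ∀ i, j i ∈ s then c j else 0 := fun j => by
    have h1 : ψ.1 (fun i => G.riesz τ (b (j i))) =
        ∑ k : Fin n → s, c (fun i => k i) * ((n.factorial : ℂ)⁻¹ *
          ∑ σ : Equiv.Perm (Fin n), if (fun i => j (σ i)) = (fun i => (k i : ι)) then 1 else 0) := by
      simp only [ψ, Submodule.coe_sum, Submodule.coe_smul, sum_apply,
        smul_apply, smul_eq_mul, symTensor_apply, riesz_apply, ← hb]
      refine Finset.sum_congr rfl fun k _ => ?_
      congr 2
      refine Finset.sum_congr rfl fun σ _ => ?_
      have h2 := orthonormal_iff_ite.1 b.orthonormal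
      simp only [h2]
      rw [Finset.prod_ite_zero]
      simp [funext_iff]
    rw [h1]
    split_ifs with h
    · have h3 : ∀ σ : Equiv.Perm (Fin n), ∑ k : Fin n → s, c (fun i => k i) *
          (if (fun i => j (σ i)) = (fun i => (k i : ι)) then 1 else 0) = c j := fun σ => by
        rw [Finset.sum_eq_single (fun i => (⟨j (σ i), h (σ i)⟩ : s))]
        · simp only [if_true, mul_one]
          exact φ.2.1 σ fun i => G.riesz τ (b (j i))
        · intro k _ hk
          rw [if_neg, mul_zero]
          intro h4
          exact hk (funext fun i => Subtype.ext (congrFun h4 i).symm)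
        · simp
      simp only [mul_left_comm _ ((n.factorial : ℂ)⁻¹), ← Finset.mul_sum]
      simp only [Finset.mul_sum]
      rw [Finset.sum_comm]
      simp only [← Finset.mul_sum, h3]
      simp [Fintype.card_perm, n.factorial_ne_zero]
    · refine Finset.sum_eq_zero fun k _ => ?_
      have : ∀ σ : Equiv.Perm (Fin n), ¬ (fun i => j (σ i)) = (fun i => (k i : ι)) := fun σ h4 =>
        h fun i => by
          have := congrFun h4 (σ.symm i)
          simp only [Equiv.apply_symm_apply] at this
          rw [this]
          exact (k _).2
      simp [this]
  refine ⟨ψ, Submodule.sum_mem _ fun k _ => Submodule.smul_mem _ _ (Submodule.subset_span ⟨_, rfl⟩),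
    tnorm_le fun v => ?_⟩
  have h5 := sum_norm_sq_le_tsum b v.2.2 (φ - ψ).1 fun x => norm_apply_riesz_le _ x
  have h6 : ∑' k : Fin n → ι, ENNReal.ofReal (‖(φ - ψ).1 fun i => G.riesz τ (b (k i))‖ ^ 2) ≤
      ENNReal.ofReal (ε ^ 2) := by
    refine le_trans ?_ hK.le
    refine le_of_le_of_eq ?_
      (tsum_subtype {k | k ∉ K} fun k => ENNReal.ofReal (‖c k‖ ^ 2)).symm
    refine ENNReal.tsum_le_tsum fun k => ?_
    have h7 : (φ - ψ).1 (fun i => G.riesz τ (b (k i))) = if ∀ i, k i ∈ s then 0 else c k := by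
      change φ.1 _ - ψ.1 _ = _
      rw [hψ]
      split_ifs <;> simp [c]
    rw [h7]
    by_cases hk : k ∈ K
    · simp [hs k hk]
    · rw [Set.indicator_of_mem (by exact hk)]
      split_ifs <;> simp
  rw [← ENNReal.ofReal_sum_of_nonneg fun _ _ => by positivity] at h5
  have h8 := (ENNReal.ofReal_le_ofReal_iff (by positivity)).1 (h5.trans h6)
  refine le_of_sq_le_sq ?_ hε.le
  rw [norm_coords_sq]
  exact h8

end NuclearScale
end

noncomputable section

namespace NuclearScale

variable {T : Type*} {G : NuclearScale T}

/-! ### Bounds for functionals on `Φ^{⊙ n}` -/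

-- The comparison of tensor norms goes through the nuclear estimate on the diagonal, not through
-- tensor powers of the inclusions. The price is a factor K^n, harmless since geometric factors are
-- absorbed everywhere.
variable (G) in
theorem exists_tnorm_le (s : Finset T) : ∃ (τ : T) (K : ℝ), 1 ≤ K ∧ ∀ σ ∈ s,
    (∀ ξ, ‖G.incl σ ξ‖ ≤ K * ‖G.incl τ ξ‖) ∧
    ∀ (n : ℕ) (φ : G.symPow n), G.tnorm σ φ ≤ K ^ n * G.tnorm τ φ := by
  classical
  choose τ' K hK h using fun σ : T => exists_norm_coords_le (G := G) σ
  obtain ⟨τ, C, hC, h1, h2⟩ := G.exists_riesz_lift (s ∪ s.image τ')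
  obtain ⟨L, hL⟩ : ∃ L : ℝ, ∀ σ ∈ s, K σ ≤ L := by
    obtain ⟨L, hL⟩ := (s.finite_toSet.image K).bddAbove
    exact ⟨L, fun σ hσ => hL ⟨σ, hσ, rfl⟩⟩
  have hb : (1 + C) * (1 + |L|) = 1 + C + |L| + C * |L| := by ring
  have hCL : 0 ≤ C * |L| := by positivity
  have habs := abs_nonneg L
  refine ⟨τ, (1 + C) * (1 + |L|), by linarith, fun σ hσ =>
    ⟨fun ξ => (h1 σ (by simp [hσ]) ξ).trans ?_, fun n φ => tnorm_le fun v => ?_⟩⟩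
  · gcongr
    linarith
  · refine (h σ n φ.1 φ.2.1 (C ^ n * G.tnorm τ φ)
      (mul_nonneg (by positivity) (apply_nonneg _ _)) (fun x => ?_) v).trans ?_
    · obtain ⟨y, hy, hyx⟩ := h2 (τ' σ)
        (Finset.mem_union_right _ (Finset.mem_image_of_mem _ hσ)) x
      rw [← hy]
      refine (G.norm_diag_le τ y φ).trans ?_
      rw [mul_right_comm, ← mul_pow]
      exact mul_le_mul_of_nonneg_right (by gcongr) (apply_nonneg _ _)
    · rw [mul_right_comm, ← mul_pow]
      refine mul_le_mul_of_nonneg_right ?_ (apply_nonneg _ _)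
      have := hL σ hσ
      have := le_abs_self L
      gcongr
      · exact mul_nonneg hC (hK σ)
      · exact hK σ
      · linarith
      · linarith

theorem exists_span_finiteDimensional {n : ℕ} {ψ : G.symPow n}
    (hψ : ψ ∈ Submodule.span ℂ (Set.range fun ξ : Fin n → G.Phi => G.symTensor ξ)) :
    ∃ W : Submodule ℂ G.Phi, FiniteDimensional ℂ W ∧
      ψ ∈ Submodule.span ℂ (G.symTensor '' {ξ : Fin n → G.Phi | ∀ i, ξ i ∈ W}) := by
  induction hψ using Submodule.span_induction with
  | mem x hx =>
    obtain ⟨ξ, rfl⟩ := hx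
    exact ⟨Submodule.span ℂ (Set.range ξ), FiniteDimensional.span_of_finite ℂ (Set.finite_range _),
      Submodule.subset_span ⟨ξ, fun i => Submodule.subset_span ⟨i, rfl⟩, rfl⟩⟩
  | zero => exact ⟨⊥, inferInstance, zero_mem _⟩
  | add x y _ _ hx hy =>
    obtain ⟨W, hW, hx⟩ := hx
    obtain ⟨W', hW', hy⟩ := hy
    refine ⟨W ⊔ W', inferInstance, add_mem (Submodule.span_mono ?_ hx) (Submodule.span_mono ?_ hy)⟩
    · exact Set.image_mono fun ξ h i => Submodule.mem_sup_left (h i)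
    · exact Set.image_mono fun ξ h i => Submodule.mem_sup_right (h i)
  | smul c x _ hx =>
    obtain ⟨W, hW, hx⟩ := hx
    exact ⟨W, hW, Submodule.smul_mem _ _ hx⟩

/-- Expansion of an algebraic tensor in an orthonormal system. -/
theorem exists_orthonormal_expansion {n : ℕ} (τ : T) {ψ : G.symPow n}
    (hψ : ψ ∈ Submodule.span ℂ (Set.range fun ξ : Fin n → G.Phi => G.symTensor ξ)) :
    ∃ (m : ℕ) (u : Fin m → G.Phi), Orthonormal ℂ (fun j => G.incl τ (u j)) ∧
      ψ = ∑ k : Fin n → Fin m, ψ.1 (fun i => G.riesz τ (G.incl τ (u (k i)))) •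
        G.symTensor fun i => u (k i) := by
  obtain ⟨W, hW, hψW⟩ := exists_span_finiteDimensional hψ
  let W' : Submodule ℂ (G.H τ) := W.map (G.incl τ).toLinearMap
  let e := stdOrthonormalBasis ℂ W'
  have hex : ∀ p, ∃ ξ : G.Phi, G.incl τ ξ = e p := fun p => by
    obtain ⟨ξ, -, h⟩ := (e p).2
    exact ⟨ξ, h⟩
  choose u hu using hex
  have ho : Orthonormal ℂ fun j => G.incl τ (u j) := by
    simp only [hu]
    exact e.orthonormal.comp_linearIsometry W'.subtypeₗᵢ
  refine ⟨_, u, ho, ?_⟩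
  have hsum : ∀ ξ ∈ W, ξ = ∑ j, inner ℂ (G.incl τ (u j)) (G.incl τ ξ) • u j := fun ξ hξ => by
    apply G.incl_injective τ
    have h1 := congrArg (Submodule.subtype W') (e.sum_repr' ⟨G.incl τ ξ, ⟨ξ, hξ, rfl⟩⟩)
    simp only [map_sum, map_smul, Submodule.subtype_apply, Submodule.coe_inner] at h1
    simp only [map_sum, map_smul, hu]
    exact h1.symm
  -- L expands a tensor in the system u. Coordinates of a symmetric product are averages over
  -- permutations, and each permutation only reindexes the expansion, so L is the identity on
  -- products of vectors from W, hence on ψ by linearity.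
  let L : G.symPow n →ₗ[ℂ] G.symPow n :=
    ∑ k : Fin n → Fin _, LinearMap.smulRight
      (dualTensor n fun i => G.riesz τ (G.incl τ (u (k i)))).toLinearMap
      (G.symTensor fun i => u (k i))
  have hL : Set.EqOn (LinearMap.id : G.symPow n →ₗ[ℂ] G.symPow n) L
      (G.symTensor '' {ξ : Fin n → G.Phi | ∀ i, ξ i ∈ W}) := by
    rintro _ ⟨ξ, hξ, rfl⟩
    let c : Fin n → Fin _ → ℂ := fun i j => inner ℂ (G.incl τ (u j)) (G.incl τ (ξ i))
    have h1 : G.symTensor ξ = ∑ k : Fin n → Fin _, (∏ i, c i (k i)) •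
        G.symTensor fun i => u (k i) := by
      have h2 : ξ = fun i => ∑ j, c i j • u j := funext fun i => hsum (ξ i) (hξ i)
      conv_lhs => rw [h2, ← symTensorMap_apply, (symTensorMap n).map_sum]
      refine Finset.sum_congr rfl fun k _ => ?_
      exact (symTensorMap n).map_smul_univ _ _
    have h3 : ∀ σ : Equiv.Perm (Fin n), ∑ k : Fin n → Fin _, (∏ i, c i (k (σ i))) •
        G.symTensor (fun i => u (k i)) = G.symTensor ξ := fun σ => by
      rw [h1]
      refine Fintype.sum_equiv (Equiv.arrowCongr σ.symm (Equiv.refl _)) _ _ fun k => ?_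
      have h4 := symTensor_comp_perm (fun i => u (k i)) σ
      simp only [Equiv.arrowCongr_apply, Equiv.symm_symm, Equiv.coe_refl, Function.comp_apply,
        id_eq]
      rw [← h4]
      rfl
    simp only [LinearMap.id_coe, id_eq, L, LinearMap.sum_apply, LinearMap.smulRight_apply,
      ContinuousLinearMap.coe_coe, dualTensor_apply, symTensor_apply, riesz_apply]
    change _ = ∑ k : Fin n → Fin _, ((n.factorial : ℂ)⁻¹ * ∑ σ : Equiv.Perm (Fin n),
      ∏ i, c i (k (σ i))) • G.symTensor fun i => u (k i)
    simp only [mul_smul, Finset.sum_smul, ← Finset.smul_sum]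
    rw [Finset.sum_comm]
    simp only [h3]
    simp [Fintype.card_perm, ← Nat.cast_smul_eq_nsmul ℂ, smul_smul, n.factorial_ne_zero]
  have := LinearMap.eqOn_span hL hψW
  simpa [L] using this

theorem norm_symTensor_le_of_tpow {n : ℕ} {τ : T} (Ψ : G.symPow n →ₗ[ℂ] ℂ) {M : ℝ}
    (h : ∀ ξ, ‖Ψ (G.tpow ξ n)‖ ≤ M * ‖G.incl τ ξ‖ ^ n) (ξ : Fin n → G.Phi) :
    ‖Ψ (G.symTensor ξ)‖ ≤ M * 6 ^ n * ∏ i, ‖G.incl τ (ξ i)‖ :=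
  (Ψ.compMultilinearMap (symTensorMap n)).norm_le_of_norm_diag_le
    ((normSeminorm ℂ (G.H τ)).comp (G.incl τ).toLinearMap)
    (fun x hx => G.incl_injective τ (by
      rw [map_zero]
      exact norm_eq_zero.1 hx))
    (fun σ x => congrArg Ψ (symTensor_comp_perm x σ)) h ξ

/-- The kernel theorem: bounds on the powers `ξ^{⊗ n}` imply bounds on `Φ^{⊙ n}`. -/
theorem exists_norm_le_of_tpow (τ : T) : ∃ (τ' : T) (K : ℝ), 0 ≤ K ∧
    ∀ (n : ℕ) (Ψ : G.SymDual n) (M : ℝ), 0 ≤ M →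
      (∀ ξ, ‖Ψ (G.tpow ξ n)‖ ≤ M * ‖G.incl τ ξ‖ ^ n) →
      ∀ φ, ‖Ψ φ‖ ≤ M * K ^ n * G.tnorm τ' φ := by
  obtain ⟨τ', K, hK, -, h1⟩ := G.exists_hilbertSchmidt τ
  refine ⟨τ', 6 * K, by positivity, fun n Ψ M hM hΨ φ => ?_⟩
  -- Cauchy–Schwarz in a system orthonormal in H_{τ'}: the coordinates of ψ give ‖ψ‖_{τ'}, and the
  -- values of Ψ on the basis tensors give (6K)^n, by polarization and the factorization of the
  -- Hilbert–Schmidt sum.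
  have hspan : ∀ ψ ∈ Submodule.span ℂ (Set.range fun ξ : Fin n → G.Phi => G.symTensor ξ),
      ‖Ψ ψ‖ ≤ M * (6 * K) ^ n * G.tnorm τ' ψ := fun ψ hψ => by
    obtain ⟨m, u, hu, hexp⟩ := exists_orthonormal_expansion τ' hψ
    have h2 := h1 m u hu
    set c : (Fin n → Fin m) → ℂ := fun k => ψ.1 (fun i => G.riesz τ' (G.incl τ' (u (k i)))) with hc
    have h3 : ‖Ψ ψ‖ ≤ ∑ k : Fin n → Fin m, ‖c k‖ * ‖Ψ (G.symTensor fun i => u (k i))‖ := by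
      conv_lhs => rw [hexp]
      rw [map_sum]
      refine (norm_sum_le _ _).trans (le_of_eq ?_)
      refine Finset.sum_congr rfl fun k _ => ?_
      rw [map_smul, norm_smul]
    have h4 : ∑ k, ‖c k‖ ^ 2 ≤ G.tnorm τ' ψ ^ 2 := sum_norm_sq_le_tnorm_sq hu ψ
    have h5 : ∑ k : Fin n → Fin m, ‖Ψ (G.symTensor fun i => u (k i))‖ ^ 2 ≤
        (M * (6 * K) ^ n) ^ 2 := by
      calc ∑ k : Fin n → Fin m, ‖Ψ (G.symTensor fun i => u (k i))‖ ^ 2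
          ≤ ∑ k : Fin n → Fin m, (M * 6 ^ n) ^ 2 * ∏ i, ‖G.incl τ (u (k i))‖ ^ 2 := by
            refine Finset.sum_le_sum fun k _ => ?_
            rw [Finset.prod_pow, ← mul_pow]
            gcongr
            exact norm_symTensor_le_of_tpow Ψ.toLinearMap hΨ _
        _ = (M * 6 ^ n) ^ 2 * (∑ j, ‖G.incl τ (u j)‖ ^ 2) ^ n := by
            rw [← Finset.mul_sum, sum_prod_eq_sum_pow n fun j => ‖G.incl τ (u j)‖ ^ 2]
        _ ≤ (M * 6 ^ n) ^ 2 * (K ^ 2) ^ n := by gcongr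
        _ = _ := by rw [← pow_mul, mul_comm 2 n, pow_mul, mul_pow 6 K]; ring
    refine h3.trans ((Real.sum_mul_le_sqrt_mul_sqrt _ _ _).trans ?_)
    rw [mul_comm]
    gcongr
    · exact Real.sqrt_le_iff.2 ⟨by positivity, h5⟩
    · exact Real.sqrt_le_iff.2 ⟨apply_nonneg _ _, h4⟩
  -- Continuity bounds Ψ by some norm, with no control of the constant. This crude bound is applied
  -- only to the error φ − ψ and disappears as ε → 0.
  obtain ⟨s, C, -, hC⟩ := Seminorm.bound_of_continuous (G.symPow_withSeminorms n)
    ((normSeminorm ℂ ℂ).comp Ψ.toLinearMap) (by exact Ψ.continuous.norm)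
  classical
  obtain ⟨σ, L, hL, hσ⟩ := G.exists_tnorm_le (insert τ' s)
  have hΨσ : ∀ ψ, ‖Ψ ψ‖ ≤ C * L ^ n * G.tnorm σ ψ := fun ψ => by
    refine (hC ψ).trans ?_
    rw [mul_assoc]
    refine mul_le_mul_of_nonneg_left ?_ C.2
    exact Seminorm.finset_sup_apply_le (mul_nonneg (by positivity) (apply_nonneg _ _))
      fun i hi => (hσ i (Finset.mem_insert_of_mem hi)).2 n ψ
  set R : ℝ := M * (6 * K) ^ n * L ^ n + C * L ^ n with hR
  have hR0 : 0 ≤ R := by positivity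
  refine le_of_forall_pos_le_add fun ε hε => ?_
  obtain ⟨ψ, hψ, hφψ⟩ := exists_mem_span_symTensor φ σ (ε := ε / (R + 1)) (by positivity)
  have h6 : ‖Ψ φ‖ ≤ ‖Ψ ψ‖ + ‖Ψ (φ - ψ)‖ := by
    have : φ = ψ + (φ - ψ) := by abel
    conv_lhs => rw [this, map_add]
    exact norm_add_le _ _
  have h7 : G.tnorm τ' ψ ≤ G.tnorm τ' φ + L ^ n * G.tnorm σ (φ - ψ) := by
    have : ψ = φ - (φ - ψ) := by abel
    conv_lhs => rw [this]
    refine (map_sub_le_add _ _ _).trans ?_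
    gcongr
    exact (hσ τ' (Finset.mem_insert_self _ _)).2 n _
  have h8 : R * G.tnorm σ (φ - ψ) ≤ ε := by
    calc R * G.tnorm σ (φ - ψ) ≤ R * (ε / (R + 1)) := by gcongr
      _ = R / (R + 1) * ε := by ring
      _ ≤ 1 * ε := by
        gcongr
        rw [div_le_one (by positivity)]
        linarith
      _ = ε := one_mul ε
  calc ‖Ψ φ‖ ≤ M * (6 * K) ^ n * G.tnorm τ' ψ + C * L ^ n * G.tnorm σ (φ - ψ) :=
        h6.trans (add_le_add (hspan ψ hψ) (hΨσ _))
    _ ≤ M * (6 * K) ^ n * (G.tnorm τ' φ + L ^ n * G.tnorm σ (φ - ψ)) +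
        C * L ^ n * G.tnorm σ (φ - ψ) := by gcongr
    _ = M * (6 * K) ^ n * G.tnorm τ' φ + R * G.tnorm σ (φ - ψ) := by rw [hR]; ring
    _ ≤ _ := by gcongr

/-- Functionals on `Φ^{⊙ n}` are determined by their values on the powers `ξ^{⊗ n}`. -/
theorem symDual_ext {n : ℕ} {Ψ Ψ' : G.SymDual n}
    (h : ∀ ξ, Ψ (G.tpow ξ n) = Ψ' (G.tpow ξ n)) : Ψ = Ψ' := by
  -- The kernel estimate with M = 0; the index it starts from is immaterial.
  obtain ⟨τ', K, -, hK⟩ := exists_norm_le_of_tpow (G := G) G.center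
  ext φ
  have := hK n (Ψ - Ψ') 0 le_rfl (fun ξ => by simp [h]) φ
  simp only [zero_mul, norm_le_zero_iff, sub_apply] at this
  exact sub_eq_zero.1 this

end NuclearScale
end

noncomputable section

/-! ### Majorants for power series -/

namespace PowerSeries

/-- The weighted `ℓ¹` norm of the first coefficients of a power series. -/
def coeffNorm (N : ℕ) (r : ℝ) (a : PowerSeries ℂ) : ℝ :=
  ∑ n ∈ Finset.range (N + 1), ‖coeff n a‖ * r ^ n

variable {N : ℕ} {r : ℝ}

theorem coeffNorm_nonneg (hr : 0 ≤ r) (a : PowerSeries ℂ) : 0 ≤ coeffNorm N r a :=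
  Finset.sum_nonneg fun _ _ => by positivity

/-- The truncated Cauchy product is part of the product of the two truncated sums, all of whose
terms are nonnegative. -/
theorem coeffNorm_mul_le (hr : 0 ≤ r) (a b : PowerSeries ℂ) :
    coeffNorm N r (a * b) ≤ coeffNorm N r a * coeffNorm N r b := by
  classical
  set f : ℕ × ℕ → ℝ := fun p => (‖coeff p.1 a‖ * r ^ p.1) * (‖coeff p.2 b‖ * r ^ p.2) with hf
  have hf0 : ∀ p, 0 ≤ f p := fun p => by positivity
  calc coeffNorm N r (a * b)
      ≤ ∑ n ∈ Finset.range (N + 1), ∑ p ∈ Finset.HasAntidiagonal.antidiagonal n, f p := by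
        refine Finset.sum_le_sum fun n _ => ?_
        rw [coeff_mul]
        refine (mul_le_mul_of_nonneg_right (norm_sum_le _ _) (by positivity)).trans (le_of_eq ?_)
        rw [Finset.sum_mul]
        refine Finset.sum_congr rfl fun p hp => ?_
        rw [Finset.HasAntidiagonal.mem_antidiagonal] at hp
        rw [hf, ← hp, norm_mul, pow_add]
        ring
    _ = ∑ p ∈ (Finset.range (N + 1) ×ˢ Finset.range (N + 1)).filter fun p => p.1 + p.2 < N + 1,
          f p := by
        rw [← Finset.sum_fiberwise_of_maps_to (g := fun p : ℕ × ℕ => p.1 + p.2)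
          (t := Finset.range (N + 1)) (fun p hp => by
            rw [Finset.mem_range]; exact (Finset.mem_filter.1 hp).2)]
        refine Finset.sum_congr rfl fun n hn => Finset.sum_congr ?_ fun _ _ => rfl
        ext p
        simp only [Finset.HasAntidiagonal.mem_antidiagonal, Finset.mem_filter, Finset.mem_product,
          Finset.mem_range] at hn ⊢
        omega
    _ ≤ ∑ p ∈ Finset.range (N + 1) ×ˢ Finset.range (N + 1), f p :=
        Finset.sum_le_sum_of_subset_of_nonneg (Finset.filter_subset _ _) fun p _ _ => hf0 p
    _ = _ := by
        rw [coeffNorm, coeffNorm, Finset.sum_mul_sum, ← Finset.sum_product']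

theorem coeffNorm_one : coeffNorm N r 1 = 1 := by
  rw [coeffNorm, Finset.sum_eq_single 0]
  · simp
  · intro n _ hn
    simp [coeff_one, hn]
  · simp

theorem coeffNorm_pow_le (hr : 0 ≤ r) (a : PowerSeries ℂ) (k : ℕ) :
    coeffNorm N r (a ^ k) ≤ coeffNorm N r a ^ k := by
  induction k with
  | zero => simp [coeffNorm_one]
  | succ k ih =>
    rw [pow_succ, pow_succ]
    exact (coeffNorm_mul_le hr _ _).trans
      (mul_le_mul_of_nonneg_right ih (coeffNorm_nonneg hr a))

theorem coeffNorm_add_le (hr : 0 ≤ r) (a b : PowerSeries ℂ) :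
    coeffNorm N r (a + b) ≤ coeffNorm N r a + coeffNorm N r b := by
  rw [coeffNorm, coeffNorm, coeffNorm, ← Finset.sum_add_distrib]
  refine Finset.sum_le_sum fun n _ => ?_
  rw [← add_mul, map_add]
  exact mul_le_mul_of_nonneg_right (norm_add_le _ _) (by positivity)

theorem coeffNorm_neg (a : PowerSeries ℂ) : coeffNorm N r (-a) = coeffNorm N r a := by
  simp [coeffNorm]

/-- The ratio 1/3 is chosen because 1/3 + 1/9 + … = 1/2, exactly the smallness needed to invert a
series with constant term 1. -/
theorem coeffNorm_le_of_geometric {a : PowerSeries ℂ} {c q : ℝ} (hr : 0 ≤ r) (hc : 0 ≤ c)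
    (hq : 0 ≤ q) (hqr : q * r ≤ 1 / 3) (h0 : coeff 0 a = 0)
    (ha : ∀ n, 1 ≤ n → ‖coeff n a‖ ≤ c * q ^ n) : coeffNorm N r a ≤ c / 2 := by
  have h1 : ∀ n : ℕ, ∑ i ∈ Finset.range n, (1 / 3 : ℝ) ^ (i + 1) ≤ 1 / 2 := fun n => by
    have : ∀ n : ℕ, ∑ i ∈ Finset.range n, (1 / 3 : ℝ) ^ (i + 1) = 1 / 2 - 1 / 2 * (1 / 3) ^ n := by
      intro n
      induction n with
      | zero => simp
      | succ n ih => rw [Finset.sum_range_succ, ih]; ring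
    rw [this]
    have : (0 : ℝ) ≤ 1 / 2 * (1 / 3) ^ n := by positivity
    linarith
  rw [coeffNorm, Finset.sum_range_succ', h0]
  simp only [norm_zero, zero_mul, add_zero]
  calc ∑ n ∈ Finset.range N, ‖coeff (n + 1) a‖ * r ^ (n + 1)
      ≤ ∑ n ∈ Finset.range N, c * (1 / 3) ^ (n + 1) := by
        refine Finset.sum_le_sum fun n _ => ?_
        calc ‖coeff (n + 1) a‖ * r ^ (n + 1) ≤ c * q ^ (n + 1) * r ^ (n + 1) := by
              gcongr
              exact ha _ (by omega)
          _ = c * (q * r) ^ (n + 1) := by rw [mul_pow]; ring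
          _ ≤ _ := by gcongr
    _ = c * ∑ n ∈ Finset.range N, (1 / 3 : ℝ) ^ (n + 1) := by rw [Finset.mul_sum]
    _ ≤ c * (1 / 2) := by gcongr; exact h1 N
    _ = c / 2 := by ring

/-- From u⁻¹ = 1 − (u − 1)u⁻¹ one gets ‖u⁻¹‖ ≤ 1 + ‖u⁻¹‖/2. The last term can be absorbed because
the truncated norm is finite, so nothing about convergence of u⁻¹ has to be known beforehand. -/
theorem coeffNorm_inv_le {u : PowerSeries ℂ} (hr : 0 ≤ r) (h0 : coeff 0 u = 1)
    (hu : coeffNorm N r (u - 1) ≤ 1 / 2) : coeffNorm N r u⁻¹ ≤ 2 := by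
  have h1 : u⁻¹ = 1 + -((u - 1) * u⁻¹) := by
    have : u * u⁻¹ = 1 := PowerSeries.mul_inv_cancel u (by
      rw [← coeff_zero_eq_constantCoeff_apply, h0]; exact one_ne_zero)
    rw [sub_mul, this]
    ring
  have h2 : coeffNorm N r u⁻¹ ≤ 1 + coeffNorm N r (u - 1) * coeffNorm N r u⁻¹ := by
    conv_lhs => rw [h1]
    refine (coeffNorm_add_le hr _ _).trans ?_
    rw [coeffNorm_one, coeffNorm_neg]
    gcongr
    exact coeffNorm_mul_le hr _ _
  have h3 := mul_le_mul_of_nonneg_right hu (coeffNorm_nonneg (N := N) hr u⁻¹)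
  linarith

theorem norm_coeff_le_of_coeffNorm {a : PowerSeries ℂ} {M : ℝ} (hr : 0 < r)
    (h : coeffNorm N r a ≤ M) : ‖coeff N a‖ ≤ M * (1 / r) ^ N := by
  have h1 : ‖coeff N a‖ * r ^ N ≤ coeffNorm N r a :=
    Finset.single_le_sum (f := fun n => ‖coeff n a‖ * r ^ n) (fun _ _ => by positivity)
      (Finset.self_mem_range_succ N)
  rw [one_div, inv_pow, ← div_eq_mul_inv, le_div_iff₀ (by positivity)]
  exact h1.trans h

/-- The coefficients of `a ^ k * u` and of `a ^ k * u⁻¹`, for power series `a` and `u` with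
geometrically bounded coefficients. -/
theorem norm_coeff_pow_mul_le {a u : PowerSeries ℂ} {c q : ℝ} (hc : 0 ≤ c) (hq : 0 < q)
    (ha0 : coeff 0 a = 0) (ha : ∀ n, 1 ≤ n → ‖coeff n a‖ ≤ c * q ^ n)
    (hu0 : coeff 0 u = 1) (hu : ∀ n, 1 ≤ n → ‖coeff n u‖ ≤ q ^ n) (k n : ℕ) :
    ‖coeff n (a ^ k * u)‖ ≤ 2 * c ^ k * (3 * q) ^ n ∧
      ‖coeff n (a ^ k * u⁻¹)‖ ≤ 2 * c ^ k * (3 * q) ^ n := by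
  -- With qr = 1/3 the norm of a is at most c and u is within 1/2 of 1, so both u and u⁻¹ have norm
  -- at most 2.
  set r := 1 / (3 * q) with hr
  have hr0 : 0 < r := by positivity
  have hqr : q * r ≤ 1 / 3 := by
    rw [hr]
    field_simp
    exact le_rfl
  have h1 : coeffNorm n r a ≤ c := by
    have := coeffNorm_le_of_geometric (N := n) hr0.le hc hq.le hqr ha0 ha
    linarith
  have h2 : coeffNorm n r (u - 1) ≤ 1 / 2 :=
    coeffNorm_le_of_geometric hr0.le zero_le_one hq.le hqr (by rw [map_sub, hu0, coeff_zero_one, sub_self])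
      fun m hm => by
        have : coeff m (u - 1) = coeff m u := by
          rw [map_sub, coeff_one, if_neg (by omega), sub_zero]
        rw [this, one_mul]
        exact hu m hm
  have h3 : coeffNorm n r (a ^ k) ≤ c ^ k :=
    (coeffNorm_pow_le hr0.le a k).trans (pow_le_pow_left₀ (coeffNorm_nonneg hr0.le a) h1 k)
  have h4 : coeffNorm n r u ≤ 2 := by
    have h5 := coeffNorm_add_le (N := n) hr0.le (u - 1) 1
    rw [sub_add_cancel, coeffNorm_one] at h5
    linarith
  have h5 := coeffNorm_inv_le hr0.le hu0 h2
  have h6 : 1 / r = 3 * q := by rw [hr, one_div_one_div]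
  have h7 : ∀ v : PowerSeries ℂ, coeffNorm n r v ≤ 2 →
      ‖coeff n (a ^ k * v)‖ ≤ 2 * c ^ k * (3 * q) ^ n := fun v hv => by
    rw [← h6]
    refine norm_coeff_le_of_coeffNorm hr0 ((coeffNorm_mul_le hr0.le _ _).trans ?_)
    rw [mul_comm]
    exact mul_le_mul hv h3 (coeffNorm_nonneg hr0.le _) zero_le_two
  exact ⟨h7 u h4, h7 _ h5⟩

theorem coeff_pow_eq_zero {R : Type*} [CommRing R] {a : PowerSeries R} (ha : coeff 0 a = 0)
    {k n : ℕ} (h : n < k) : coeff n (a ^ k) = 0 := by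
  have h1 : (X : PowerSeries R) ∣ a := by
    rw [X_dvd_iff, ← coeff_zero_eq_constantCoeff_apply, ha]
  exact X_pow_dvd_iff.1 (pow_dvd_pow_of_dvd h1 k) n h

/-- As a has no constant term, powers beyond n do not contribute, so the exponential series can be
cut at any N ≥ n. The scalar c marks the degree k. -/
theorem coeff_exp_subst_smul {a : PowerSeries ℂ} (ha : coeff 0 a = 0) (c : ℂ) {n N : ℕ}
    (hn : n ≤ N) : coeff n ((exp ℂ).subst (c • a)) =
      ∑ k ∈ Finset.range (N + 1), c ^ k * ((k.factorial : ℂ)⁻¹ * coeff n (a ^ k)) := by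
  have hs : HasSubst (c • a) := HasSubst.of_constantCoeff_zero' (by
    rw [← coeff_zero_eq_constantCoeff_apply, coeff_smul, ha, smul_zero])
  rw [coeff_subst' hs, finsum_eq_sum_of_support_subset]
  · refine Finset.sum_congr rfl fun k _ => ?_
    rw [smul_pow, coeff_smul, coeff_exp]
    simp only [smul_eq_mul, one_div, map_inv₀, map_natCast]
    ring
  · intro k hk
    rw [Finset.coe_range, Set.mem_Iio]
    by_contra hlt
    refine hk ?_
    change _ • _ = _
    rw [smul_pow, coeff_smul, coeff_pow_eq_zero ha (by omega), smul_zero, smul_zero]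

theorem coeff_exp_subst_smul_mul {a : PowerSeries ℂ} (ha : coeff 0 a = 0) (c : ℂ)
    (v : PowerSeries ℂ) (n : ℕ) : coeff n ((exp ℂ).subst (c • a) * v) =
      ∑ k ∈ Finset.range (n + 1), c ^ k * ((k.factorial : ℂ)⁻¹ * coeff n (a ^ k * v)) := by
  simp only [coeff_mul, Finset.mul_sum]
  rw [Finset.sum_comm]
  refine Finset.sum_congr rfl fun p hp => ?_
  rw [coeff_exp_subst_smul ha c (N := n) (by
    rw [Finset.HasAntidiagonal.mem_antidiagonal] at hp; omega), Finset.sum_mul]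
  exact Finset.sum_congr rfl fun k _ => by ring

end PowerSeries

/-- Separates homogeneous components: it is used after replacing ω by c • ω in an identity
polynomial in ω. -/
theorem eq_of_forall_sum_pow_mul_eq {N : ℕ} {x y : ℕ → ℂ}
    (h : ∀ c : ℂ, ∑ k ∈ Finset.range N, c ^ k * x k = ∑ k ∈ Finset.range N, c ^ k * y k) :
    ∀ k < N, x k = y k := by
  let P : Polynomial ℂ := ∑ k ∈ Finset.range N, Polynomial.monomial k (x k - y k)
  have hP : P = 0 := Polynomial.funext fun c => by
    simp only [P, Polynomial.eval_finsetSum, Polynomial.eval_monomial, Polynomial.eval_zero,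
      sub_mul, Finset.sum_sub_distrib]
    rw [sub_eq_zero]
    simpa only [mul_comm] using h c
  intro k hk
  have h1 := congrArg (fun Q => Polynomial.coeff Q k) hP
  simp only [P, Polynomial.finsetSum_coeff, Polynomial.coeff_monomial, Polynomial.coeff_zero,
    Finset.sum_ite_eq', Finset.mem_range, hk, if_true] at h1
  exact sub_eq_zero.1 h1

/-! ### Coefficients of convergent power series -/

theorem iteratedDeriv_eq_of_hasSum {c : ℕ → ℂ} {g : ℂ → ℂ}
    (h : ∀ z : ℂ, ‖z‖ ≤ 1 → HasSum (fun n => c n * z ^ n) (g z)) :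
    HasFPowerSeriesOnBall g (FormalMultilinearSeries.ofScalars ℂ c) 0 1 ∧
      ∀ n, iteratedDeriv n g 0 = n.factorial * c n := by
  have hf : HasFPowerSeriesOnBall g (FormalMultilinearSeries.ofScalars ℂ c) 0 1 := by
    refine ⟨?_, one_pos, fun {z} hz => ?_⟩
    · have h1 := (h 1 (by simp)).summable.tendsto_atTop_zero.norm
      simp only [one_pow, mul_one, norm_zero] at h1
      have := (FormalMultilinearSeries.ofScalars ℂ c).le_radius_of_tendsto (r := 1) (l := 0)
        (by simpa using h1)
      simpa using this
    · have hz' : ‖z‖ ≤ 1 := by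
        rw [Metric.mem_eball, edist_zero_right] at hz
        have : ENNReal.ofReal ‖z‖ < 1 := by rwa [ofReal_norm]
        exact (ENNReal.ofReal_lt_one.1 this).le
      simp only [FormalMultilinearSeries.ofScalars_apply_eq, smul_eq_mul, zero_add]
      exact h z hz'
  refine ⟨hf, fun n => ?_⟩
  have h2 := hf.factorial_smul 1 n
  rw [FormalMultilinearSeries.ofScalars_apply_eq] at h2
  rw [iteratedDeriv_eq_iteratedFDeriv, ← h2]
  simp

/-- Cauchy's inequality on the circle of radius 1/2, whence 2^n. The sum is known to be holomorphic
only on the open unit disc, so a smaller circle is taken. -/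
theorem norm_coeff_le_of_hasSum {c : ℕ → ℂ} {g : ℂ → ℂ} {M : ℝ}
    (h : ∀ z : ℂ, ‖z‖ ≤ 1 → HasSum (fun n => c n * z ^ n) (g z))
    (hM : ∀ z : ℂ, ‖z‖ ≤ 1 → ‖g z‖ ≤ M) (n : ℕ) : ‖c n‖ ≤ M * 2 ^ n := by
  obtain ⟨hf, hn⟩ := iteratedDeriv_eq_of_hasSum h
  have hd : DifferentiableOn ℂ g (Metric.ball 0 1) := by
    have := hf.differentiableOn
    rwa [← ENNReal.ofReal_one, Metric.eball_ofReal] at this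
  have h1 := Complex.norm_iteratedDeriv_le_of_forall_mem_sphere_norm_le (c := 0) (R := 1 / 2)
    (C := M) (f := g) n (by norm_num)
    (DifferentiableOn.diffContOnCl ((hd.mono (by
      refine closure_minimal ?_ Metric.isClosed_closedBall |>.trans
        (Metric.closedBall_subset_ball (by norm_num : (1 / 2 : ℝ) < 1))
      exact Metric.ball_subset_closedBall))))
    (fun z hz => hM z (by
      rw [mem_sphere_zero_iff_norm] at hz
      rw [hz]; norm_num))
  rw [hn, norm_mul, Complex.norm_natCast, mul_div_assoc] at h1
  have h2 := le_of_mul_le_mul_left h1 (by positivity)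
  refine h2.trans (le_of_eq ?_)
  rw [one_div, inv_pow, div_inv_eq_mul]

end

noncomputable section

namespace NuclearScale

variable {T : Type*} {G : NuclearScale T}

/-! ### Bounds for the coefficients of the generating function -/

theorem tpow_zero_left {n : ℕ} (hn : 1 ≤ n) : G.tpow (0 : G.Phi) n = 0 :=
  symPow_ext fun ω => by
    rw [tpow_apply]
    simp [show n ≠ 0 by omega]

theorem tpow_smul {n : ℕ} (z : ℂ) (ξ : G.Phi) : G.tpow (z • ξ) n = z ^ n • G.tpow ξ n :=
  symPow_ext fun ω => by
    rw [tpow_apply, Submodule.coe_smul, smul_apply, tpow_apply]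
    simp [mul_pow]

theorem dpow_smul {n : ℕ} (z : ℂ) (ω : G.Dual) : G.dpow (z • ω) n = z ^ n • G.dpow ω n := by
  ext φ
  rw [smul_apply, dpow_apply, dpow_apply, φ.1.map_smul_univ (fun _ => z)]
  simp

variable (G) in
theorem exists_ball_subset_of_mem_nhds_zero {U : Set G.Phi} (hU : U ∈ 𝓝 0) :
    ∃ (τ : T) (r : ℝ), 0 < r ∧ ∀ ξ : G.Phi, ‖G.incl τ ξ‖ < r → ξ ∈ U := by
  have hi : Topology.IsInducing G.phiSubmodule.subtype := Topology.IsInducing.subtypeVal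
  have hw := hi.withSeminorms (withSeminorms_pi fun τ => norm_withSeminorms ℂ (G.H τ))
  obtain ⟨s, r, hr, h⟩ := (hw.mem_nhds_iff 0 U).1 hU
  classical
  obtain ⟨τ, C, hC, hτ⟩ := G.exists_common_bound (s.image Sigma.fst)
  refine ⟨τ, r / (C + 1), by positivity, fun ξ hξ => h ?_⟩
  rw [Seminorm.mem_ball_zero]
  rw [lt_div_iff₀ (by positivity)] at hξ
  refine lt_of_le_of_lt (Seminorm.finset_sup_apply_le (a := C * ‖G.incl τ ξ‖) (by positivity)
    fun i hi => ?_) ?_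
  · exact hτ i.1 (Finset.mem_image_of_mem _ hi) ξ
  · have := norm_nonneg (G.incl τ ξ)
    nlinarith

/-- Continuity at 0 bounds the function on a ball of a single norm ‖·‖_σ, and Cauchy's inequality
along complex lines bounds the homogeneous terms there; homogeneity does the rest. For n ≥ 1 the
constant factor M is absorbed into R^n. -/
theorem HolomorphicNearZero.exists_bound {ρ : G.FormalSeries ℂ} (hρ : HolomorphicNearZero ρ) :
    ∃ (σ : T) (R : ℝ), 1 ≤ R ∧ ∀ n, 1 ≤ n → ∀ ξ, ‖ρ n (G.tpow ξ n)‖ ≤ R ^ n * ‖G.incl σ ξ‖ ^ n := by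
  obtain ⟨U, f, hU, h0, ⟨hc, -⟩, hsum⟩ := hρ
  have hU0 : U ∈ 𝓝 (0 : G.Phi) := hU.mem_nhds h0
  have hcont : ContinuousAt f 0 := hc.continuousAt hU0
  have hb : {ξ | ‖f ξ - f 0‖ < 1} ∈ 𝓝 (0 : G.Phi) := by
    have : ∀ᶠ ξ in 𝓝 (0 : G.Phi), ‖f ξ - f 0‖ < 1 := by
      simpa [dist_eq_norm] using (Metric.continuousAt_iff'.1 hcont) 1 one_pos
    exact this
  obtain ⟨σ, r, hr, hσ⟩ := G.exists_ball_subset_of_mem_nhds_zero (Filter.inter_mem hU0 hb)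
  set M := ‖f 0‖ + 1 with hM
  have hM1 : 1 ≤ M := by have := norm_nonneg (f 0); linarith
  have hsmall : ∀ ξ, ‖G.incl σ ξ‖ < r → ∀ n, ‖ρ n (G.tpow ξ n)‖ ≤ M * 2 ^ n := fun ξ hξ n => by
    have hz : ∀ z : ℂ, ‖z‖ ≤ 1 → ‖G.incl σ (z • ξ)‖ < r := fun z hz => by
      rw [map_smul, norm_smul]
      exact (mul_le_of_le_one_left (norm_nonneg _) hz).trans_lt hξ
    refine norm_coeff_le_of_hasSum (c := fun n => ρ n (G.tpow ξ n)) (g := fun z => f (z • ξ))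
      (fun z h => ?_) (fun z h => ?_) n
    · have := hsum _ (hσ _ (hz z h)).1
      simpa only [tpow_smul, map_smul, smul_eq_mul, mul_comm] using this
    · have := (hσ _ (hz z h)).2
      rw [Set.mem_ofPred_eq] at this
      have h2 := norm_sub_norm_le (f (z • ξ)) (f 0)
      linarith
  refine ⟨σ, max 1 (M * 4 / r), le_max_left _ _, fun n hn ξ => ?_⟩
  rcases eq_or_ne ξ 0 with rfl | hξ
  · rw [tpow_zero_left hn, map_zero, norm_zero]
    positivity
  have ht : 0 < ‖G.incl σ ξ‖ := norm_pos_iff.2 fun h => hξ (G.incl_injective σ (by rw [h, map_zero]))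
  set t := ‖G.incl σ ξ‖ with ht'
  -- Rescale ξ to norm r/2, inside the ball.
  have h1 := hsmall (((r / (2 * t) : ℝ) : ℂ) • ξ) (by
    rw [map_smul, norm_smul, Complex.norm_real, Real.norm_of_nonneg (by positivity), ← ht']
    have : r / (2 * t) * t = r / 2 := by field_simp
    rw [this]
    linarith) n
  rw [tpow_smul, map_smul, norm_smul, norm_pow, Complex.norm_real,
    Real.norm_of_nonneg (by positivity)] at h1
  have h2 : ‖ρ n (G.tpow ξ n)‖ ≤ M * 2 ^ n / (r / (2 * t)) ^ n := by
    rw [le_div_iff₀ (by positivity), mul_comm]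
    exact h1
  have h3 : M * 2 ^ n / (r / (2 * t)) ^ n = M * (4 / r) ^ n * t ^ n := by
    rw [mul_div_assoc, ← div_pow, mul_assoc, ← mul_pow]
    congr 2
    field_simp
    norm_num
  rw [h3] at h2
  refine h2.trans (mul_le_mul_of_nonneg_right ?_ (by positivity))
  calc M * (4 / r) ^ n ≤ M ^ n * (4 / r) ^ n := by
        gcongr
        exact le_self_pow₀ hM1 (by omega)
    _ = (M * 4 / r) ^ n := by rw [← mul_pow]; ring_nf
    _ ≤ _ := by
        gcongr
        exact le_max_right _ _

theorem QuasiHolomorphic.exists_bound {A : G.FormalSeries G.Phi} (hA : QuasiHolomorphic A) (τ : T) :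
    ∃ (τ' : T) (C : ℝ), 1 ≤ C ∧ ∀ n, 1 ≤ n → ∀ ξ,
      ‖G.incl τ (A n (G.tpow ξ n))‖ ≤ (C * ‖G.incl τ' ξ‖) ^ n := by
  obtain ⟨τ', C, hC, h⟩ := hA τ
  refine ⟨τ', max 1 C, le_max_left _ _, fun n hn ξ => (h n hn _).trans ?_⟩
  rw [mul_pow]
  exact mul_le_mul (pow_le_pow_left₀ hC (le_max_right _ _) n) (tnorm_tpow_le τ' ξ)
    (apply_nonneg _ _) (by positivity)

/-- There are 2^{m−1} compositions of m. In each term the polarized bound for ρ costs (6R)^{length}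
≤ (6R)^m, and the bounds for the blocks multiply to (C‖ξ‖)^m since the block sizes add up to m. -/
theorem exists_compCoeff_bound {ρ : G.FormalSeries ℂ} (hρ : HolomorphicNearZero ρ)
    {A : G.FormalSeries G.Phi} (hA : QuasiHolomorphic A) :
    ∃ (τ : T) (D : ℝ), 1 ≤ D ∧ ∀ n, 1 ≤ n → ∀ ξ,
      ‖compCoeff ρ A ξ n‖ ≤ (D * ‖G.incl τ ξ‖) ^ n := by
  obtain ⟨σ, R, hR, hσ⟩ := hρ.exists_bound
  obtain ⟨τ, C, hC, hτ⟩ := hA.exists_bound σ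
  refine ⟨τ, 2 * (R * 6) * C, by nlinarith, fun m hm ξ => ?_⟩
  have hterm : ∀ c : Composition m, ‖ρ c.length (G.symTensor fun i =>
      A (c.blocksFun i) (G.tpow ξ (c.blocksFun i)))‖ ≤ (R * 6) ^ m * (C * ‖G.incl τ ξ‖) ^ m :=
    fun c => by
      have hl : 1 ≤ c.length := c.length_pos_of_pos hm
      refine (norm_symTensor_le_of_tpow (ρ c.length).toLinearMap (hσ _ hl) _).trans ?_
      rw [← mul_pow]
      have h1 : ∏ i, ‖G.incl σ (A (c.blocksFun i) (G.tpow ξ (c.blocksFun i)))‖ ≤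
          (C * ‖G.incl τ ξ‖) ^ m := by
        calc _ ≤ ∏ i, (C * ‖G.incl τ ξ‖) ^ c.blocksFun i :=
              Finset.prod_le_prod (fun i _ => norm_nonneg _) fun i _ =>
                hτ _ (c.one_le_blocksFun i) ξ
          _ = _ := by rw [Finset.prod_pow_eq_pow_sum, c.sum_blocksFun]
      refine mul_le_mul ?_ h1 (Finset.prod_nonneg fun i _ => norm_nonneg _) (by positivity)
      exact pow_le_pow_right₀ (by linarith) c.length_le
  calc ‖compCoeff ρ A ξ m‖ ≤ ∑ _c : Composition m, (R * 6) ^ m * (C * ‖G.incl τ ξ‖) ^ m :=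
        (norm_sum_le _ _).trans (Finset.sum_le_sum fun c _ => hterm c)
    _ = 2 ^ (m - 1) * ((R * 6) ^ m * (C * ‖G.incl τ ξ‖) ^ m) := by
        rw [Finset.sum_const, Finset.card_univ, composition_card, nsmul_eq_mul]
        norm_num
    _ ≤ 2 ^ m * ((R * 6) ^ m * (C * ‖G.incl τ ξ‖) ^ m) := by
        gcongr
        · norm_num
        · exact Nat.sub_le _ _
    _ = _ := by rw [← mul_pow, ← mul_pow]; ring_nf

theorem compCoeff_zero {ρ : G.FormalSeries ℂ} (hρ : ∀ ξ, ρ 0 (G.tpow ξ 0) = 1)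
    (A : G.FormalSeries G.Phi) (ξ : G.Phi) : compCoeff ρ A ξ 0 = 1 := by
  have h : ∀ (l : ℕ) (_ : l = 0) (η : Fin l → G.Phi), ρ l (G.symTensor η) = 1 := by
    rintro l rfl η
    rw [← hρ 0]
    congr 2
  rw [compCoeff]
  have h2 : ∀ c : Composition 0, c.length = 0 := fun c => Nat.le_zero.1 c.length_le
  simp only [h _ (h2 _)]
  rw [Finset.sum_const, Finset.card_univ, composition_card]
  simp

/-- The power series `⟨ω, A(z ξ)⟩` in `z`. -/
def pairSeries (A : G.FormalSeries G.Phi) (ω : G.Dual) (ξ : G.Phi) : PowerSeries ℂ :=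
  PowerSeries.mk fun k => ω (A k (G.tpow ξ k))

/-- Stated for a general u since it serves twice: with A and the inverse of u = ρ(A(zξ)) for the
Sheffer coefficients, and with B and u = ρ(zξ) for the inverse operators. At ξ = 0 only degree zero
is claimed, as the majorant needs a positive ratio; in positive degree callers use 0^{⊗n} = 0. -/
theorem exists_coeff_bound {A : G.FormalSeries G.Phi} (hA0 : A 0 = 0) (hA : QuasiHolomorphic A)
    {u : G.Phi → PowerSeries ℂ} (hu0 : ∀ ξ, PowerSeries.coeff 0 (u ξ) = 1)
    (hu : ∃ (τ : T) (D : ℝ), 1 ≤ D ∧ ∀ n, 1 ≤ n → ∀ ξ,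
      ‖PowerSeries.coeff n (u ξ)‖ ≤ (D * ‖G.incl τ ξ‖) ^ n) (τ : T) :
    ∃ (τ' : T) (D : ℝ), 0 ≤ D ∧ ∀ (k n : ℕ) (x : G.H τ) (ξ : G.Phi), (ξ = 0 → n = 0) →
      ‖PowerSeries.coeff n (pairSeries A (G.riesz τ x) ξ ^ k * u ξ)‖ ≤
        2 * ‖x‖ ^ k * (D * ‖G.incl τ' ξ‖) ^ n ∧
      ‖PowerSeries.coeff n (pairSeries A (G.riesz τ x) ξ ^ k * (u ξ)⁻¹)‖ ≤
        2 * ‖x‖ ^ k * (D * ‖G.incl τ' ξ‖) ^ n := by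
  classical
  obtain ⟨τ₁, C, hC, h1⟩ := hA.exists_bound τ
  obtain ⟨τ₂, D, hD, h2⟩ := hu
  obtain ⟨τ', L, hL, h3⟩ := G.exists_tnorm_le {τ₁, τ₂}
  refine ⟨τ', 3 * (max C D * L), by positivity, fun k n x ξ hξ => ?_⟩
  have ha0 : PowerSeries.coeff 0 (pairSeries A (G.riesz τ x) ξ) = 0 := by
    simp [pairSeries, hA0]
  rcases eq_or_ne ξ 0 with rfl | hξ0
  · rw [hξ rfl]
    have hu' : PowerSeries.constantCoeff (u 0) = 1 := by
      rw [← PowerSeries.coeff_zero_eq_constantCoeff_apply, hu0]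
    have ha' : PowerSeries.constantCoeff (pairSeries A (G.riesz τ x) 0) = 0 := by
      rw [← PowerSeries.coeff_zero_eq_constantCoeff_apply, ha0]
    have h4 : ‖(0 : ℂ) ^ k‖ ≤ 2 * ‖x‖ ^ k := by
      rcases Nat.eq_zero_or_pos k with rfl | hk
      · simp
      · rw [zero_pow hk.ne', norm_zero]; positivity
    simpa [hu', ha'] using h4
  have hpos : 0 < ‖G.incl τ' ξ‖ :=
    norm_pos_iff.2 fun h => hξ0 (G.incl_injective τ' (by rw [h, map_zero]))
  have e : (3 * (max C D * L) * ‖G.incl τ' ξ‖) = 3 * (max C D * L * ‖G.incl τ' ξ‖) := by ring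
  rw [e]
  have hmax : 1 ≤ max C D := hC.trans (le_max_left _ _)
  refine PowerSeries.norm_coeff_pow_mul_le (norm_nonneg x) (by positivity) ha0 (fun m hm => ?_)
    (hu0 ξ) (fun m hm => ?_) k n
  · rw [pairSeries, PowerSeries.coeff_mk]
    refine (G.norm_riesz_apply_le τ x _).trans ?_
    refine mul_le_mul_of_nonneg_left ((h1 m hm ξ).trans ?_) (norm_nonneg _)
    rw [mul_assoc]
    gcongr
    · exact le_max_left _ _
    · exact (h3 τ₁ (by simp)).1 ξ
  · refine (h2 m hm ξ).trans ?_
    rw [mul_assoc]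
    gcongr
    · exact le_max_right _ _
    · exact (h3 τ₂ (by simp)).1 ξ

/-- Estimates for triangular families of operators `Φ^{⊙ n} → Φ^{⊙ k}`. -/
theorem exists_norm_coords_le_of_tpow {Ψ : ∀ _k n : ℕ, G.Dual → G.SymDual n}
    (h : ∀ τ, ∃ (τ' : T) (D : ℝ), 0 ≤ D ∧ ∀ k n, k ≤ n → ∀ (x : G.H τ) (ξ : G.Phi),
      ‖Ψ k n (G.riesz τ x) (G.tpow ξ n)‖ ≤
        (n.factorial / k.factorial : ℝ) * (2 * ‖x‖ ^ k * (D * ‖G.incl τ' ξ‖) ^ n)) (τ : T) :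
    ∃ (τ' : T) (C : ℝ), 0 ≤ C ∧ ∀ k n, k ≤ n → ∀ (φ : G.symPow n)
      (F : MultilinearMap ℂ (fun _ : Fin k => G.Dual) ℂ),
      (∀ (σ : Equiv.Perm (Fin k)) (ω : Fin k → G.Dual), F (ω ∘ σ) = F ω) →
      (∀ ω, F (fun _ => ω) = Ψ k n ω φ) → ∀ v : G.OrthoSys τ,
      ‖G.coords v F‖ ≤ (n.factorial / k.factorial : ℝ) * (2 * C ^ n) * G.tnorm τ' φ := by
  obtain ⟨τ₁, K, hK, h1⟩ := exists_norm_coords_le (G := G) τ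
  obtain ⟨τ₂, D, hD, h2⟩ := h τ₁
  obtain ⟨τ₃, L, hL, h3⟩ := exists_norm_le_of_tpow (G := G) τ₂
  refine ⟨τ₃, D * L * max 1 K, by positivity, fun k n hkn φ F hF hFΨ v => ?_⟩
  have ht : 0 ≤ G.tnorm τ₃ φ := apply_nonneg _ _
  have h4 : ∀ x : G.H τ₁, ‖F fun _ => G.riesz τ₁ x‖ ≤
      ((n.factorial / k.factorial : ℝ) * (2 * (D * L) ^ n) * G.tnorm τ₃ φ) * ‖x‖ ^ k := fun x => by
    rw [hFΨ]
    refine (h3 n (Ψ k n (G.riesz τ₁ x))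
      ((n.factorial / k.factorial : ℝ) * (2 * ‖x‖ ^ k * D ^ n)) (by positivity) (fun ξ => ?_)
      φ).trans (le_of_eq ?_)
    · refine (h2 k n hkn x ξ).trans (le_of_eq ?_)
      rw [mul_pow]
      ring
    · rw [mul_pow]
      ring
  refine (h1 k F hF _ (by positivity) h4 v).trans ?_
  have h5 : K ^ k ≤ max 1 K ^ n :=
    (pow_le_pow_left₀ hK (le_max_right _ _) k).trans (pow_le_pow_right₀ (le_max_left _ _) hkn)
  calc _ ≤ (n.factorial / k.factorial : ℝ) * (2 * (D * L) ^ n) * G.tnorm τ₃ φ * max 1 K ^ n := by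
        gcongr
    _ = _ := by rw [mul_pow (D * L)]; ring

theorem continuous_of_tnorm_le {n k : ℕ} (f : G.symPow n →ₗ[ℂ] G.symPow k)
    (h : ∀ τ, ∃ (τ' : T) (C : ℝ), 0 ≤ C ∧ ∀ φ, G.tnorm τ (f φ) ≤ C * G.tnorm τ' φ) :
    Continuous f := by
  refine WithSeminorms.continuous_of_isBounded (G.symPow_withSeminorms n) (G.symPow_withSeminorms k) f
    fun τ => ?_
  obtain ⟨τ', C, hC, hb⟩ := h τ
  refine ⟨{τ'}, ⟨C, hC⟩, fun φ => ?_⟩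
  rw [Finset.sup_singleton]
  exact hb φ

/-- Both sides are the part of degree k in ω of the n-th coefficient of the generating function; the
parts are separated by replacing ω with c • ω. -/
theorem coeff_generating {S : ∀ n : ℕ, G.Dual → G.SymDual n} {A : G.FormalSeries G.Phi}
    {ρ : G.FormalSeries ℂ} (hS : IsSheffer S A ρ) {U : ∀ n k : ℕ, G.SymDual k →ₗ[ℂ] G.SymDual n}
    (hU : ∀ n ω, S n ω = ∑ k ∈ Finset.range (n + 1), U n k (G.dpow ω k)) {k n : ℕ} (hkn : k ≤ n)
    (ω : G.Dual) (ξ : G.Phi) : U n k (G.dpow ω k) (G.tpow ξ n) =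
      (n.factorial / k.factorial : ℂ) * PowerSeries.coeff n
        (pairSeries A ω ξ ^ k * (PowerSeries.mk (compCoeff ρ A ξ))⁻¹) := by
  have ha0 : PowerSeries.coeff 0 (pairSeries A ω ξ) = 0 := by simp [pairSeries, hS.A_zero]
  have hn : (n.factorial : ℂ) ≠ 0 := by exact_mod_cast n.factorial_ne_zero
  have key := eq_of_forall_sum_pow_mul_eq (N := n + 1)
    (x := fun k => (n.factorial : ℂ)⁻¹ * U n k (G.dpow ω k) (G.tpow ξ n))
    (y := fun k => (k.factorial : ℂ)⁻¹ * PowerSeries.coeff n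
        (pairSeries A ω ξ ^ k * (PowerSeries.mk (compCoeff ρ A ξ))⁻¹)) (fun c => by
      have h1 := congrArg (PowerSeries.coeff n) (hS.generating (c • ω) ξ)
      have h2 : (PowerSeries.mk fun k => (c • ω) (A k (G.tpow ξ k))) = c • pairSeries A ω ξ := by
        ext m
        simp [pairSeries]
      rw [h2, PowerSeries.coeff_exp_subst_smul_mul ha0, PowerSeries.coeff_mk, hU] at h1
      rw [← h1, sum_apply, Finset.mul_sum]
      refine Finset.sum_congr rfl fun k _ => ?_
      rw [dpow_smul, map_smul, smul_apply, smul_eq_mul]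
      ring) k (by omega)
  beta_reduce at key
  rw [inv_mul_eq_iff_eq_mul₀ hn] at key
  rw [key]
  ring

/-- The operators `V_{k,n} : Φ^{⊙ n} → Φ^{⊙ k}` dual to the coefficients `U_{n,k}` of a Sheffer
sequence. -/
theorem IsSheffer.exists_coeff_operators {S : ∀ n : ℕ, G.Dual → G.SymDual n}
    {A : G.FormalSeries G.Phi} {ρ : G.FormalSeries ℂ} (hS : IsSheffer S A ρ)
    (hρ : HolomorphicNearZero ρ) (hA : QuasiHolomorphic A) :
    ∃ V : ∀ k n : ℕ, G.symPow n →L[ℂ] G.symPow k,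
      (∀ n, V n n = ContinuousLinearMap.id ℂ _) ∧ (∀ k n, n < k → V k n = 0) ∧
      (∀ n ω φ, S n ω φ = ∑ k ∈ Finset.range (n + 1), G.dpow ω k (V k n φ)) ∧
      ∀ τ, ∃ (τ' : T) (C : ℝ), 0 ≤ C ∧ ∀ k n, k ≤ n → ∀ φ : G.symPow n,
        G.tnorm τ (V k n φ) ≤ (n.factorial / k.factorial : ℝ) * (2 * C ^ n) * G.tnorm τ' φ := by
  obtain ⟨U, -, hU1, hU⟩ := hS.monic
  have hb := exists_norm_coords_le_of_tpow (G := G) (Ψ := fun k n ω => U n k (G.dpow ω k))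
    (fun τ => by
      obtain ⟨τ', D, hD, h⟩ := exists_coeff_bound hS.A_zero hA
        (u := fun ξ => PowerSeries.mk (compCoeff ρ A ξ))
        (fun ξ => by rw [PowerSeries.coeff_mk, compCoeff_zero hS.rho_zero])
        (by
          obtain ⟨τ, D, hD, h⟩ := exists_compCoeff_bound hρ hA
          exact ⟨τ, D, hD, fun n hn ξ => by rw [PowerSeries.coeff_mk]; exact h n hn ξ⟩) τ
      refine ⟨τ', D, hD, fun k n hkn x ξ => ?_⟩
      by_cases hξ : ξ = 0 → n = 0
      · rw [coeff_generating hS hU hkn, norm_mul]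
        refine mul_le_mul (le_of_eq (by simp)) (h k n x ξ hξ).2 (norm_nonneg _) (by positivity)
      · push Not at hξ
        rw [hξ.1, tpow_zero_left (by omega), map_zero, norm_zero]
        positivity)
  -- The transpose of U_{n,k}: F sends φ to the form (ω₁, …, ω_k) ↦ ⟨U_{n,k}(ω₁ ⊙ … ⊙ ω_k), φ⟩. The
  -- bounds of `hb` place it in Φ^{⊙k}.
  let F : ∀ k n : ℕ, G.symPow n →ₗ[ℂ] MultilinearMap ℂ (fun _ : Fin k => G.Dual) ℂ := fun k n =>
    { toFun := fun φ =>
        ({ toFun := fun Ψ => U n k Ψ φ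
           map_add' := fun x y => by rw [map_add]; rfl
           map_smul' := fun c x => by rw [map_smul]; rfl } :
          G.SymDual k →ₗ[ℂ] ℂ).compMultilinearMap (dualTensor k)
      map_add' := fun φ ψ => by ext ω; exact map_add (U n k (dualTensor k ω)) φ ψ
      map_smul' := fun c φ => by ext ω; exact map_smul (U n k (dualTensor k ω)) c φ }
  have hFsymm : ∀ k n φ (σ : Equiv.Perm (Fin k)) (ω : Fin k → G.Dual),
      F k n φ (ω ∘ σ) = F k n φ ω := fun k n φ σ ω => by
    have : dualTensor k (ω ∘ σ) = dualTensor k ω := by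
      ext ψ
      exact ψ.2.1 σ ω
    exact congrArg (fun Ψ => U n k Ψ φ) this
  have hFmem : ∀ k n, k ≤ n → ∀ φ, F k n φ ∈ G.symPow k := fun k n hkn φ => by
    refine ⟨hFsymm k n φ, fun τ => ?_⟩
    obtain ⟨τ', C, -, h⟩ := hb τ
    refine ⟨(n.factorial / k.factorial : ℝ) * (2 * C ^ n) * G.tnorm τ' φ, ?_⟩
    rintro _ ⟨v, rfl⟩
    exact h k n hkn φ (F k n φ) (hFsymm k n φ) (fun ω => rfl) v
  let V₀ : ∀ k n : ℕ, G.symPow n →ₗ[ℂ] G.symPow k := fun k n =>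
    if hkn : k ≤ n then LinearMap.codRestrict (G.symPow k) (F k n) (hFmem k n hkn) else 0
  have hV₀ : ∀ k n, k ≤ n → ∀ φ, (V₀ k n φ).1 = F k n φ := fun k n hkn φ => by
    simp only [V₀, dif_pos hkn]
    rfl
  have hbound : ∀ τ, ∃ (τ' : T) (C : ℝ), 0 ≤ C ∧ ∀ k n, k ≤ n → ∀ φ : G.symPow n,
        G.tnorm τ (V₀ k n φ) ≤ (n.factorial / k.factorial : ℝ) * (2 * C ^ n) * G.tnorm τ' φ := by
    intro τ
    obtain ⟨τ', C, hC, h⟩ := hb τ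
    refine ⟨τ', C, hC, fun k n hkn φ => tnorm_le fun v => ?_⟩
    rw [hV₀ k n hkn]
    exact h k n hkn φ (F k n φ) (hFsymm k n φ) (fun ω => rfl) v
  have hcont : ∀ k n, Continuous (V₀ k n) := fun k n => by
    refine continuous_of_tnorm_le _ fun τ => ?_
    obtain ⟨τ', C, hC, h⟩ := hbound τ
    by_cases hkn : k ≤ n
    · exact ⟨τ', _, by positivity, fun φ => h k n hkn φ⟩
    · refine ⟨τ, 0, le_rfl, fun φ => ?_⟩
      simp [V₀, dif_neg hkn]
  refine ⟨fun k n => ⟨V₀ k n, hcont k n⟩, fun n => ?_, fun k n hkn => ?_, fun n ω φ => ?_, hbound⟩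
  · ext1 φ
    refine symPow_ext fun ω => ?_
    change (V₀ n n φ).1 _ = _
    rw [hV₀ n n le_rfl]
    change U n n (dualTensor n _) φ = _
    rw [hU1]
    rfl
  · ext1 φ
    change V₀ k n φ = 0
    simp only [V₀, dif_neg (not_le.2 hkn)]
    rfl
  · rw [hU, sum_apply]
    refine Finset.sum_congr rfl fun k hk => ?_
    change _ = (V₀ k n φ).1 _
    rw [hV₀ k n (by rw [Finset.mem_range] at hk; omega)]
    rfl

end NuclearScale
end

noncomputable section

/-! ### Polynomial curves vanishing to a given order -/

section PolyCurve

open Finset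

variable {X Y : Type*} [AddCommGroup X] [Module ℂ X] [AddCommGroup Y] [Module ℂ Y]

/-- Polynomial functions `ℂ → X`. -/
def polyCurve (X : Type*) [AddCommGroup X] [Module ℂ X] : Submodule ℂ (ℂ → X) :=
  Submodule.span ℂ {f | ∃ (m : ℕ) (x : X), f = fun z => z ^ m • x}

/-- Polynomial functions `ℂ → X` that vanish to order `i` at zero. -/
def vanish (X : Type*) [AddCommGroup X] [Module ℂ X] (i : ℕ) : Submodule ℂ (ℂ → X) where
  carrier := {f | ∃ g ∈ polyCurve X, f = fun z => z ^ i • g z}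
  add_mem' := by
    rintro _ _ ⟨g, hg, rfl⟩ ⟨h, hh, rfl⟩
    exact ⟨g + h, add_mem hg hh, by funext z; simp⟩
  zero_mem' := ⟨0, zero_mem _, by funext z; simp⟩
  smul_mem' := by
    rintro c _ ⟨g, hg, rfl⟩
    exact ⟨c • g, Submodule.smul_mem _ c hg, by funext z; simp [smul_comm c]⟩

theorem pow_smul_mem_polyCurve (m : ℕ) (x : X) : (fun z : ℂ => z ^ m • x) ∈ polyCurve X :=
  Submodule.subset_span ⟨m, x, rfl⟩

theorem exists_sum_of_mem_polyCurve {g : ℂ → X} (hg : g ∈ polyCurve X) :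
    ∃ (N : ℕ) (c : ℕ → X), g = fun z => ∑ m ∈ Finset.range N, z ^ m • c m := by
  induction hg using Submodule.span_induction with
  | mem f hf =>
    obtain ⟨m, x, rfl⟩ := hf
    refine ⟨m + 1, fun k => if k = m then x else 0, ?_⟩
    funext z
    simp [Finset.sum_ite_eq']
  | zero => exact ⟨0, 0, by funext z; simp⟩
  | add f g _ _ hf hg =>
    obtain ⟨N, c, rfl⟩ := hf
    obtain ⟨M, d, rfl⟩ := hg
    refine ⟨N + M, fun k => (if k < N then c k else 0) + (if k < M then d k else 0), ?_⟩
    funext z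
    have key : ∀ (N M : ℕ) (c : ℕ → X), N ≤ M →
        ∑ m ∈ Finset.range N, z ^ m • c m = ∑ m ∈ Finset.range M, z ^ m • (if m < N then c m else 0) := by
      intro N M c h
      rw [← Finset.sum_subset (Finset.range_mono h)
        (f := fun m => z ^ m • (if m < N then c m else 0))]
      · refine Finset.sum_congr rfl fun m hm => ?_
        rw [if_pos (Finset.mem_range.1 hm)]
      · intro m _ hm
        rw [if_neg (by simpa using hm), smul_zero]
    simp only [Pi.add_apply, smul_add, Finset.sum_add_distrib]
    rw [key N (N + M) c (by omega), key M (N + M) d (by omega)]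
  | smul a f _ hf =>
    obtain ⟨N, c, rfl⟩ := hf
    refine ⟨N, fun k => a • c k, ?_⟩
    funext z
    simp [Finset.smul_sum, smul_comm a]

theorem vanish_antitone {i j : ℕ} (h : i ≤ j) : vanish X j ≤ vanish X i := by
  rintro _ ⟨g, hg, rfl⟩
  refine ⟨fun z => z ^ (j - i) • g z, ?_, ?_⟩
  · obtain ⟨N, c, rfl⟩ := exists_sum_of_mem_polyCurve hg
    have : (fun z : ℂ => z ^ (j - i) • ∑ m ∈ Finset.range N, z ^ m • c m) =
        ∑ m ∈ Finset.range N, fun z : ℂ => z ^ (j - i + m) • c m := by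
      funext z
      simp [Finset.smul_sum, smul_smul, pow_add]
    rw [this]
    exact sum_mem fun m _ => pow_smul_mem_polyCurve _ _
  · funext z
    rw [smul_smul, ← pow_add, Nat.add_sub_cancel' h]

theorem pow_smul_mem_vanish (m : ℕ) (x : X) : (fun z : ℂ => z ^ m • x) ∈ vanish X m :=
  ⟨fun _ => x, by simpa using pow_smul_mem_polyCurve 0 x, rfl⟩

theorem MultilinearMap.comp_mem_polyCurve {k : ℕ} (F : MultilinearMap ℂ (fun _ : Fin k => X) Y)
    {y : Fin k → ℂ → X} (hy : ∀ p, y p ∈ polyCurve X) : (fun z => F fun p => y p z) ∈ polyCurve Y := by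
  choose N c hc using fun p => exists_sum_of_mem_polyCurve (hy p)
  have : (fun z => F fun p => y p z) = ∑ r ∈ Fintype.piFinset fun p => Finset.range (N p),
      fun z : ℂ => z ^ (∑ p, r p) • F fun p => c p (r p) := by
    funext z
    simp only [hc, F.map_sum_finset]
    rw [Finset.sum_apply]
    refine Finset.sum_congr rfl fun r _ => ?_
    rw [F.map_smul_univ (fun p => z ^ r p), Finset.prod_pow_eq_pow_sum]
  rw [this]
  exact sum_mem fun r _ => pow_smul_mem_polyCurve _ _

/-- Orders of vanishing add under a multilinear map. This calculus modulo z^{n+1} replaces formal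
power series with vector coefficients in the inversion below. -/
theorem MultilinearMap.comp_mem_vanish {k : ℕ} (F : MultilinearMap ℂ (fun _ : Fin k => X) Y)
    {y : Fin k → ℂ → X} {i : Fin k → ℕ} (hy : ∀ p, y p ∈ vanish X (i p)) :
    (fun z => F fun p => y p z) ∈ vanish Y (∑ p, i p) := by
  choose g hg h using hy
  refine ⟨_, F.comp_mem_polyCurve hg, ?_⟩
  funext z
  simp only [h]
  rw [F.map_smul_univ (fun p => z ^ i p), Finset.prod_pow_eq_pow_sum]

theorem LinearMap.comp_mem_vanish (f : X →ₗ[ℂ] Y) {y : ℂ → X} {i : ℕ} (hy : y ∈ vanish X i) :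
    (fun z => f (y z)) ∈ vanish Y i := by
  obtain ⟨g, hg, rfl⟩ := hy
  obtain ⟨N, c, rfl⟩ := exists_sum_of_mem_polyCurve hg
  refine ⟨∑ m ∈ Finset.range N, fun z : ℂ => z ^ m • f (c m),
    sum_mem fun m _ => pow_smul_mem_polyCurve _ _, ?_⟩
  funext z
  simp [Finset.sum_apply]

theorem mul_mem_vanish {u v : ℂ → ℂ} {i j : ℕ} (hu : u ∈ vanish ℂ i) (hv : v ∈ vanish ℂ j) :
    (fun z => u z * v z) ∈ vanish ℂ (i + j) := by
  have := (MultilinearMap.mkPiAlgebra ℂ (Fin 2) ℂ).comp_mem_vanish (y := ![u, v]) (i := ![i, j])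
    (by intro p; fin_cases p <;> simpa)
  simpa [Fin.prod_univ_two, Fin.sum_univ_two] using this

/-- Expand F at x + (y − x): every term except F(x, …, x) contains a factor y − x. Hence F on the
diagonal respects congruence of curves modulo z^n. -/
theorem MultilinearMap.comp_sub_comp_mem_vanish {k n : ℕ}
    (F : MultilinearMap ℂ (fun _ : Fin k => X) Y) {y x : ℂ → X} (hx : x ∈ vanish X 0)
    (h : (fun z => y z - x z) ∈ vanish X n) :
    (fun z => F (fun _ => y z) - F (fun _ => x z)) ∈ vanish Y n := by
  classical
  have : (fun z => F (fun _ => y z) - F (fun _ => x z)) =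
      ∑ s ∈ (univ : Finset (Finset (Fin k))).erase univ,
        fun z => F (s.piecewise (fun _ => x z) (fun _ => y z - x z)) := by
    funext z
    have h1 := F.map_add_univ (fun _ => x z) (fun _ => y z - x z)
    have h2 : ((fun _ => x z) + fun _ => y z - x z : Fin k → X) = fun _ => y z := by
      funext p
      simp
    rw [h2, ← Finset.add_sum_erase _ _ (Finset.mem_univ Finset.univ)] at h1
    rw [h1, Finset.sum_apply]
    simp
  rw [this]
  refine sum_mem fun s hs => ?_
  have h3 := F.comp_mem_vanish (y := fun p z => if p ∈ s then x z else y z - x z)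
    (i := fun p => if p ∈ s then 0 else n) (fun p => by
      by_cases hp : p ∈ s
      · simpa [hp] using hx
      · simpa [hp] using h)
  refine vanish_antitone ?_ h3
  obtain ⟨p, hp⟩ : ∃ p, p ∉ s := by
    by_contra! hcon
    exact (Finset.ne_of_mem_erase hs) (Finset.eq_univ_iff_forall.2 hcon)
  refine le_trans (by simp [hp]) (Finset.single_le_sum (f := fun p => if p ∈ s then 0 else n)
    (fun _ _ => Nat.zero_le _) (Finset.mem_univ p))

/-- A polynomial divisible by z^{n+1} has no term in z^n. This turns a congruence of curves back
into an identity between coefficients. -/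
theorem eq_zero_of_sum_mem_vanish {n : ℕ} {d : ℕ → ℂ}
    (h : (fun z : ℂ => ∑ m ∈ Finset.range (n + 1), z ^ m * d m) ∈ vanish ℂ (n + 1)) : d n = 0 := by
  obtain ⟨g, hg, h⟩ := h
  obtain ⟨N, c, rfl⟩ := exists_sum_of_mem_polyCurve hg
  have hP : (∑ m ∈ Finset.range (n + 1), Polynomial.monomial m (d m) : Polynomial ℂ) =
      Polynomial.X ^ (n + 1) * ∑ m ∈ Finset.range N, Polynomial.monomial m (c m) :=
    Polynomial.funext fun z => by
      have := congrFun h z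
      simp only [Polynomial.eval_finsetSum, Polynomial.eval_monomial, Polynomial.eval_mul,
        Polynomial.eval_pow, Polynomial.eval_X]
      simp only [smul_eq_mul] at this
      simpa only [mul_comm] using this
  have := congrArg (fun P => Polynomial.coeff P n) hP
  beta_reduce at this
  rw [Polynomial.coeff_X_pow_mul', if_neg (by omega), Polynomial.finsetSum_coeff] at this
  simpa [Polynomial.coeff_monomial] using this

/-- Collecting the terms of low degree. -/
theorem sum_sub_sum_fiber_mem_vanish {ι : Type*} [DecidableEq ι] (s : Finset ι) (deg : ι → ℕ) {g : ι → ℂ → X}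
    (hg : ∀ i ∈ s, g i ∈ vanish X (deg i)) (n : ℕ) :
    (fun z => ∑ i ∈ s, g i z - ∑ m ∈ Finset.range (n + 1), ∑ i ∈ s with deg i = m, g i z) ∈
      vanish X (n + 1) := by
  have : (fun z => ∑ i ∈ s, g i z - ∑ m ∈ Finset.range (n + 1), ∑ i ∈ s with deg i = m, g i z) =
      ∑ i ∈ s with ¬ deg i ≤ n, g i := by
    funext z
    rw [Finset.sum_apply, ← Finset.sum_filter_add_sum_filter_not s (fun i => deg i ≤ n)]
    rw [← Finset.sum_fiberwise_of_maps_to (s := {i ∈ s | deg i ≤ n}) (t := Finset.range (n + 1)) (g := deg)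
      (fun i hi => by
        simp only [Finset.mem_filter] at hi
        simp only [Finset.mem_range]
        omega)]
    have : ∀ m ∈ Finset.range (n + 1), {i ∈ {i ∈ s | deg i ≤ n} | deg i = m} = {i ∈ s | deg i = m} := by
      intro m hm
      ext i
      simp only [Finset.mem_filter, Finset.mem_range] at hm ⊢
      constructor
      · rintro ⟨⟨h1, h2⟩, h3⟩
        exact ⟨h1, h3⟩
      · rintro ⟨h1, h2⟩
        exact ⟨⟨h1, by omega⟩, h2⟩
    rw [Finset.sum_congr rfl (fun m hm => by rw [this m hm])]
    abel
  rw [this]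
  refine sum_mem fun i hi => ?_
  simp only [Finset.mem_filter] at hi
  exact vanish_antitone (by omega) (hg i hi.1)

theorem sum_mul_sum_sub_mem_vanish {u v : ℕ → ℂ → ℂ} (hu : ∀ i, u i ∈ vanish ℂ i)
    (hv : ∀ i, v i ∈ vanish ℂ i) (n : ℕ) :
    (fun z => (∑ i ∈ Finset.range (n + 1), u i z) * (∑ j ∈ Finset.range (n + 1), v j z) -
      ∑ m ∈ Finset.range (n + 1), ∑ p ∈ HasAntidiagonal.antidiagonal m, u p.1 z * v p.2 z) ∈
      vanish ℂ (n + 1) := by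
  have h := sum_sub_sum_fiber_mem_vanish (Finset.range (n + 1) ×ˢ Finset.range (n + 1))
    (fun p : ℕ × ℕ => p.1 + p.2) (g := fun p z => u p.1 z * v p.2 z)
    (fun p _ => mul_mem_vanish (hu _) (hv _)) n
  convert h using 2 with z
  rw [Finset.sum_mul_sum, Finset.sum_product]
  congr 1
  refine Finset.sum_congr rfl fun m hm => Finset.sum_congr ?_ fun _ _ => rfl
  ext p
  simp only [Finset.mem_range, HasAntidiagonal.mem_antidiagonal, Finset.mem_filter,
    Finset.mem_product] at hm ⊢
  omega

theorem MultilinearMap.comp_sum_sub_mem_vanish {k : ℕ} (F : MultilinearMap ℂ (fun _ : Fin k => X) Y)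
    {y : ℕ → ℂ → X} (hy : ∀ i, y i ∈ vanish X i) (n : ℕ) :
    (fun z => F (fun _ => ∑ i ∈ Finset.range (n + 1), y i z) -
      ∑ m ∈ Finset.range (n + 1), ∑ j ∈ piAntidiag (univ : Finset (Fin k)) m, F fun p => y (j p) z) ∈
      vanish Y (n + 1) := by
  have h := sum_sub_sum_fiber_mem_vanish (Fintype.piFinset fun _ : Fin k => Finset.range (n + 1))
    (fun j => ∑ p, j p) (g := fun j z => F fun p => y (j p) z)
    (fun j _ => F.comp_mem_vanish fun p => hy (j p)) n
  convert h using 2 with z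
  rw [F.map_sum_finset]
  congr 1
  refine Finset.sum_congr rfl fun m hm => Finset.sum_congr ?_ fun _ _ => rfl
  ext j
  simp only [Finset.mem_range, mem_piAntidiag, Finset.mem_filter, Fintype.mem_piFinset,
    Finset.mem_univ, implies_true, and_true] at hm ⊢
  refine ⟨fun (h : Finset.univ.sum j = m) => ⟨fun p => ?_, h⟩, fun h => h.2⟩
  have : j p ≤ Finset.univ.sum j :=
    Finset.single_le_sum (f := j) (fun _ _ => Nat.zero_le _) (Finset.mem_univ p)
  omega

/-- Compositions as tuples of positive integers. -/
theorem sum_composition_eq {Y : Type*} [AddCommMonoid Y] {n m : ℕ} (hm : m ≤ n) (g : ∀ k : ℕ, (Fin k → ℕ) → Y)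
    (hg : ∀ k (j : Fin k → ℕ), (∃ p, j p = 0) → g k j = 0) :
    ∑ c : Composition m, g c.length c.blocksFun =
      ∑ k ∈ Finset.range (n + 1), ∑ j ∈ piAntidiag (univ : Finset (Fin k)) m, g k j := by
  rw [Finset.sum_sigma']
  refine Finset.sum_of_injOn (fun c : Composition m => (⟨c.length, c.blocksFun⟩ : Σ k, Fin k → ℕ))
    ?_ ?_ ?_ ?_
  · intro c _ c' _ h
    have := List.ofFn_inj'.2 h
    rw [c.ofFn_blocksFun, c'.ofFn_blocksFun] at this
    exact Composition.ext this
  · intro c _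
    simp only [Finset.coe_sigma, Set.mem_sigma_iff, Finset.mem_coe, Finset.mem_range, mem_piAntidiag,
      Finset.mem_univ, implies_true, and_true]
    exact ⟨by have := c.length_le; omega, c.sum_blocksFun⟩
  · rintro ⟨k, j⟩ hkj hnot
    refine hg k j ?_
    by_contra! hpos
    refine hnot ⟨⟨List.ofFn j, fun {i} hi => ?_, ?_⟩, by simp, ?_⟩
    · obtain ⟨p, rfl⟩ := (List.mem_ofFn' _ _).1 hi
      exact Nat.pos_of_ne_zero (hpos p)
    · rw [List.sum_ofFn]
      simp only [Finset.mem_sigma, Finset.mem_range, mem_piAntidiag] at hkj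
      exact hkj.2.1
    · refine List.ofFn_inj'.1 ?_
      rw [Composition.ofFn_blocksFun]
  · intro c _
    rfl

/-- Substitution of one series into another, modulo z^{n+1}: multilinear expansion gives tuples of
indices, and `hy0` kills those with a zero entry, so that exactly the compositions remain. -/
theorem sum_composition_sub_mem_vanish (F : ∀ k : ℕ, MultilinearMap ℂ (fun _ : Fin k => X) Y)
    {y : ℕ → ℂ → X} (hy : ∀ i, y i ∈ vanish X i) (hy0 : y 0 = 0) (n : ℕ) :
    (fun z => ∑ k ∈ Finset.range (n + 1), F k (fun _ => ∑ i ∈ Finset.range (n + 1), y i z) -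
      ∑ m ∈ Finset.range (n + 1), ∑ c : Composition m, F c.length fun p => y (c.blocksFun p) z) ∈
      vanish Y (n + 1) := by
  have h := sum_mem (t := Finset.range (n + 1)) (S := vanish Y (n + 1))
    (fun k _ => (F k).comp_sum_sub_mem_vanish hy n)
  convert h using 1
  funext z
  rw [Finset.sum_apply, Finset.sum_sub_distrib]
  congr 1
  rw [Finset.sum_comm]
  refine Finset.sum_congr rfl fun m hm => ?_
  refine sum_composition_eq (by rw [Finset.mem_range] at hm; omega)
    (fun k j => F k fun p => y (j p) z) fun k j ⟨p, hp⟩ => ?_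
  exact (F k).map_coord_zero p (by simp [hp, hy0])

theorem PowerSeries.coeff_prod_fin {k : ℕ} (f : Fin k → PowerSeries ℂ) (m : ℕ) :
    PowerSeries.coeff m (∏ p, f p) =
      ∑ j ∈ piAntidiag (univ : Finset (Fin k)) m, ∏ p, PowerSeries.coeff (j p) (f p) := by
  rw [PowerSeries.coeff_prod]
  refine Finset.sum_equiv Finsupp.equivFunOnFinite (fun l => ?_) fun l _ => rfl
  simp [Finset.mem_finsuppAntidiag, mem_piAntidiag]

end PolyCurve
end

noncomputable section

namespace NuclearScale

variable {T : Type*} {G : NuclearScale T}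

/-! ### Inversion of the generating function -/

/-- The coefficient at `z ^ m` of `B(z η) ^ {⊗ k}`. -/
def powCoeff (B : G.FormalSeries G.Phi) (η : G.Phi) (k m : ℕ) : G.symPow k :=
  ∑ j ∈ Finset.piAntidiag (Finset.univ : Finset (Fin k)) m,
    G.symTensor fun p => B (j p) (G.tpow η (j p))

theorem dpow_powCoeff (B : G.FormalSeries G.Phi) (ω : G.Dual) (η : G.Phi) (k m : ℕ) :
    G.dpow ω k (powCoeff B η k m) = PowerSeries.coeff m (pairSeries B ω η ^ k) := by
  have h : pairSeries B ω η ^ k = ∏ _p : Fin k, pairSeries B ω η := by simp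
  rw [h, PowerSeries.coeff_prod_fin, powCoeff, map_sum]
  refine Finset.sum_congr rfl fun j _ => ?_
  rw [dpow_apply, symTensor_diag]
  simp [pairSeries]

theorem tpow_comp_mem_vanish {Y : Type*} [AddCommGroup Y] [Module ℂ Y] {k : ℕ}
    (L : G.symPow k →ₗ[ℂ] Y) {ξ : ℂ → G.Phi} (hξ : ξ ∈ vanish G.Phi 1) :
    (fun z => L (G.tpow (ξ z) k)) ∈ vanish Y k := by
  have := (L.compMultilinearMap (symTensorMap k)).comp_mem_vanish (y := fun _ => ξ)
    (i := fun _ => 1) fun _ => hξ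
  rw [Finset.sum_const, Finset.card_univ, Fintype.card_fin, smul_eq_mul, mul_one] at this
  exact this

theorem compCoeff_comp_mem_vanish {ρ : G.FormalSeries ℂ} {A : G.FormalSeries G.Phi}
    {ξ : ℂ → G.Phi} (hξ : ξ ∈ vanish G.Phi 1) (m : ℕ) :
    (fun z => compCoeff ρ A (ξ z) m) ∈ vanish ℂ m := by
  have : (fun z => compCoeff ρ A (ξ z) m) = ∑ c : Composition m, fun z =>
      ((ρ c.length).toLinearMap.compMultilinearMap (symTensorMap c.length))
        fun p => A (c.blocksFun p) (G.tpow (ξ z) (c.blocksFun p)) := by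
    funext z
    rw [Finset.sum_apply]
    rfl
  rw [this]
  refine sum_mem fun c _ => ?_
  have h := ((ρ c.length).toLinearMap.compMultilinearMap (symTensorMap c.length)).comp_mem_vanish
    (y := fun p z => A (c.blocksFun p) (G.tpow (ξ z) (c.blocksFun p)))
    (i := c.blocksFun) fun p => tpow_comp_mem_vanish (A (c.blocksFun p)).toLinearMap hξ
  rwa [c.sum_blocksFun] at h

/-- The curve `z ↦ B(z η)`, truncated at order `n`. -/
def truncCurve (B : G.FormalSeries G.Phi) (η : G.Phi) (n : ℕ) (z : ℂ) : G.Phi :=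
  ∑ i ∈ Finset.range (n + 1), z ^ i • B i (G.tpow η i)

theorem truncCurve_mem {B : G.FormalSeries G.Phi} (hB : B 0 = 0) (η : G.Phi) (n : ℕ) :
    truncCurve B η n ∈ vanish G.Phi 1 := by
  have : truncCurve B η n = ∑ i ∈ Finset.range (n + 1), fun z : ℂ => z ^ i • B i (G.tpow η i) := by
    funext z
    rw [Finset.sum_apply]
    rfl
  rw [this]
  refine sum_mem fun i _ => ?_
  rcases Nat.eq_zero_or_pos i with rfl | hi
  · convert zero_mem (vanish G.Phi 1) using 1
    funext z
    simp [hB]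
  · exact vanish_antitone hi (pow_smul_mem_vanish i _)

theorem symTensor_pow_smul {k : ℕ} (z : ℂ) (j : Fin k → ℕ) (b : ℕ → G.Phi) :
    G.symTensor (fun p => z ^ j p • b (j p)) = z ^ (∑ p, j p) • G.symTensor fun p => b (j p) := by
  rw [← symTensorMap_apply, (symTensorMap k).map_smul_univ (fun p => z ^ j p),
    Finset.prod_pow_eq_pow_sum]
  rfl

/-- The identity A(B(zη)) = zη along the truncated curve: cutting B at order n changes nothing
modulo z^{n+1}. -/
theorem sum_tpow_truncCurve_sub_mem {A B : G.FormalSeries G.Phi} (hAB : IsCompInverse A B)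
    (η : G.Phi) (n : ℕ) :
    (fun z => ∑ k ∈ Finset.range (n + 1), A k (G.tpow (truncCurve B η n z) k) - z • η) ∈
      vanish G.Phi (n + 1) := by
  have h := sum_composition_sub_mem_vanish
    (fun k => (A k).toLinearMap.compMultilinearMap (symTensorMap k))
    (y := fun i z => z ^ i • B i (G.tpow η i)) (fun i => pow_smul_mem_vanish i _)
    (by funext z; simp [hAB.2.1]) n
  -- For n = 0 the term m = 1 is outside the range, but what remains, −zη, vanishes to order 1 = n +
  -- 1.
  have h2 : (fun z : ℂ => ∑ m ∈ Finset.range (n + 1), z ^ m • (if m = 1 then η else 0) - z • η) ∈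
      vanish G.Phi (n + 1) := by
    rcases Nat.eq_zero_or_pos n with rfl | hn
    · have := neg_mem (pow_smul_mem_vanish (X := G.Phi) 1 η)
      convert this using 1
      funext z
      simp
    · convert zero_mem (vanish G.Phi (n + 1)) using 1
      funext z
      simp only [smul_ite, smul_zero, Finset.sum_ite_eq', Finset.mem_range, pow_one, Pi.zero_apply]
      rw [if_pos (by omega), sub_self]
  have h3 := add_mem h h2
  convert h3 using 1
  funext z
  simp only [Pi.add_apply]
  have h4 : ∀ m ∈ Finset.range (n + 1), ∑ c : Composition m,
      ((A c.length).toLinearMap.compMultilinearMap (symTensorMap c.length))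
        (fun p => z ^ c.blocksFun p • B (c.blocksFun p) (G.tpow η (c.blocksFun p))) =
      z ^ m • (if m = 1 then η else 0) := fun m _ => by
    rw [← (hAB.2.2 η m).1, compCoeff, Finset.smul_sum]
    refine Finset.sum_congr rfl fun c _ => ?_
    change A c.length (G.symTensor _) = _
    rw [symTensor_pow_smul z c.blocksFun (fun i => B i (G.tpow η i)), c.sum_blocksFun, map_smul]
  rw [Finset.sum_congr rfl h4]
  have h5 : ∀ k, ((A k).toLinearMap.compMultilinearMap (symTensorMap k))
      (fun _ => ∑ i ∈ Finset.range (n + 1), z ^ i • B i (G.tpow η i)) =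
      A k (G.tpow (truncCurve B η n z) k) := fun k => rfl
  simp only [h5]
  abel

/-- ρ(A(B(zη))) = ρ(zη) modulo z^{n+1}: regroup the composition and replace A along the curve by zη,
to which it is congruent. -/
theorem sum_compCoeff_truncCurve_sub_mem {A B : G.FormalSeries G.Phi} (hAB : IsCompInverse A B)
    (ρ : G.FormalSeries ℂ) (η : G.Phi) (n : ℕ) :
    (fun z => ∑ m ∈ Finset.range (n + 1), compCoeff ρ A (truncCurve B η n z) m -
      ∑ k ∈ Finset.range (n + 1), z ^ k * ρ k (G.tpow η k)) ∈ vanish ℂ (n + 1) := by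
  have hξ := truncCurve_mem hAB.2.1 η n
  have h := sum_composition_sub_mem_vanish
    (fun k => (ρ k).toLinearMap.compMultilinearMap (symTensorMap k))
    (y := fun i z => A i (G.tpow (truncCurve B η n z) i))
    (fun i => tpow_comp_mem_vanish (A i).toLinearMap hξ)
    (by funext z; simp [hAB.1]) n
  have h2 := sum_mem (t := Finset.range (n + 1)) (S := vanish ℂ (n + 1))
    (fun k _ => ((ρ k).toLinearMap.compMultilinearMap (symTensorMap k)).comp_sub_comp_mem_vanish
      (vanish_antitone (Nat.zero_le 1) (by simpa using pow_smul_mem_vanish 1 η))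
      (sum_tpow_truncCurve_sub_mem hAB η n))
  have h3 := sub_mem h2 h
  convert h3 using 1
  funext z
  simp only [Pi.sub_apply, Finset.sum_apply, Finset.sum_sub_distrib]
  have h5 : ∀ k, ((ρ k).toLinearMap.compMultilinearMap (symTensorMap k)) (fun _ => z • η) =
      z ^ k * ρ k (G.tpow η k) := fun k => by
    change ρ k (G.tpow (z • η) k) = _
    rw [tpow_smul, map_smul, smul_eq_mul]
  simp only [h5]
  have h6 : ∀ m ∈ Finset.range (n + 1), ∑ c : Composition m,
      ((ρ c.length).toLinearMap.compMultilinearMap (symTensorMap c.length))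
        (fun p => A (c.blocksFun p) (G.tpow (truncCurve B η n z) (c.blocksFun p))) =
      compCoeff ρ A (truncCurve B η n z) m := fun m _ => rfl
  rw [Finset.sum_congr rfl h6]
  abel

/-- Likewise exp⟨ω, A(B(zη))⟩ = exp(z⟨ω, η⟩) modulo z^{n+1}, one power of the exponential series at
a time. -/
theorem sum_coeff_exp_sub_mem {A B : G.FormalSeries G.Phi} (hAB : IsCompInverse A B)
    (ω : G.Dual) (η : G.Phi) (n : ℕ) :
    (fun z => ∑ m ∈ Finset.range (n + 1), PowerSeries.coeff m
        ((PowerSeries.exp ℂ).subst (pairSeries A ω (truncCurve B η n z))) -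
      ∑ k ∈ Finset.range (n + 1), z ^ k * ((k.factorial : ℂ)⁻¹ * ω η ^ k)) ∈ vanish ℂ (n + 1) := by
  have hξ := truncCurve_mem hAB.2.1 η n
  set a : ℕ → ℂ → ℂ := fun i z => ω (A i (G.tpow (truncCurve B η n z) i)) with ha
  have hav : ∀ i, a i ∈ vanish ℂ i := fun i =>
    tpow_comp_mem_vanish (ω.toLinearMap ∘ₗ (A i).toLinearMap) hξ
  have h1 := fun k => (MultilinearMap.mkPiAlgebra ℂ (Fin k) ℂ).comp_sum_sub_mem_vanish hav n
  have h2 : (fun z => ∑ i ∈ Finset.range (n + 1), a i z - z * ω η) ∈ vanish ℂ (n + 1) := by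
    have := ω.toLinearMap.comp_mem_vanish (sum_tpow_truncCurve_sub_mem hAB η n)
    simpa [ha] using this
  have h3 := fun k => (MultilinearMap.mkPiAlgebra ℂ (Fin k) ℂ).comp_sub_comp_mem_vanish
    (vanish_antitone (Nat.zero_le 1) (by simpa using pow_smul_mem_vanish 1 (ω η))) h2
  have h4 := sum_mem (t := Finset.range (n + 1)) (S := vanish ℂ (n + 1)) (fun k _ =>
    Submodule.smul_mem _ ((k.factorial : ℂ)⁻¹) (sub_mem (h3 k) (h1 k)))
  convert h4 using 1
  funext z
  have h5 : ∀ m ∈ Finset.range (n + 1), PowerSeries.coeff m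
        ((PowerSeries.exp ℂ).subst (pairSeries A ω (truncCurve B η n z))) =
      ∑ k ∈ Finset.range (n + 1), (k.factorial : ℂ)⁻¹ *
        ∑ j ∈ Finset.piAntidiag (Finset.univ : Finset (Fin k)) m, ∏ p, a (j p) z := fun m hm => by
    have h := PowerSeries.coeff_exp_subst_smul
      (a := pairSeries A ω (truncCurve B η n z)) (by simp [pairSeries, hAB.1]) 1
      (n := m) (N := n) (by rw [Finset.mem_range] at hm; omega)
    rw [one_smul] at h
    rw [h]
    refine Finset.sum_congr rfl fun k _ => ?_
    have h6 : pairSeries A ω (truncCurve B η n z) ^ k =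
      ∏ _p : Fin k, pairSeries A ω (truncCurve B η n z) := by simp
    rw [h6, PowerSeries.coeff_prod_fin, one_pow, one_mul]
    simp [pairSeries, ha]
  rw [Finset.sum_congr rfl h5, Finset.sum_comm]
  simp only [Finset.sum_apply, Pi.smul_apply, Pi.sub_apply, ← Finset.sum_sub_distrib]
  refine Finset.sum_congr rfl fun k _ => ?_
  have h7 : ∑ m ∈ Finset.range (n + 1), (k.factorial : ℂ)⁻¹ *
      ∑ j ∈ Finset.piAntidiag (Finset.univ : Finset (Fin k)) m, ∏ p, a (j p) z =
      (k.factorial : ℂ)⁻¹ * ∑ m ∈ Finset.range (n + 1),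
        ∑ j ∈ Finset.piAntidiag (Finset.univ : Finset (Fin k)) m, ∏ p, a (j p) z :=
    (Finset.mul_sum _ _ _).symm
  rw [h7]
  simp only [MultilinearMap.mkPiAlgebra_apply, Finset.prod_const, Finset.card_univ,
    Fintype.card_fin, smul_eq_mul]
  ring

/-- This is the coefficient of z^n in the generating function after the substitution ξ = B(zη). That
function is given only as a formal series along each line, so its homogeneous terms are evaluated on
the polynomial curve z ↦ ∑_{i≤n} z^i B_i η^{⊗i} and compared modulo z^{n+1}. -/
theorem IsSheffer.sum_powCoeff {S : ∀ n : ℕ, G.Dual → G.SymDual n} {A B : G.FormalSeries G.Phi}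
    {ρ : G.FormalSeries ℂ} (hS : IsSheffer S A ρ) (hAB : IsCompInverse A B)
    (ω : G.Dual) (η : G.Phi) (n : ℕ) :
    ∑ p ∈ Finset.HasAntidiagonal.antidiagonal n, (∑ k ∈ Finset.range (n + 1),
      (k.factorial : ℂ)⁻¹ * S k ω (powCoeff B η k p.1)) * ρ p.2 (G.tpow η p.2) =
      (n.factorial : ℂ)⁻¹ * ω η ^ n := by
  have hξ := truncCurve_mem hAB.2.1 η n
  set ξ := truncCurve B η n with hξdef
  let s : ℕ → ℂ → ℂ := fun k z => (k.factorial : ℂ)⁻¹ * S k ω (G.tpow (ξ z) k)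
  let r : ℕ → ℂ → ℂ := fun k z => compCoeff ρ A (ξ z) k
  let p : ℕ → ℂ := fun m => ∑ k ∈ Finset.range (n + 1),
    (k.factorial : ℂ)⁻¹ * S k ω (powCoeff B η k m)
  have hs : ∀ k, s k ∈ vanish ℂ k := fun k =>
    Submodule.smul_mem _ _ (tpow_comp_mem_vanish (S k ω).toLinearMap hξ)
  have hr : ∀ k, r k ∈ vanish ℂ k := fun k => compCoeff_comp_mem_vanish hξ k
  have hsr := sum_mul_sum_sub_mem_vanish hs hr n
  have hexp : ∀ z m, ∑ q ∈ Finset.HasAntidiagonal.antidiagonal m, s q.1 z * r q.2 z =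
      PowerSeries.coeff m ((PowerSeries.exp ℂ).subst (pairSeries A ω (ξ z))) := fun z m => by
    have h0 : PowerSeries.constantCoeff (PowerSeries.mk (compCoeff ρ A (ξ z))) ≠ 0 := by
      rw [← PowerSeries.coeff_zero_eq_constantCoeff_apply, PowerSeries.coeff_mk,
        compCoeff_zero hS.rho_zero]
      exact one_ne_zero
    have h1 : PowerSeries.mk (fun k => s k z) * PowerSeries.mk (compCoeff ρ A (ξ z)) =
        (PowerSeries.exp ℂ).subst (pairSeries A ω (ξ z)) := by
      rw [show PowerSeries.mk (fun k => s k z) = _ from hS.generating ω (ξ z), mul_assoc,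
        PowerSeries.inv_mul_cancel _ h0, mul_one]
      rfl
    rw [← h1, PowerSeries.coeff_mul]
    simp [r]
  simp only [hexp] at hsr
  have hE := sum_coeff_exp_sub_mem hAB ω η n
  have hR := sum_compCoeff_truncCurve_sub_mem hAB ρ η n
  have hP : (fun z => ∑ k ∈ Finset.range (n + 1), s k z - ∑ m ∈ Finset.range (n + 1), z ^ m * p m) ∈
      vanish ℂ (n + 1) := by
    have h := sum_mem (t := Finset.range (n + 1)) (S := vanish ℂ (n + 1)) (fun k _ =>
      Submodule.smul_mem _ ((k.factorial : ℂ)⁻¹)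
        (((S k ω).toLinearMap.compMultilinearMap (symTensorMap k)).comp_sum_sub_mem_vanish
        (y := fun i z => z ^ i • B i (G.tpow η i)) (fun i => pow_smul_mem_vanish i _) n))
    convert h using 1
    funext z
    have h1 : ∀ k m, ∑ j ∈ Finset.piAntidiag (Finset.univ : Finset (Fin k)) m,
        ((S k ω).toLinearMap.compMultilinearMap (symTensorMap k))
          (fun q => z ^ j q • B (j q) (G.tpow η (j q))) = z ^ m * S k ω (powCoeff B η k m) :=
      fun k m => by
        rw [powCoeff, map_sum, Finset.mul_sum]
        refine Finset.sum_congr rfl fun j hj => ?_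
        rw [Finset.mem_piAntidiag] at hj
        change S k ω (G.symTensor _) = _
        rw [symTensor_pow_smul z j (fun i => B i (G.tpow η i)), map_smul, smul_eq_mul]
        congr 2
        exact hj.1
    simp only [Finset.sum_apply, Pi.smul_apply, h1, smul_eq_mul, mul_sub]
    rw [Finset.sum_sub_distrib]
    congr 1
    simp only [p, Finset.mul_sum]
    rw [Finset.sum_comm]
    refine Finset.sum_congr rfl fun k _ => Finset.sum_congr rfl fun m _ => by ring
  have hpr := sum_mul_sum_sub_mem_vanish (u := fun i z => z ^ i * p i)
    (v := fun i z => z ^ i * ρ i (G.tpow η i)) (fun i => pow_smul_mem_vanish i (p i))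
    (fun i => pow_smul_mem_vanish i (ρ i (G.tpow η i))) n
  have hr0 : (fun z => ∑ j ∈ Finset.range (n + 1), r j z) ∈ vanish ℂ 0 := by
    have := sum_mem (t := Finset.range (n + 1)) (S := vanish ℂ 0)
      (fun j _ => vanish_antitone (Nat.zero_le j) (hr j))
    convert this using 1
    funext z
    rw [Finset.sum_apply]
  have hp0 : (fun z => ∑ m ∈ Finset.range (n + 1), z ^ m * p m) ∈ vanish ℂ 0 := by
    have := sum_mem (t := Finset.range (n + 1)) (S := vanish ℂ 0)
      (fun j _ => vanish_antitone (Nat.zero_le j) (pow_smul_mem_vanish j (p j)))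
    convert this using 1
    funext z
    rw [Finset.sum_apply]
    rfl
  have h1 := mul_mem_vanish hP hr0
  have h2 := mul_mem_vanish hp0 hR
  rw [zero_add] at h2
  -- With s, p, r, ϱ denoting the truncated sums of `s`, of z^m p_m, of `r` and of ρ(zη): (s − p)r +
  -- p(r − ϱ) = sr − pϱ. The other three congruences replace sr by exp⟨ω, A(ξ)⟩, that by exp(z⟨ω,
  -- η⟩), and pϱ by its Cauchy product.
  have key := add_mem (sub_mem (sub_mem (add_mem h1 h2) hsr) hE) hpr
  have hfin : (fun z : ℂ => ∑ m ∈ Finset.range (n + 1), z ^ m *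
      ((m.factorial : ℂ)⁻¹ * ω η ^ m - ∑ q ∈ Finset.HasAntidiagonal.antidiagonal m,
        p q.1 * ρ q.2 (G.tpow η q.2))) ∈ vanish ℂ (n + 1) := by
    convert key using 1
    funext z
    simp only [Pi.add_apply, Pi.sub_apply]
    have h3 : ∀ m, ∑ q ∈ Finset.HasAntidiagonal.antidiagonal m,
        z ^ q.1 * p q.1 * (z ^ q.2 * ρ q.2 (G.tpow η q.2)) =
        z ^ m * ∑ q ∈ Finset.HasAntidiagonal.antidiagonal m, p q.1 * ρ q.2 (G.tpow η q.2) :=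
      fun m => by
        rw [Finset.mul_sum]
        refine Finset.sum_congr rfl fun q hq => ?_
        rw [← Finset.HasAntidiagonal.mem_antidiagonal.1 hq, pow_add]
        ring
    simp only [h3, mul_sub, Finset.sum_sub_distrib]
    ring
  have := eq_zero_of_sum_mem_vanish hfin
  rw [sub_eq_zero] at this
  exact this.symm

end NuclearScale
end

noncomputable section

namespace NuclearScale

variable {T : Type*} {G : NuclearScale T}

/-! ### The inverse operators -/

/-- The identity if `n = k`, and zero otherwise. -/
def deltaOp (k n : ℕ) : G.symPow n →L[ℂ] G.symPow k :=
  if h : n = k then h ▸ ContinuousLinearMap.id ℂ (G.symPow n) else 0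

theorem deltaOp_self (n : ℕ) : deltaOp (G := G) n n = ContinuousLinearMap.id ℂ _ := by
  simp [deltaOp]

theorem deltaOp_of_ne {k n : ℕ} (h : n ≠ k) : deltaOp (G := G) k n = 0 := by
  simp [deltaOp, h]

/-- The left inverse of a unipotent upper triangular matrix of operators. -/
def invOp (V : ∀ k n : ℕ, G.symPow n →L[ℂ] G.symPow k) (k : ℕ) (n : ℕ) :
    G.symPow n →L[ℂ] G.symPow k :=
  deltaOp k n - ∑ j : Fin n, (invOp V k j).comp (V j n)
termination_by n
decreasing_by exact j.2

theorem sum_invOp_apply {V : ∀ k n : ℕ, G.symPow n →L[ℂ] G.symPow k}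
    (hV : ∀ n, V n n = ContinuousLinearMap.id ℂ _) (k n : ℕ) (φ : G.symPow n) :
    ∑ j ∈ Finset.range (n + 1), invOp V k j (V j n φ) = deltaOp k n φ := by
  rw [Finset.sum_range_succ, hV, ContinuousLinearMap.id_apply, invOp, sub_apply,
    sum_apply, Finset.sum_range]
  simp

theorem invOp_of_lt (V : ∀ k n : ℕ, G.symPow n →L[ℂ] G.symPow k) (k : ℕ) :
    ∀ n, n < k → invOp V k n = 0 := by
  intro n
  induction n using Nat.strong_induction_on with
  | _ n ih =>
    intro hn
    have h : ∑ j : Fin n, (invOp V k j).comp (V j n) = 0 := Finset.sum_eq_zero fun j _ => by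
      rw [ih j j.2 (j.2.trans hn), ContinuousLinearMap.zero_comp]
    rw [invOp, deltaOp_of_ne hn.ne, h]
    ext1 φ
    rw [sub_apply, zero_apply, sub_zero]

/-- The value at `η ^ {⊗ n}` of the inverse operators. -/
def invPow (B : G.FormalSeries G.Phi) (ρ : G.FormalSeries ℂ) (η : G.Phi) (k n : ℕ) : G.symPow k :=
  (n.factorial / k.factorial : ℂ) • ∑ p ∈ Finset.HasAntidiagonal.antidiagonal n,
    ρ p.2 (G.tpow η p.2) • powCoeff B η k p.1

theorem dpow_invPow (B : G.FormalSeries G.Phi) (ρ : G.FormalSeries ℂ) (ω : G.Dual) (η : G.Phi)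
    (k n : ℕ) : G.dpow ω k (invPow B ρ η k n) = (n.factorial / k.factorial : ℂ) *
      PowerSeries.coeff n (pairSeries B ω η ^ k * PowerSeries.mk fun l => ρ l (G.tpow η l)) := by
  rw [invPow, map_smul, map_sum, PowerSeries.coeff_mul, smul_eq_mul]
  congr 1
  refine Finset.sum_congr rfl fun p _ => ?_
  rw [map_smul, dpow_powCoeff, PowerSeries.coeff_mk, smul_eq_mul, mul_comm]

theorem IsSheffer.sum_invPow {S : ∀ n : ℕ, G.Dual → G.SymDual n} {A B : G.FormalSeries G.Phi}
    {ρ : G.FormalSeries ℂ} (hS : IsSheffer S A ρ) (hAB : IsCompInverse A B)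
    (ω : G.Dual) (η : G.Phi) (n : ℕ) :
    ∑ k ∈ Finset.range (n + 1), S k ω (invPow B ρ η k n) = ω η ^ n := by
  have h := hS.sum_powCoeff hAB ω η n
  have hn : (n.factorial : ℂ) ≠ 0 := by exact_mod_cast n.factorial_ne_zero
  have h2 : ω η ^ n = (n.factorial : ℂ) * ((n.factorial : ℂ)⁻¹ * ω η ^ n) := by field_simp
  rw [h2, ← h]
  simp only [invPow, map_smul, map_sum, smul_eq_mul, Finset.mul_sum, Finset.sum_mul]
  rw [Finset.sum_comm]
  refine Finset.sum_congr rfl fun p _ => Finset.sum_congr rfl fun k _ => by ring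

/-- The explicit tensors `invPow` form a right inverse of the matrix V on the powers η^{⊗n}: insert
the expansion of S into `sum_invPow` and compare the degrees in ω. -/
theorem IsSheffer.sum_apply_invPow {S : ∀ n : ℕ, G.Dual → G.SymDual n} {A B : G.FormalSeries G.Phi}
    {ρ : G.FormalSeries ℂ} (hS : IsSheffer S A ρ) (hAB : IsCompInverse A B)
    {V : ∀ k n : ℕ, G.symPow n →L[ℂ] G.symPow k} (hV0 : ∀ k n, n < k → V k n = 0)
    (hV : ∀ n ω φ, S n ω φ = ∑ k ∈ Finset.range (n + 1), G.dpow ω k (V k n φ))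
    (η : G.Phi) {j n : ℕ} (hj : j ≤ n) :
    ∑ k ∈ Finset.range (n + 1), V j k (invPow B ρ η k n) = deltaOp j n (G.tpow η n) := by
  have hV' : ∀ k ∈ Finset.range (n + 1), ∀ ω φ, S k ω φ =
      ∑ i ∈ Finset.range (n + 1), G.dpow ω i (V i k φ) := fun k hk ω φ => by
    rw [hV]
    refine Finset.sum_subset (Finset.range_mono (by rw [Finset.mem_range] at hk; omega)) ?_
    intro i _ hi
    rw [hV0 i k (by rw [Finset.mem_range] at hi; omega)]
    simp
  refine symPow_ext fun ω => ?_
  have key := eq_of_forall_sum_pow_mul_eq (N := n + 1)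
    (x := fun i => G.dpow ω i (∑ k ∈ Finset.range (n + 1), V i k (invPow B ρ η k n)))
    (y := fun i => if i = n then ω η ^ n else 0) (fun c => by
      have h := hS.sum_invPow hAB (c • ω) η n
      rw [Finset.sum_congr rfl fun k hk => hV' k hk _ _, Finset.sum_comm] at h
      have h2 : ∑ i ∈ Finset.range (n + 1), c ^ i * (if i = n then ω η ^ n else 0) =
          (c • ω) η ^ n := by
        simp [mul_pow]
      rw [h2, ← h]
      refine Finset.sum_congr rfl fun i _ => ?_
      rw [map_sum, Finset.mul_sum]
      refine Finset.sum_congr rfl fun k _ => ?_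
      rw [dpow_smul, smul_apply, smul_eq_mul]) j (by omega)
  change G.dpow ω j _ = _
  refine key.trans ?_
  rcases eq_or_ne j n with rfl | hjn
  · rw [if_pos rfl, deltaOp_self, ContinuousLinearMap.id_apply, tpow_apply]
    simp
  · rw [if_neg hjn, deltaOp_of_ne hjn.symm]
    rfl

/-- The monomials can be expressed in terms of a Sheffer sequence, with estimates. -/
theorem IsSheffer.exists_operators {S : ∀ n : ℕ, G.Dual → G.SymDual n}
    {A B : G.FormalSeries G.Phi} {ρ : G.FormalSeries ℂ} (hS : IsSheffer S A ρ)
    (hρ : HolomorphicNearZero ρ) (hAB : IsCompInverse A B) (hA : QuasiHolomorphic A)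
    (hB : QuasiHolomorphic B) :
    ∃ V W : ∀ k n : ℕ, G.symPow n →L[ℂ] G.symPow k,
      (∀ n ω φ, S n ω φ = ∑ k ∈ Finset.range (n + 1), G.dpow ω k (V k n φ)) ∧
      (∀ τ, ∃ (τ' : T) (C : ℝ), 0 ≤ C ∧ ∀ k n, k ≤ n → ∀ φ : G.symPow n,
        G.tnorm τ (V k n φ) ≤ (n.factorial / k.factorial : ℝ) * (2 * C ^ n) * G.tnorm τ' φ) ∧
      (∀ k n, n < k → W k n = 0) ∧
      (∀ n ω φ, ∑ k ∈ Finset.range (n + 1), S k ω (W k n φ) = G.dpow ω n φ) ∧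
      (∀ k n φ, ∑ j ∈ Finset.range (n + 1), W k j (V j n φ) = deltaOp k n φ) ∧
      (∀ τ, ∃ (τ' : T) (C : ℝ), 0 ≤ C ∧ ∀ k n, k ≤ n → ∀ φ : G.symPow n,
        G.tnorm τ (W k n φ) ≤ (n.factorial / k.factorial : ℝ) * (2 * C ^ n) * G.tnorm τ' φ) := by
  obtain ⟨V, hV1, hV0, hV, hVb⟩ := hS.exists_coeff_operators hρ hA
  -- A left and a right inverse coincide: in W(V P) = (W V)P, the recursive left inverse W is a
  -- genuine operator but comes without estimates, while P = `invPow` is explicit but known only on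
  -- powers. The equality carries the estimates over to W.
  have hW : ∀ i n, i ≤ n → ∀ η, invOp V i n (G.tpow η n) = invPow B ρ η i n := by
    intro i n hin η
    have h1 : ∑ j ∈ Finset.range (n + 1), invOp V i j (deltaOp j n (G.tpow η n)) =
        invOp V i n (G.tpow η n) := by
      rw [Finset.sum_eq_single n]
      · rw [deltaOp_self]
        rfl
      · intro j _ hj
        rw [deltaOp_of_ne hj.symm]
        simp
      · intro h
        simp at h
    rw [← h1, Finset.sum_congr rfl fun j hj => by
      rw [← hS.sum_apply_invPow hAB hV0 hV η (j := j) (n := n)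
        (by rw [Finset.mem_range] at hj; omega), map_sum]]
    rw [Finset.sum_comm, Finset.sum_eq_single i]
    · have h2 := sum_invOp_apply hV1 i i (invPow B ρ η i n)
      rw [deltaOp_self] at h2
      refine Eq.trans (Finset.sum_subset (Finset.range_mono (by omega)) ?_).symm h2
      intro j _ hj
      rw [hV0 j i (by rw [Finset.mem_range] at hj; omega)]
      simp
    · intro k hk hki
      have h2 := sum_invOp_apply hV1 i k (invPow B ρ η k n)
      rw [deltaOp_of_ne hki] at h2
      refine Eq.trans (Finset.sum_subset (Finset.range_mono
        (by rw [Finset.mem_range] at hk; omega)) ?_).symm h2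
      intro j _ hj
      rw [hV0 j k (by rw [Finset.mem_range] at hj; omega)]
      simp
    · intro h
      rw [Finset.mem_range] at h
      omega
  refine ⟨V, invOp V, hV, hVb, fun k n h => invOp_of_lt V k n h, fun n ω φ => ?_,
    sum_invOp_apply hV1, fun τ => ?_⟩
  · have : ∑ k ∈ Finset.range (n + 1), (S k ω).comp (invOp V k n) = G.dpow ω n := by
      refine symDual_ext fun ξ => ?_
      rw [sum_apply, dpow_apply, tpow_apply]
      have h3 := hS.sum_invPow hAB ω ξ n
      rw [Finset.prod_const, Finset.card_univ, Fintype.card_fin, ← h3]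
      refine Finset.sum_congr rfl fun k hk => ?_
      rw [ContinuousLinearMap.comp_apply, hW k n (by rw [Finset.mem_range] at hk; omega)]
    rw [← this, sum_apply]
    rfl
  · obtain ⟨τ', C, hC, h⟩ := exists_norm_coords_le_of_tpow (G := G)
      (Ψ := fun k n ω => (G.dpow ω k).comp (invOp V k n)) (fun τ => by
        obtain ⟨τ', D, hD, h⟩ := exists_coeff_bound hAB.2.1 hB
          (u := fun ξ => PowerSeries.mk fun l => ρ l (G.tpow ξ l))
          (fun ξ => by rw [PowerSeries.coeff_mk, hS.rho_zero])
          (by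
            obtain ⟨σ, R, hR, h⟩ := hρ.exists_bound
            exact ⟨σ, R, hR, fun n hn ξ => by
              rw [PowerSeries.coeff_mk, mul_pow]; exact h n hn ξ⟩) τ
        refine ⟨τ', D, hD, fun k n hkn x ξ => ?_⟩
        by_cases hξ : ξ = 0 → n = 0
        · rw [ContinuousLinearMap.comp_apply, hW k n hkn, dpow_invPow, norm_mul]
          refine mul_le_mul (le_of_eq (by simp)) (h k n x ξ hξ).1 (norm_nonneg _) (by positivity)
        · push Not at hξ
          rw [hξ.1, tpow_zero_left (by omega), map_zero, norm_zero]
          positivity) τ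
    exact ⟨τ', C, hC, fun k n hkn φ => tnorm_le fun v =>
      h k n hkn φ (invOp V k n φ).1 (invOp V k n φ).2.1 (fun ω => rfl) v⟩

end NuclearScale
end

noncomputable section

/-! ### Parametric Cauchy formulas -/

section Cauchy

open Complex

theorem deriv_zero_eq_integral {g : ℂ → ℂ} (hg : Differentiable ℂ g) :
    deriv g 0 = (2 * Real.pi * I : ℂ)⁻¹ * ∫ θ in (0 : ℝ)..2 * Real.pi,
      deriv (circleMap 0 1) θ * (((circleMap 0 1 θ) ^ 2)⁻¹ * g (circleMap 0 1 θ)) := by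
  have h := cderiv_eq_deriv isOpen_univ hg.differentiableOn one_pos (Set.subset_univ (Metric.closedBall 0 1))
  rw [← h, cderiv, circleIntegral]
  simp

/-- Cauchy's formula on the unit circle expresses the derivative as an integral over a compact
interval, which depends continuously on parameters. -/
theorem continuous_deriv_zero {P : Type*} [TopologicalSpace P] {g : P → ℂ → ℂ}
    (hc : Continuous fun p : P × ℂ => g p.1 p.2) (hg : ∀ p, Differentiable ℂ (g p)) :
    Continuous fun p => deriv (g p) 0 := by
  simp only [deriv_zero_eq_integral (hg _)]
  refine continuous_const.mul
    (intervalIntegral.continuous_parametric_intervalIntegral_of_continuous' ?_ _ _)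
  have h1 : Continuous fun p : P × ℝ => circleMap 0 1 p.2 := (continuous_circleMap 0 1).comp continuous_snd
  have h2 : Continuous fun p : P × ℝ => deriv (circleMap 0 1) p.2 := by
    simp only [deriv_circleMap]
    exact h1.mul continuous_const
  refine h2.mul ((Continuous.inv₀ (h1.pow 2) fun p => pow_ne_zero 2 ?_).mul
    (hc.comp (continuous_fst.prodMk h1)))
  exact circleMap_ne_center one_ne_zero

theorem hasDerivAt_integral_of_continuous {F F' : ℂ → ℝ → ℂ} (a b : ℝ)
    (hF : ∀ z, Continuous (F z)) (hF' : Continuous fun p : ℂ × ℝ => F' p.1 p.2)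
    (h : ∀ z t, HasDerivAt (fun z => F z t) (F' z t) z) (z : ℂ) :
    HasDerivAt (fun z => ∫ t in a..b, F z t) (∫ t in a..b, F' z t) z := by
  obtain ⟨C, hC⟩ := ((isCompact_closedBall z 1).prod
    (isCompact_uIcc (a := a) (b := b))).exists_bound_of_continuousOn hF'.continuousOn
  refine (intervalIntegral.hasDerivAt_integral_of_dominated_loc_of_deriv_le (s := Metric.closedBall z 1)
    (bound := fun _ => C) (Metric.closedBall_mem_nhds z one_pos)
    (Filter.Eventually.of_forall fun x => (hF x).aestronglyMeasurable)
    ((hF z).intervalIntegrable _ _)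
    (hF'.comp (continuous_const.prodMk continuous_id)).aestronglyMeasurable ?_
    (continuous_const.intervalIntegrable _ _) ?_).2
  · exact Filter.Eventually.of_forall fun t ht x hx => hC (x, t) ⟨hx, Set.uIoc_subset_uIcc ht⟩
  · exact Filter.Eventually.of_forall fun t _ x _ => h x t

variable {h : ℂ → ℂ → ℂ}

theorem continuous_deriv_snd (hc : Continuous fun p : ℂ × ℂ => h p.1 p.2)
    (h2 : ∀ z, Differentiable ℂ (h z)) : Continuous fun p : ℂ × ℂ => deriv (h p.1) p.2 := by
  have := continuous_deriv_zero (P := ℂ × ℂ) (g := fun p u => h p.1 (p.2 + u)) (by fun_prop)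
    fun p => (h2 p.1).comp (by fun_prop)
  simpa [deriv_comp_const_add] using this

/-- Differentiate Cauchy's formula under the integral sign. Consequently directional derivatives of
an entire function are again entire and can be iterated. -/
theorem differentiable_deriv_snd (hc : Continuous fun p : ℂ × ℂ => h p.1 p.2)
    (h1 : ∀ w, Differentiable ℂ fun z => h z w) (h2 : ∀ z, Differentiable ℂ (h z)) :
    Differentiable ℂ fun z => deriv (h z) 0 := by
  have h3 : Continuous fun p : ℂ × ℂ => deriv (fun z => h z p.2) p.1 := by
    have := continuous_deriv_snd (h := fun w z => h z w) (hc.comp continuous_swap) h1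
    exact this.comp continuous_swap
  simp only [deriv_zero_eq_integral (h2 _)]
  have hcm := continuous_circleMap 0 1
  have hcd : Continuous (deriv (circleMap 0 1)) := by
    have : deriv (circleMap 0 1) = fun θ => circleMap 0 1 θ * I := funext fun θ => deriv_circleMap 0 1 θ
    rw [this]
    exact hcm.mul continuous_const
  have hci : Continuous fun θ => ((circleMap 0 1 θ) ^ 2)⁻¹ :=
    Continuous.inv₀ (hcm.pow 2) fun p => pow_ne_zero 2 (circleMap_ne_center one_ne_zero)
  refine Differentiable.const_mul (fun z => ?_) _
  refine (hasDerivAt_integral_of_continuous (F' := fun z θ => deriv (circleMap 0 1) θ *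
    (((circleMap 0 1 θ) ^ 2)⁻¹ * deriv (fun z => h z (circleMap 0 1 θ)) z)) _ _ (fun z => ?_) ?_
    (fun z t => ?_) z).differentiableAt
  · exact hcd.mul (hci.mul (hc.comp (continuous_const.prodMk hcm)))
  · exact (hcd.comp continuous_snd).mul ((hci.comp continuous_snd).mul
      (h3.comp (continuous_fst.prodMk (hcm.comp continuous_snd))))
  · exact (((h1 _ z).hasDerivAt).const_mul _).const_mul _

/-- The partial derivatives are jointly continuous by Cauchy's formula, so h is differentiable and
the chain rule applies on the diagonal. It yields additivity of the directional derivative in its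
direction. -/
theorem deriv_diag_zero (hc : Continuous fun p : ℂ × ℂ => h p.1 p.2)
    (h1 : ∀ w, Differentiable ℂ fun z => h z w) (h2 : ∀ z, Differentiable ℂ (h z)) :
    deriv (fun t => h t t) 0 = deriv (fun z => h z 0) 0 + deriv (h 0) 0 := by
  have h3 : Continuous fun p : ℂ × ℂ => deriv (fun z => h z p.2) p.1 := by
    have := continuous_deriv_snd (h := fun w z => h z w) (hc.comp continuous_swap) h1
    exact this.comp continuous_swap
  have h4 := continuous_deriv_snd hc h2
  have key := hasStrictFDerivAt_uncurry_coprod (𝕜 := ℂ) (u := ((0 : ℂ), (0 : ℂ))) (f := h)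
    (f₁ := fun z w => ContinuousLinearMap.toSpanSingleton ℂ (deriv (fun z => h z w) z))
    (f₂ := fun z w => ContinuousLinearMap.toSpanSingleton ℂ (deriv (h z) w))
    (Filter.Eventually.of_forall fun v => (h1 v.2 v.1).hasDerivAt.hasFDerivAt)
    (Filter.Eventually.of_forall fun v => (h2 v.1 v.2).hasDerivAt.hasFDerivAt)
    (((ContinuousLinearMap.toSpanSingletonCLE (𝕜 := ℂ) (E := ℂ)).continuous.comp h3).continuousAt)
    (((ContinuousLinearMap.toSpanSingletonCLE (𝕜 := ℂ) (E := ℂ)).continuous.comp h4).continuousAt)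
  have h5 : HasDerivAt (fun t : ℂ => (t, t)) ((1 : ℂ), (1 : ℂ)) 0 :=
    (hasDerivAt_id 0).prodMk (hasDerivAt_id 0)
  have h6 := HasFDerivAt.comp_hasDerivAt (f := fun t : ℂ => (t, t)) (0 : ℂ) key.hasFDerivAt h5
  have h7 := h6.deriv
  refine Eq.trans h7 ?_
  change ContinuousLinearMap.toSpanSingleton ℂ (deriv (fun z => h z 0) 0) 1 +
    ContinuousLinearMap.toSpanSingleton ℂ (deriv (h 0) 0) 1 = _
  simp

end Cauchy
namespace NuclearScale

variable {T : Type*} {G : NuclearScale T}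

/-! ### Entire functions on `Φ'` and their Taylor forms -/

-- A direction η need not lie in H_{-τ}. Passing to a common larger H_{-σ} makes (ω, z) ↦ f(ω + zη)
-- jointly continuous on H_{-τ} × ℂ.
variable (G) in
theorem exists_dualMap (τ : T) (η : G.Dual) : ∃ (σ : T)
    (j : (G.H τ →L[ℂ] ℂ) →L[ℂ] (G.H σ →L[ℂ] ℂ)) (η' : G.H σ →L[ℂ] ℂ),
    (∀ ω, G.dualIncl σ (j ω) = G.dualIncl τ ω) ∧ G.dualIncl σ η' = η := by
  obtain ⟨τ₁, x, hx⟩ := G.exists_riesz η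
  have step : ∀ τ₁ τ₂ : T, ∀ i : G.H τ₂ →L[ℂ] G.H τ₁, G.emb τ₁ ∘L i = G.emb τ₂ →
      ∀ ω, G.dualIncl τ₂ (ω.comp i) = G.dualIncl τ₁ ω := fun τ₁ τ₂ i hi ω => by
    ext ξ
    change ω (i (G.incl τ₂ ξ)) = ω (G.incl τ₁ ξ)
    congr 1
    apply G.emb_injective τ₁
    have h1 := congrArg (fun f => f (G.incl τ₂ ξ)) hi
    simp only [ContinuousLinearMap.comp_apply] at h1
    rw [h1]
    exact (ξ.2 τ₂).trans (ξ.2 τ₁).symm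
  obtain ⟨σ, ⟨i, hi⟩, ⟨i', hi'⟩⟩ := G.directed τ τ₁
  exact ⟨σ, (ContinuousLinearMap.compL ℂ (G.H σ) (G.H τ) ℂ).flip i, (innerSL ℂ x).comp i',
    fun ω => step _ _ i hi ω, (step _ _ i' hi' _).trans hx⟩

variable (G) in
/-- Functions on `Φ'` that are continuous on each `H_{-τ}` and Gâteaux holomorphic. -/
def entireSubmodule : Submodule ℂ (G.Dual → ℂ) where
  carrier := {f | (∀ τ, Continuous fun ω => f (G.dualIncl τ ω)) ∧
    ∀ x η, Differentiable ℂ fun z : ℂ => f (x + z • η)}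
  add_mem' hf hg := ⟨fun τ => (hf.1 τ).add (hg.1 τ), fun x η => (hf.2 x η).add (hg.2 x η)⟩
  zero_mem' := ⟨fun _ => continuous_const, fun _ _ => differentiable_const _⟩
  smul_mem' c _ hf := ⟨fun τ => (hf.1 τ).const_smul c, fun x η => (hf.2 x η).const_smul c⟩

/-- A line in Φ' lies in a single H_{-τ}, and local holomorphy recentred at each of its points shows
that f is entire on it. -/
theorem mem_entireSubmodule_of_holomorphicOn {f : G.Dual → ℂ}
    (hf : ∀ τ, HolomorphicOn (fun ω => f (G.dualIncl τ ω)) Set.univ) : f ∈ G.entireSubmodule := by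
  refine ⟨fun τ => continuousOn_univ.1 (hf τ).1, fun x η z => ?_⟩
  obtain ⟨τ, y, hy⟩ := G.exists_common_riesz ![x, η]
  have hx : G.dualIncl τ (innerSL ℂ (y 0)) = x := hy 0
  have hη : G.dualIncl τ (innerSL ℂ (y 1)) = η := hy 1
  obtain ⟨r, hr, h⟩ := (hf τ).2 (innerSL ℂ (y 0) + z • innerSL ℂ (y 1)) (Set.mem_univ _)
    (innerSL ℂ (y 1))
  have h1 : DifferentiableAt ℂ (fun w : ℂ => f (x + (z + w) • η)) 0 := by
    have h2 := h.differentiableAt (Metric.ball_mem_nhds 0 hr)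
    convert h2 using 2 with w
    simp only [map_add, map_smul, hx, hη, show (z + w) • η = z • η + w • η from add_smul z w η,
      add_assoc]
  have h3 : DifferentiableAt ℂ (fun w : ℂ => f (x + (z + (w - z)) • η)) z := by
    refine DifferentiableAt.comp (f := fun w : ℂ => w - z) (g := fun w : ℂ => f (x + (z + w) • η))
      z ?_ (by fun_prop)
    simpa using h1
  simpa using h3

theorem continuous_plane {f : G.Dual → ℂ} (hf : f ∈ G.entireSubmodule) (x η ζ : G.Dual) :
    Continuous fun p : ℂ × ℂ => f (x + p.1 • η + p.2 • ζ) := by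
  obtain ⟨τ, y, hy⟩ := G.exists_common_riesz ![x, η, ζ]
  have h0 : G.dualIncl τ (innerSL ℂ (y 0)) = x := hy 0
  have h1 : G.dualIncl τ (innerSL ℂ (y 1)) = η := hy 1
  have h2 : G.dualIncl τ (innerSL ℂ (y 2)) = ζ := hy 2
  have h3 : Continuous fun p : ℂ × ℂ =>
      innerSL ℂ (y 0) + p.1 • innerSL ℂ (y 1) + p.2 • innerSL ℂ (y 2) := by fun_prop
  have h4 := (hf.1 τ).comp h3
  convert h4 using 2 with p
  simp only [Function.comp_apply, map_add, map_smul, h0, h1, h2]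

/-- The derivative in the direction `η`. -/
def dirDeriv (η : G.Dual) (f : G.Dual → ℂ) (x : G.Dual) : ℂ := deriv (fun z : ℂ => f (x + z • η)) 0

theorem differentiable_plane_fst {f : G.Dual → ℂ} (hf : f ∈ G.entireSubmodule) (x η ζ : G.Dual)
    (w : ℂ) : Differentiable ℂ fun z : ℂ => f (x + z • η + w • ζ) := by
  simpa only [add_right_comm] using hf.2 (x + w • ζ) η

theorem dirDeriv_mem {f : G.Dual → ℂ} (hf : f ∈ G.entireSubmodule) (η : G.Dual) :
    dirDeriv η f ∈ G.entireSubmodule := by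
  refine ⟨fun τ => ?_, fun x ζ => ?_⟩
  · obtain ⟨σ, j, η', hj, hη⟩ := G.exists_dualMap τ η
    refine continuous_deriv_zero (g := fun ω z => f (G.dualIncl τ ω + z • η)) ?_
      fun ω => hf.2 _ _
    have h3 : Continuous fun p : (G.H τ →L[ℂ] ℂ) × ℂ => j p.1 + p.2 • η' := by fun_prop
    have h4 := (hf.1 σ).comp h3
    convert h4 using 2 with p
    simp only [Function.comp_apply, map_add, map_smul, hj, hη]
  · exact differentiable_deriv_snd (h := fun z w => f (x + z • ζ + w • η))
      (continuous_plane hf x ζ η) (differentiable_plane_fst hf x ζ η) fun z => hf.2 _ _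

theorem dirDeriv_add_dir {f : G.Dual → ℂ} (hf : f ∈ G.entireSubmodule) (η ζ : G.Dual) :
    dirDeriv (η + ζ) f = dirDeriv η f + dirDeriv ζ f := by
  funext x
  have h := deriv_diag_zero (h := fun z w => f (x + z • η + w • ζ))
    (continuous_plane hf x η ζ) (differentiable_plane_fst hf x η ζ) fun z => hf.2 _ _
  have h0 : ∀ x : G.Dual, (0 : ℂ) • x = 0 := fun x => zero_smul ℂ x
  simpa [dirDeriv, smul_add, add_assoc, h0] using h

theorem dirDeriv_smul_dir (f : G.Dual → ℂ) (c : ℂ) (η : G.Dual) :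
    dirDeriv (c • η) f = c • dirDeriv η f := by
  funext x
  have h2 := deriv_comp_mul_left c (fun z : ℂ => f (x + z • η)) 0
  rw [mul_zero] at h2
  simpa [dirDeriv, smul_smul, mul_comm] using h2

variable (G) in
/-- The directional derivative as a bilinear map. -/
def dirDerivLin : G.Dual →ₗ[ℂ] G.entireSubmodule →ₗ[ℂ] G.entireSubmodule :=
  LinearMap.mk₂ ℂ (fun η f => ⟨dirDeriv η f.1, dirDeriv_mem f.2 η⟩)
    (fun η ζ f => Subtype.ext (dirDeriv_add_dir f.2 η ζ))
    (fun c η f => Subtype.ext (dirDeriv_smul_dir f.1 c η))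
    (fun η f g => Subtype.ext (funext fun x => deriv_add (f.2.2 x η 0) (g.2.2 x η 0)))
    (fun c η f => Subtype.ext (funext fun x => deriv_const_smul c (f.2.2 x η 0)))

variable (G) in
/-- The derivatives at zero, as multilinear forms. -/
def derivForm : ∀ n : ℕ, G.entireSubmodule →ₗ[ℂ] MultilinearMap ℂ (fun _ : Fin n => G.Dual) ℂ
  | 0 =>
    { toFun := fun f => MultilinearMap.constOfIsEmpty ℂ _ (f.1 0)
      map_add' := fun _ _ => rfl
      map_smul' := fun _ _ => rfl }
  | n + 1 =>
    { toFun := fun f => ((derivForm n).comp ((G.dirDerivLin).flip f)).uncurryLeft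
      map_add' := fun f g => by ext ω; simp
      map_smul' := fun c f => by ext ω; simp }

theorem derivForm_diag (n : ℕ) (f : G.entireSubmodule) (ω : G.Dual) :
    G.derivForm n f (fun _ => ω) = iteratedDeriv n (fun z : ℂ => f.1 (z • ω)) 0 := by
  induction n generalizing f with
  | zero =>
    rw [iteratedDeriv_zero, show (0 : ℂ) • ω = 0 from zero_smul ℂ ω]
    rfl
  | succ n ih =>
    have h1 : G.derivForm (n + 1) f (fun _ => ω) = G.derivForm n (G.dirDerivLin ω f) fun _ => ω := rfl
    rw [h1, ih, iteratedDeriv_succ']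
    congr 1
    funext z
    change deriv (fun t : ℂ => f.1 (z • ω + t • ω)) 0 = _
    have := deriv_comp_const_add (fun t : ℂ => f.1 (t • ω)) z 0
    simp only [add_zero] at this
    rw [← this]
    congr 1
    funext t
    rw [show (z + t) • ω = z • ω + t • ω from add_smul z t ω]

/-- The `n`-th Taylor form of an entire function. -/
theorem exists_taylorForm (n : ℕ) {f : G.Dual → ℂ} (hf : f ∈ G.entireSubmodule) :
    ∃ F : MultilinearMap ℂ (fun _ : Fin n => G.Dual) ℂ,
      (∀ (σ : Equiv.Perm (Fin n)) (ω : Fin n → G.Dual), F (ω ∘ σ) = F ω) ∧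
      ∀ ω, F (fun _ => ω) = (n.factorial : ℂ)⁻¹ * iteratedDeriv n (fun z : ℂ => f (z • ω)) 0 := by
  have hn : (n.factorial : ℂ) ≠ 0 := by exact_mod_cast n.factorial_ne_zero
  -- Averaging over permutations makes the form symmetric without proving that derivatives commute;
  -- this accounts for one factor 1/n!, Taylor's formula for the other.
  refine ⟨((n.factorial : ℂ)⁻¹ * (n.factorial : ℂ)⁻¹) • ∑ σ : Equiv.Perm (Fin n),
    (G.derivForm n ⟨f, hf⟩).domDomCongr σ, fun π ω => ?_, fun ω => ?_⟩
  · simp only [smul_apply, sum_apply, MultilinearMap.domDomCongr_apply]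
    congr 1
    exact Fintype.sum_equiv (Equiv.mulLeft π) _ _ fun σ => rfl
  · have h : ∀ σ : Equiv.Perm (Fin n), (G.derivForm n ⟨f, hf⟩).domDomCongr σ (fun _ => ω) =
        iteratedDeriv n (fun z : ℂ => f (z • ω)) 0 := fun σ => derivForm_diag n ⟨f, hf⟩ ω
    simp only [smul_apply, sum_apply, h]
    simp [Fintype.card_perm]
    field_simp

end NuclearScale
end

noncomputable section

/-! ### Elementary estimates -/

/-- Raise y^k / k! ≤ e^y, with y = 2^{−l'β} x^β, to the power 1/β. The exponent becomes y/β, which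
is at most 2^{−l} x^β once l' is large. -/
theorem exists_pow_le_mul_exp {β : ℝ} (hβ : 0 < β) (l : ℕ) : ∃ l' : ℕ, ∀ (k : ℕ) (x : ℝ), 0 ≤ x →
    x ^ k ≤ (k.factorial : ℝ) ^ (1 / β) * (2 ^ l') ^ k * Real.exp (((2 : ℝ) ^ l)⁻¹ * x ^ β) := by
  obtain ⟨l', hl'⟩ := pow_unbounded_of_one_lt (2 ^ l / β) (Real.one_lt_rpow one_lt_two hβ)
  refine ⟨l', fun k x hx => ?_⟩
  set s : ℝ := ((2 : ℝ) ^ l') ^ β with hs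
  have hs0 : 0 < s := by positivity
  have hs1 : 2 ^ l / β < s := by
    rw [hs, ← Real.rpow_pow_comm (by norm_num)]
    exact hl'
  have h1 : (s⁻¹ * x ^ β) ^ k / k.factorial ≤ Real.exp (s⁻¹ * x ^ β) :=
    Real.pow_div_factorial_le_exp _ (by positivity) k
  have hk : (0 : ℝ) < k.factorial := by exact_mod_cast k.factorial_pos
  rw [div_le_iff₀ hk] at h1
  have h2 := Real.rpow_le_rpow (by positivity) h1 (by positivity : 0 ≤ 1 / β)
  have e1 : ((s⁻¹ * x ^ β) ^ k) ^ (1 / β) = ((2 ^ l') ^ k)⁻¹ * x ^ k := by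
    have h3 : s⁻¹ * x ^ β = (((2 : ℝ) ^ l')⁻¹ * x) ^ β := by
      rw [Real.mul_rpow (by positivity) hx, Real.inv_rpow (by positivity)]
    rw [h3, ← Real.rpow_natCast, ← Real.rpow_mul (by positivity), ← Real.rpow_mul (by positivity)]
    have h4 : β * (k : ℝ) * (1 / β) = k := by field_simp
    rw [mul_assoc] at h4
    rw [h4, Real.rpow_natCast, mul_pow, inv_pow]
  have e2 : (Real.exp (s⁻¹ * x ^ β) * k.factorial) ^ (1 / β) =
      Real.exp (s⁻¹ * x ^ β / β) * (k.factorial : ℝ) ^ (1 / β) := by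
    rw [Real.mul_rpow (by positivity) (by positivity), ← Real.exp_mul, mul_one_div]
  rw [e1, e2, inv_mul_le_iff₀ (by positivity)] at h2
  have h5 : s⁻¹ / β ≤ ((2 : ℝ) ^ l)⁻¹ := by
    rw [div_lt_iff₀ hβ] at hs1
    rw [div_eq_mul_inv, ← mul_inv]
    exact inv_anti₀ (by positivity) hs1.le
  calc x ^ k ≤ (2 ^ l') ^ k * (Real.exp (s⁻¹ * x ^ β / β) * (k.factorial : ℝ) ^ (1 / β)) := h2
    _ ≤ (2 ^ l') ^ k * (Real.exp (((2 : ℝ) ^ l)⁻¹ * x ^ β) * (k.factorial : ℝ) ^ (1 / β)) := by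
        rw [mul_div_right_comm]
        gcongr
    _ = _ := by ring

theorem factorial_rpow_le {γ : ℝ} (hγ : 0 ≤ γ) (n : ℕ) :
    (n.factorial : ℝ) ^ γ ≤ ((n : ℝ) ^ γ) ^ n := by
  calc (n.factorial : ℝ) ^ γ ≤ ((n : ℝ) ^ n) ^ γ := by
        gcongr
        exact_mod_cast n.factorial_le_pow
    _ = _ := by rw [← Real.rpow_natCast, ← Real.rpow_mul (by positivity), ← Real.rpow_natCast,
          ← Real.rpow_mul (by positivity), mul_comm]

namespace NuclearScale

variable {T : Type*} {G : NuclearScale T} {α : ℝ}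

theorem orders_pos (hα : 0 ≤ α) {β : ℝ} (hβ : β ∈ orders α) : 0 < β := by
  rw [orders] at hβ
  split_ifs at hβ with h
  · exact hβ
  · rw [Set.mem_singleton_iff] at hβ
    rw [hβ]
    exact lt_of_le_of_ne hα (Ne.symm h)

theorem norm_apply_le_growthNorm (f : G.Emin α) (i : orders α × T × ℕ) (ω : G.H i.2.1 →L[ℂ] ℂ) :
    ‖f (G.dualIncl i.2.1 ω)‖ ≤
      G.growthNorm α i f * Real.exp (((2 : ℝ) ^ i.2.2)⁻¹ * ‖ω‖ ^ (i.1 : ℝ)) := by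
  have h : G.weighted i.1 i.2.1 i.2.2 f.1 ω ≤ G.growthNorm α i f :=
    le_ciSup ((f.2 i.1 i.1.2 i.2.1).2 i.2.2) ω
  rw [weighted, neg_mul, Real.exp_neg, ← div_eq_mul_inv, div_le_iff₀ (Real.exp_pos _)] at h
  exact h

theorem growthNorm_le {f : G.Emin α} {i : orders α × T × ℕ} {M : ℝ}
    (h : ∀ ω : G.H i.2.1 →L[ℂ] ℂ, ‖f (G.dualIncl i.2.1 ω)‖ ≤
      M * Real.exp (((2 : ℝ) ^ i.2.2)⁻¹ * ‖ω‖ ^ (i.1 : ℝ))) : G.growthNorm α i f ≤ M := by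
  refine ciSup_le fun ω => ?_
  rw [weighted, neg_mul, Real.exp_neg, ← div_eq_mul_inv, div_le_iff₀ (Real.exp_pos _)]
  exact h ω

theorem orders_nonempty (α : ℝ) : (orders α).Nonempty := by
  rw [orders]
  split_ifs
  · exact ⟨1, Set.mem_Ioi.2 one_pos⟩
  · exact ⟨α, rfl⟩

theorem Emin.mem_entireSubmodule (f : G.Emin α) : f.1 ∈ G.entireSubmodule := by
  obtain ⟨β, hβ⟩ := orders_nonempty α
  exact mem_entireSubmodule_of_holomorphicOn fun τ => (f.2 β hβ τ).1

/-! ### Taylor coefficients -/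

/-- The value of the `n`-th Taylor form on the diagonal. -/
def taylorDiag (n : ℕ) (f : G.Dual → ℂ) (ω : G.Dual) : ℂ :=
  (n.factorial : ℂ)⁻¹ * iteratedDeriv n (fun z : ℂ => f (z • ω)) 0

theorem differentiable_line {f : G.Dual → ℂ} (hf : f ∈ G.entireSubmodule) (ω : G.Dual) :
    Differentiable ℂ fun z : ℂ => f (z • ω) := by
  have := hf.2 0 ω
  simpa only [zero_add] using this

theorem taylorDiag_add {f g : G.Dual → ℂ} (hf : f ∈ G.entireSubmodule) (hg : g ∈ G.entireSubmodule)
    (n : ℕ) (ω : G.Dual) : taylorDiag n (f + g) ω = taylorDiag n f ω + taylorDiag n g ω := by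
  have h := iteratedDeriv_add (n := n) (x := (0 : ℂ)) (differentiable_line hf ω).contDiff.contDiffAt
    (differentiable_line hg ω).contDiff.contDiffAt
  rw [taylorDiag, taylorDiag, taylorDiag, ← mul_add, ← h]
  rfl

theorem taylorDiag_smul (f : G.Dual → ℂ) (c : ℂ) (n : ℕ) (ω : G.Dual) :
    taylorDiag n (c • f) ω = c * taylorDiag n f ω := by
  have h := iteratedDeriv_const_mul_field (n := n) (x := (0 : ℂ)) c (fun z : ℂ => f (z • ω))
  rw [taylorDiag, taylorDiag, mul_left_comm, ← h]
  rfl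

theorem hasSum_taylorDiag {f : G.Dual → ℂ} (hf : f ∈ G.entireSubmodule) (ω : G.Dual) :
    HasSum (fun n => taylorDiag n f ω) (f ω) := by
  have h := Complex.hasSum_taylorSeries_of_entire (differentiable_line hf ω) 0 1
  rw [show ((1 : ℂ) • ω) = ω from one_smul ℂ ω] at h
  simpa [taylorDiag] using h

/-- Cauchy estimates. -/
theorem norm_taylorDiag_le (hα : 0 ≤ α) (f : G.Emin α) (i : orders α × T × ℕ) (n : ℕ)
    (ω : G.H i.2.1 →L[ℂ] ℂ) :
    (n.factorial : ℝ) ^ (1 / (i.1 : ℝ)) * (((2 : ℝ) ^ i.2.2) ^ (1 / (i.1 : ℝ)) / Real.exp 1) ^ n *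
      ‖taylorDiag n f.1 (G.dualIncl i.2.1 ω)‖ ≤ G.growthNorm α i f * ‖ω‖ ^ n := by
  obtain ⟨⟨β, hβ⟩, τ, l⟩ := i
  have hβ0 := orders_pos hα hβ
  have hp := apply_nonneg (G.growthNorm α (⟨β, hβ⟩, τ, l)) f
  simp only
  rcases Nat.eq_zero_or_pos n with rfl | hn
  · have h := norm_apply_le_growthNorm f (⟨β, hβ⟩, τ, l) 0
    simp only [norm_zero, Real.zero_rpow hβ0.ne', mul_zero, Real.exp_zero, mul_one, map_zero] at h
    have h0 : (0 : ℂ) • G.dualIncl τ ω = 0 := zero_smul ℂ (G.dualIncl τ ω)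
    simpa [taylorDiag, h0] using h
  rcases eq_or_ne ω 0 with rfl | hω
  · have h0 : ∀ z : ℂ, z • (0 : G.Dual) = 0 := fun z => smul_zero (A := G.Dual) z
    have : taylorDiag n f.1 (G.dualIncl τ 0) = 0 := by
      simp [taylorDiag, h0, iteratedDeriv_const, hn.ne']
    rw [this, norm_zero, mul_zero]
    positivity
  have hω' : 0 < ‖ω‖ := norm_pos_iff.2 hω
  have hn0 : (0 : ℝ) < n := by exact_mod_cast hn
  -- The radius, measured as ‖zω‖, for which 2^{−l} R^β = n. The growth factor is then e^n, and R^n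
  -- supplies n^{n/β} ≥ (n!)^{1/β}.
  set R : ℝ := ((2 : ℝ) ^ l * n) ^ (1 / β) with hR
  have hR0 : 0 < R := by positivity
  have hRβ : R ^ β = 2 ^ l * n := by
    rw [hR, ← Real.rpow_mul (by positivity), one_div_mul_cancel hβ0.ne', Real.rpow_one]
  have hC : ∀ z ∈ Metric.sphere (0 : ℂ) (R / ‖ω‖), ‖f.1 (z • G.dualIncl τ ω)‖ ≤
      G.growthNorm α (⟨β, hβ⟩, τ, l) f * Real.exp n := fun z hz => by
    have h := norm_apply_le_growthNorm f (⟨β, hβ⟩, τ, l) (z • ω)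
    rw [mem_sphere_zero_iff_norm] at hz
    simp only [norm_smul, hz, map_smul] at h
    rw [div_mul_cancel₀ _ hω'.ne', hRβ, inv_mul_cancel_left₀ (by positivity)] at h
    exact h
  have h1 := Complex.norm_iteratedDeriv_le_of_forall_mem_sphere_norm_le n (by positivity)
    ((differentiable_line f.mem_entireSubmodule (G.dualIncl τ ω)).diffContOnCl) hC
  have h2 : ‖taylorDiag n f.1 (G.dualIncl τ ω)‖ ≤
      G.growthNorm α (⟨β, hβ⟩, τ, l) f * Real.exp n * ‖ω‖ ^ n / R ^ n := by
    have hf : (0 : ℝ) < n.factorial := by exact_mod_cast n.factorial_pos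
    rw [taylorDiag, norm_mul, norm_inv, Complex.norm_natCast, inv_mul_le_iff₀ hf]
    refine h1.trans (le_of_eq ?_)
    rw [div_pow]
    field_simp
  have h3 : (n.factorial : ℝ) ^ (1 / β) * (((2 : ℝ) ^ l) ^ (1 / β) / Real.exp 1) ^ n ≤
      R ^ n / Real.exp n := by
    have h4 : R = ((2 : ℝ) ^ l) ^ (1 / β) * (n : ℝ) ^ (1 / β) :=
      Real.mul_rpow (by positivity) (by positivity)
    have h5 : Real.exp n = Real.exp 1 ^ n := by rw [← Real.exp_nat_mul, mul_one]
    rw [h4, h5, div_pow, mul_pow, ← mul_div_assoc, mul_comm]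
    gcongr
    exact factorial_rpow_le (by positivity) n
  calc _ ≤ R ^ n / Real.exp n *
        (G.growthNorm α (⟨β, hβ⟩, τ, l) f * Real.exp n * ‖ω‖ ^ n / R ^ n) := by gcongr
    _ = _ := by field_simp

/-- Cauchy estimates bound the Taylor forms on the diagonal of every H_{-τ}, and the nuclear
estimate then makes them elements of Φ^{⊙n}. Minimal type is what allows an arbitrary geometric
weight L. -/
theorem exists_taylorCoeff (hα : 0 ≤ α) : ∃ t : ∀ n : ℕ, G.Emin α →ₗ[ℂ] G.symPow n,
    (∀ n f ω, (t n f).1 (fun _ => ω) = taylorDiag n f.1 ω) ∧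
    ∀ (β : orders α) (τ : T) (L : ℝ), ∃ i : orders α × T × ℕ, ∀ n f,
      (n.factorial : ℝ) ^ (1 / (β : ℝ)) * L ^ n * G.tnorm τ (t n f) ≤ G.growthNorm α i f := by
  choose F hFs hF using fun (n : ℕ) (f : G.Emin α) => exists_taylorForm n f.mem_entireSubmodule
  have hF' : ∀ n f ω, F n f (fun _ => ω) = taylorDiag n f.1 ω := hF
  obtain ⟨β₀, hβ₀⟩ := orders_nonempty α
  have hmem : ∀ n f, F n f ∈ G.symPow n := fun n f => by
    refine mem_symPow_of_diag _ (hFs n f) fun τ => ?_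
    let c : ℝ := (n.factorial : ℝ) ^ (1 / β₀) * (((2 : ℝ) ^ 0) ^ (1 / β₀) / Real.exp 1) ^ n
    have hc : 0 < c := by
      have : (0 : ℝ) < n.factorial := by exact_mod_cast n.factorial_pos
      positivity
    refine ⟨c⁻¹ * G.growthNorm α (⟨β₀, hβ₀⟩, τ, 0) f, fun x => ?_⟩
    have h := norm_taylorDiag_le hα f (⟨β₀, hβ₀⟩, τ, 0) n (InnerProductSpace.toDual ℂ _ x)
    rw [hF', mul_assoc, le_inv_mul_iff₀ hc]
    rw [LinearIsometryEquiv.norm_map] at h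
    exact h
  let t : ∀ n : ℕ, G.Emin α →ₗ[ℂ] G.symPow n := fun n =>
    { toFun := fun f => ⟨F n f, hmem n f⟩
      map_add' := fun f g => symPow_ext fun ω => by
        refine (hF' n _ ω).trans ((taylorDiag_add f.mem_entireSubmodule g.mem_entireSubmodule n ω).trans ?_)
        rw [← hF', ← hF']
        rfl
      map_smul' := fun c f => symPow_ext fun ω => by
        refine (hF' n _ ω).trans ((taylorDiag_smul f.1 c n ω).trans ?_)
        rw [← hF']
        rfl }
  refine ⟨t, hF', fun β τ L => ?_⟩
  have hβ := orders_pos hα β.2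
  obtain ⟨τ', K, hK, h⟩ := exists_norm_coords_le (G := G) τ
  -- Per degree, 2^{l/β} has to beat the weight |L|, the nuclear constant K and the factor e lost in
  -- the Cauchy estimate.
  obtain ⟨l, hl⟩ := pow_unbounded_of_one_lt (|L| * K * Real.exp 1)
    (Real.one_lt_rpow one_lt_two (by positivity : 0 < 1 / (β : ℝ)))
  refine ⟨(β, τ', l), fun n f => ?_⟩
  have hf : (0 : ℝ) < (n.factorial : ℝ) ^ (1 / (β : ℝ)) := by
    have : (0 : ℝ) < n.factorial := by exact_mod_cast n.factorial_pos
    positivity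
  set a : ℝ := ((2 : ℝ) ^ l) ^ (1 / (β : ℝ)) / Real.exp 1 with ha
  have ha0 : 0 < a := by positivity
  have hla : |L| * K ≤ a := by
    rw [ha, le_div_iff₀ (Real.exp_pos 1), ← Real.rpow_pow_comm (by norm_num)]
    exact hl.le
  have hp := apply_nonneg (G.growthNorm α (β, τ', l)) f
  have h1 : G.tnorm τ (t n f) ≤
      (((n.factorial : ℝ) ^ (1 / (β : ℝ)) * a ^ n)⁻¹ * G.growthNorm α (β, τ', l) f) * K ^ n := by
    refine tnorm_le fun v => h n (F n f) (hFs n f) _ (by positivity) (fun x => ?_) v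
    have h := norm_taylorDiag_le hα f (β, τ', l) n (InnerProductSpace.toDual ℂ _ x)
    rw [hF', mul_assoc, le_inv_mul_iff₀ (by positivity)]
    rw [LinearIsometryEquiv.norm_map] at h
    exact h
  calc _ ≤ (n.factorial : ℝ) ^ (1 / (β : ℝ)) * |L| ^ n * G.tnorm τ (t n f) := by
        refine mul_le_mul_of_nonneg_right (mul_le_mul_of_nonneg_left ?_ hf.le) (apply_nonneg _ _)
        rw [← abs_pow]
        exact le_abs_self _
    _ ≤ (n.factorial : ℝ) ^ (1 / (β : ℝ)) * |L| ^ n *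
        ((((n.factorial : ℝ) ^ (1 / (β : ℝ)) * a ^ n)⁻¹ * G.growthNorm α (β, τ', l) f) * K ^ n) := by
        gcongr
    _ = ((|L| * K) ^ n / a ^ n) * G.growthNorm α (β, τ', l) f := by
        rw [mul_pow]
        field_simp
    _ ≤ 1 * G.growthNorm α (β, τ', l) f := by
        gcongr
        rw [div_le_one (by positivity)]
        gcongr
    _ = _ := one_mul _

end NuclearScale
end

noncomputable section

namespace NuclearScale

variable {T : Type*} {G : NuclearScale T} {α : ℝ}

/-! ### Monomials as elements of `E^α_min(Φ')` -/

theorem norm_dpow_dualIncl_le (τ : T) (ω : G.H τ →L[ℂ] ℂ) {k : ℕ} (ψ : G.symPow k) :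
    ‖G.dpow (G.dualIncl τ ω) k ψ‖ ≤ ‖ω‖ ^ k * G.tnorm τ ψ := by
  have h := G.norm_diag_le τ ((InnerProductSpace.toDual ℂ (G.H τ)).symm ω) ψ
  rw [riesz_toDual_symm, LinearIsometryEquiv.norm_map] at h
  exact h

/-- A symmetric tensor as a continuous multilinear form on `H_{-τ}`. -/
theorem exists_continuousMultilinear (τ : T) {k : ℕ} (ψ : G.symPow k) :
    ∃ F : ContinuousMultilinearMap ℂ (fun _ : Fin k => G.H τ →L[ℂ] ℂ) ℂ,
      ∀ ω, F ω = ψ.1 fun i => G.dualIncl τ (ω i) := by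
  refine ⟨(ψ.1.compLinearMap fun _ => G.dualIncl τ).mkContinuous (G.tnorm τ ψ * 6 ^ k)
    fun ω => ?_, fun ω => rfl⟩
  have h := norm_apply_riesz_le ψ fun i => (InnerProductSpace.toDual ℂ (G.H τ)).symm (ω i)
  simp only [riesz_toDual_symm, LinearIsometryEquiv.norm_map] at h
  exact h

theorem holomorphicOn_dpow (τ : T) {k : ℕ} (ψ : G.symPow k) :
    HolomorphicOn (fun ω => G.dpow (G.dualIncl τ ω) k ψ) Set.univ := by
  obtain ⟨F, hF⟩ := exists_continuousMultilinear τ ψ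
  have h : ∀ ω : G.H τ →L[ℂ] ℂ, G.dpow (G.dualIncl τ ω) k ψ = F fun _ => ω := fun ω => by
    rw [hF]
    rfl
  simp only [h]
  have hc : ContDiff ℂ 1 fun ω : G.H τ →L[ℂ] ℂ => F fun _ => ω :=
    F.contDiff.comp (contDiff_pi.2 fun _ => contDiff_id)
  refine ⟨hc.continuous.continuousOn, fun ξ _ η => ⟨1, one_pos, ?_⟩⟩
  have hd := hc.differentiable one_ne_zero
  exact (hd.comp (by fun_prop : Differentiable ℂ fun z : ℂ => ξ + z • η)).differentiableOn

/-- The exponent is γ = max(1, 1/β). For α > 0 it equals 1/α because α ≤ 1; for α = 0 every positive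
order is available, so enlarging 1/β to at least 1 does no harm. -/
theorem exists_norm_dpow_le (hα : α ∈ Set.Icc (0 : ℝ) 1) (i : orders α × T × ℕ) :
    ∃ (γ : ℝ) (l' : ℕ), 1 ≤ γ ∧ 1 / γ ∈ orders α ∧ ∀ (k : ℕ) (ψ : G.symPow k)
      (ω : G.H i.2.1 →L[ℂ] ℂ), ‖G.dpow (G.dualIncl i.2.1 ω) k ψ‖ ≤
        (k.factorial : ℝ) ^ γ * (2 ^ l') ^ k * G.tnorm i.2.1 ψ *
          Real.exp (((2 : ℝ) ^ i.2.2)⁻¹ * ‖ω‖ ^ (i.1 : ℝ)) := by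
  obtain ⟨⟨β, hβ⟩, τ, l⟩ := i
  have hβ0 := orders_pos hα.1 hβ
  obtain ⟨l', hl'⟩ := exists_pow_le_mul_exp hβ0 l
  refine ⟨max 1 (1 / β), l', le_max_left _ _, ?_, fun k ψ ω => ?_⟩
  · rw [orders] at hβ ⊢
    split_ifs at hβ ⊢ with h
    · exact Set.mem_Ioi.2 (by positivity)
    · rw [Set.mem_singleton_iff] at hβ ⊢
      subst hβ
      have : 1 ≤ 1 / β := by
        rw [le_div_iff₀ hβ0]
        linarith [hα.2]
      rw [max_eq_right this, one_div_one_div]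
  · refine (norm_dpow_dualIncl_le τ ω ψ).trans ?_
    have h1 := hl' k ‖ω‖ (norm_nonneg _)
    have h2 : (k.factorial : ℝ) ^ (1 / β) ≤ (k.factorial : ℝ) ^ max 1 (1 / β) :=
      Real.rpow_le_rpow_of_exponent_le (by exact_mod_cast k.factorial_pos) (le_max_right _ _)
    have ht : 0 ≤ G.tnorm τ ψ := apply_nonneg _ _
    calc _ ≤ ((k.factorial : ℝ) ^ (1 / β) * (2 ^ l') ^ k *
          Real.exp (((2 : ℝ) ^ l)⁻¹ * ‖ω‖ ^ β)) * G.tnorm τ ψ := by gcongr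
      _ ≤ ((k.factorial : ℝ) ^ max 1 (1 / β) * (2 ^ l') ^ k *
          Real.exp (((2 : ℝ) ^ l)⁻¹ * ‖ω‖ ^ β)) * G.tnorm τ ψ := by gcongr
      _ = _ := by ring

/-- The monomial `ω ↦ ⟨ω^{⊗ k}, ψ⟩` as an element of `E^α_min(Φ')`. -/
def monomialFun (hα : α ∈ Set.Icc (0 : ℝ) 1) (k : ℕ) (ψ : G.symPow k) : G.Emin α :=
  ⟨fun ω => G.dpow ω k ψ, fun β hβ τ => ⟨holomorphicOn_dpow τ ψ, fun l => by
    obtain ⟨γ, l', -, -, h⟩ := exists_norm_dpow_le (G := G) hα (⟨β, hβ⟩, τ, l)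
    refine ⟨(k.factorial : ℝ) ^ γ * (2 ^ l') ^ k * G.tnorm τ ψ, ?_⟩
    rintro _ ⟨ω, rfl⟩
    rw [weighted, neg_mul, Real.exp_neg, ← div_eq_mul_inv, div_le_iff₀ (Real.exp_pos _)]
    exact h k ψ ω⟩⟩

theorem exists_growthNorm_monomialFun_le (hα : α ∈ Set.Icc (0 : ℝ) 1) (i : orders α × T × ℕ) :
    ∃ (γ : ℝ) (l' : ℕ), 1 ≤ γ ∧ 1 / γ ∈ orders α ∧ ∀ (k : ℕ) (ψ : G.symPow k),
      G.growthNorm α i (monomialFun hα k ψ) ≤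
        (k.factorial : ℝ) ^ γ * (2 ^ l') ^ k * G.tnorm i.2.1 ψ := by
  obtain ⟨γ, l', h1, h2, h⟩ := exists_norm_dpow_le (G := G) hα i
  exact ⟨γ, l', h1, h2, fun k ψ => growthNorm_le fun ω => h k ψ ω⟩

/-- Monotonicity of x ↦ x^{γ−1}. This is where α ≤ 1 is decisive: the factor n!/k! from the
generating function is absorbed by the weights (n!)^γ because γ ≥ 1. -/
theorem factorial_rpow_mul_le {γ : ℝ} (hγ : 1 ≤ γ) {k n : ℕ} (hkn : k ≤ n) :
    (k.factorial : ℝ) ^ γ * (n.factorial / k.factorial : ℝ) ≤ (n.factorial : ℝ) ^ γ := by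
  have hk : (0 : ℝ) < k.factorial := by exact_mod_cast k.factorial_pos
  have hn : (0 : ℝ) < n.factorial := by exact_mod_cast n.factorial_pos
  have e : ∀ x : ℝ, 0 < x → x ^ γ = x ^ (γ - 1) * x := fun x hx => by
    rw [← Real.rpow_add_one hx.ne', sub_add_cancel]
  rw [e _ hk, e _ hn]
  have : (k.factorial : ℝ) ^ (γ - 1) ≤ (n.factorial : ℝ) ^ (γ - 1) := by
    refine Real.rpow_le_rpow hk.le ?_ (by linarith)
    exact_mod_cast Nat.factorial_le hkn
  calc _ = (k.factorial : ℝ) ^ (γ - 1) * n.factorial := by field_simp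
    _ ≤ _ := by gcongr

/-- The function `ω ↦ ∑ k ≤ n, ⟨ω^{⊗ k}, V_{k,n} φ⟩` on `Φ'`. -/
def polyFun (hα : α ∈ Set.Icc (0 : ℝ) 1) (V : ∀ k n : ℕ, G.symPow n →L[ℂ] G.symPow k) (n : ℕ)
    (φ : G.symPow n) : G.Emin α :=
  ∑ k ∈ Finset.range (n + 1), monomialFun hα k (V k n φ)

theorem Emin.sum_apply {ι : Type*} (s : Finset ι) (f : ι → G.Emin α) (ω : G.Dual) :
    (∑ i ∈ s, f i) ω = ∑ i ∈ s, f i ω := by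
  classical
  induction s using Finset.induction_on with
  | empty => rfl
  | insert a s ha ih =>
    rw [Finset.sum_insert ha, Finset.sum_insert ha, ← ih]
    rfl

theorem polyFun_apply (hα : α ∈ Set.Icc (0 : ℝ) 1) (V : ∀ k n : ℕ, G.symPow n →L[ℂ] G.symPow k)
    (n : ℕ) (φ : G.symPow n) (ω : G.Dual) :
    polyFun hα V n φ ω = ∑ k ∈ Finset.range (n + 1), G.dpow ω k (V k n φ) :=
  Emin.sum_apply _ _ _

/-- Each of the n + 1 homogeneous terms obeys the monomial bound, and n + 1 ≤ 2^n keeps the total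
loss geometric. -/
theorem exists_growthNorm_polyFun_le (hα : α ∈ Set.Icc (0 : ℝ) 1)
    {V : ∀ k n : ℕ, G.symPow n →L[ℂ] G.symPow k}
    (hV : ∀ τ, ∃ (τ' : T) (C : ℝ), 0 ≤ C ∧ ∀ k n, k ≤ n → ∀ φ : G.symPow n,
      G.tnorm τ (V k n φ) ≤ (n.factorial / k.factorial : ℝ) * (2 * C ^ n) * G.tnorm τ' φ)
    (i : orders α × T × ℕ) :
    ∃ (γ : ℝ) (τ' : T) (L : ℝ), 1 ≤ γ ∧ 1 / γ ∈ orders α ∧ 0 ≤ L ∧ ∀ (n : ℕ) (φ : G.symPow n),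
      G.growthNorm α i (polyFun hα V n φ) ≤ 2 * ((n.factorial : ℝ) ^ γ * L ^ n * G.tnorm τ' φ) := by
  obtain ⟨γ, l', hγ, hγα, h⟩ := exists_growthNorm_monomialFun_le (G := G) hα i
  obtain ⟨τ', C, hC, h2⟩ := hV i.2.1
  refine ⟨γ, τ', 2 * 2 ^ l' * C, hγ, hγα, by positivity, fun n φ => ?_⟩
  have ht : 0 ≤ G.tnorm τ' φ := apply_nonneg _ _
  have hterm : ∀ k ∈ Finset.range (n + 1), G.growthNorm α i (monomialFun hα k (V k n φ)) ≤
      2 * ((n.factorial : ℝ) ^ γ * ((2 ^ l') ^ n * C ^ n) * G.tnorm τ' φ) := fun k hk => by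
    have hkn : k ≤ n := by rw [Finset.mem_range] at hk; omega
    calc _ ≤ (k.factorial : ℝ) ^ γ * (2 ^ l') ^ k * G.tnorm i.2.1 (V k n φ) := h k _
      _ ≤ (k.factorial : ℝ) ^ γ * (2 ^ l') ^ n *
          ((n.factorial / k.factorial : ℝ) * (2 * C ^ n) * G.tnorm τ' φ) := by
          gcongr
          · exact one_le_pow₀ one_le_two
          · exact h2 k n hkn φ
      _ = 2 * (((k.factorial : ℝ) ^ γ * (n.factorial / k.factorial : ℝ)) * ((2 ^ l') ^ n * C ^ n) *
          G.tnorm τ' φ) := by ring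
      _ ≤ _ := by
          gcongr
          exact factorial_rpow_mul_le hγ hkn
  calc _ ≤ ∑ k ∈ Finset.range (n + 1), G.growthNorm α i (monomialFun hα k (V k n φ)) :=
        Finset.le_sum_of_subadditive (G.growthNorm α i) (map_zero _).le (map_add_le_add _) _ _
    _ ≤ ∑ _k ∈ Finset.range (n + 1),
        2 * ((n.factorial : ℝ) ^ γ * ((2 ^ l') ^ n * C ^ n) * G.tnorm τ' φ) :=
        Finset.sum_le_sum hterm
    _ = (n + 1 : ℝ) * (2 * ((n.factorial : ℝ) ^ γ * ((2 ^ l') ^ n * C ^ n) * G.tnorm τ' φ)) := by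
        rw [Finset.sum_const, Finset.card_range, nsmul_eq_mul]
        push_cast
        ring
    _ ≤ (2 : ℝ) ^ n * (2 * ((n.factorial : ℝ) ^ γ * ((2 ^ l') ^ n * C ^ n) * G.tnorm τ' φ)) := by
        gcongr
        exact_mod_cast Nat.lt_two_pow_self
    _ = _ := by
        rw [mul_pow, mul_pow]
        ring

/-! ### Convergence in `Φ^{⊙ n}` -/

/-- The sum is formed pointwise as a multilinear form. Each finite system of coordinates passes to
the limit, and the supremum over systems bounds the remainder by the tail of the norms. -/
theorem exists_hasSum_symPow {k : ℕ} {ψ : ℕ → G.symPow k}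
    (h : ∀ τ, Summable fun n => G.tnorm τ (ψ n)) :
    ∃ s : G.symPow k, HasSum ψ s ∧ ∀ τ, G.tnorm τ s ≤ ∑' n, G.tnorm τ (ψ n) := by
  have hpt : ∀ ω, Summable fun n => (ψ n).1 ω := fun ω => by
    obtain ⟨τ, x, hx⟩ := G.exists_common_riesz ω
    have hω : ω = fun i => G.riesz τ (x i) := funext fun i => (hx i).symm
    refine Summable.of_norm_bounded ((h τ).mul_right (6 ^ k * ∏ i, ‖x i‖)) fun n => ?_
    rw [hω, ← mul_assoc]
    exact norm_apply_riesz_le (ψ n) x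
  let F : MultilinearMap ℂ (fun _ : Fin k => G.Dual) ℂ :=
    { toFun := fun ω => ∑' n, (ψ n).1 ω
      map_update_add' := fun {_} ω i x y => by
        rw [← (hpt _).tsum_add (hpt _)]
        congr 1
        funext n
        convert (ψ n).1.map_update_add ω i x y
      map_update_smul' := fun {_} ω i c x => by
        rw [smul_eq_mul, ← (hpt _).tsum_mul_left]
        congr 1
        funext n
        rw [← smul_eq_mul]
        convert (ψ n).1.map_update_smul ω i c x }
  have hF : ∀ (s : Finset ℕ) (τ : T) (v : G.OrthoSys τ),
      ‖G.coords v (F - (∑ n ∈ s, ψ n : G.symPow k).1)‖ ≤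
        ∑' n : {n // n ∉ s}, G.tnorm τ (ψ n) := fun s τ v => by
    have h1 : HasSum (fun n : {n // n ∉ s} => G.coords v (ψ n).1)
        (G.coords v (F - (∑ n ∈ s, ψ n : G.symPow k).1)) := by
      have h3 : HasSum (fun n => G.coords v (ψ n).1) (G.coords v F) := by
        have h4 : HasSum (fun n => (fun j => (ψ n).1 fun i => G.riesz τ (v.2.1 (j i)) :
            (Fin k → Fin v.1) → ℂ)) fun j => F fun i => G.riesz τ (v.2.1 (j i)) :=
          Pi.hasSum.2 fun j => (hpt _).hasSum
        exact h4.mapL (PiLp.continuousLinearEquiv 2 ℂ fun _ : Fin k → Fin v.1 => ℂ).symm.toContinuousLinearMap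
      refine (Finset.hasSum_compl_iff (f := fun n => G.coords v (ψ n).1) s).2 ?_
      convert h3 using 1
      rw [map_sub, Submodule.coe_sum, map_sum]
      exact sub_add_cancel _ _
    have h2 : Summable fun n : {n // n ∉ s} => G.tnorm τ (ψ n) := (h τ).subtype _
    rw [← h1.tsum_eq]
    refine tsum_of_norm_bounded h2.hasSum fun n => coords_le_tnorm v (ψ n)
  have hmem : F ∈ G.symPow k := by
    refine ⟨fun σ ω => tsum_congr fun n => (ψ n).2.1 σ ω, fun τ => ⟨∑' n : {n // n ∉ (∅ : Finset ℕ)},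
      G.tnorm τ (ψ n), ?_⟩⟩
    rintro _ ⟨v, rfl⟩
    have := hF ∅ τ v
    simpa using this
  have hbound : ∀ (s : Finset ℕ) (τ : T), G.tnorm τ ((⟨F, hmem⟩ : G.symPow k) - ∑ n ∈ s, ψ n) ≤
      ∑' n : {n // n ∉ s}, G.tnorm τ (ψ n) := fun s τ => tnorm_le fun v => hF s τ v
  refine ⟨⟨F, hmem⟩, ?_, fun τ => ?_⟩
  · refine ((G.symPow_withSeminorms k).tendsto_nhds _ _).2 fun τ ε hε => ?_
    have h6 := tendsto_tsum_compl_atTop_zero fun n => G.tnorm τ (ψ n)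
    filter_upwards [h6.eventually (gt_mem_nhds hε)] with s hs
    rw [map_sub_rev]
    exact (hbound s τ).trans_lt hs
  · have h7 := hbound ∅ τ
    rw [Finset.sum_empty, sub_zero] at h7
    refine h7.trans (le_of_eq ?_)
    rw [← (h τ).sum_add_tsum_subtype_compl ∅, Finset.sum_empty, zero_add]

end NuclearScale
end

noncomputable section

namespace NuclearScale

variable {T : Type*} {G : NuclearScale T} {α : ℝ}

/-! ### Coordinates with respect to a Sheffer sequence -/

theorem exists_exponent (hα : α ∈ Set.Icc (0 : ℝ) 1) : ∃ γ : ℝ, 1 ≤ γ ∧ 1 / γ ∈ orders α := by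
  rcases eq_or_lt_of_le hα.1 with h | h
  · subst h
    exact ⟨1, le_rfl, by simp [orders]⟩
  · refine ⟨1 / α, ?_, by simp [orders, h.ne']⟩
    rw [le_div_iff₀ h, one_mul]
    exact hα.2

theorem symPow_hasSum_unique {k : ℕ} {ψ : ℕ → G.symPow k} {s s' : G.symPow k} (h : HasSum ψ s)
    (h' : HasSum ψ s') : s = s' :=
  symPow_ext fun ω => (h.mapL (G.dpow ω k)).unique (h'.mapL (G.dpow ω k))

/-- The weight appears both as L^k and as L^n, so that a large L provides geometric decay in both
indices. Since W_{k,n} = 0 for n < k, only L^k ≤ L^n is needed, hence the Taylor weight L·L·C. -/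
theorem exists_invOp_taylor_bound {t : ∀ n : ℕ, G.Emin α →ₗ[ℂ] G.symPow n}
    (ht : ∀ (β : orders α) (τ : T) (L : ℝ), ∃ i : orders α × T × ℕ, ∀ n f,
      (n.factorial : ℝ) ^ (1 / (β : ℝ)) * L ^ n * G.tnorm τ (t n f) ≤ G.growthNorm α i f)
    {W : ∀ k n : ℕ, G.symPow n →L[ℂ] G.symPow k} (hW0 : ∀ k n, n < k → W k n = 0)
    (hW : ∀ τ, ∃ (τ' : T) (C : ℝ), 0 ≤ C ∧ ∀ k n, k ≤ n → ∀ φ : G.symPow n,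
      G.tnorm τ (W k n φ) ≤ (n.factorial / k.factorial : ℝ) * (2 * C ^ n) * G.tnorm τ' φ)
    {γ : ℝ} (hγ : 1 ≤ γ) (hγα : 1 / γ ∈ orders α) (τ : T) {L : ℝ} (hL : 1 ≤ L) :
    ∃ i : orders α × T × ℕ, ∀ f k n, (k.factorial : ℝ) ^ γ * L ^ k * L ^ n *
      G.tnorm τ (W k n (t n f)) ≤ 2 * G.growthNorm α i f := by
  obtain ⟨τ', C, hC, h⟩ := hW τ
  obtain ⟨i, hi⟩ := ht ⟨1 / γ, hγα⟩ τ' (L * L * C)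
  refine ⟨i, fun f k n => ?_⟩
  have h1 := hi n f
  simp only [one_div_one_div] at h1
  rcases lt_or_ge n k with hnk | hkn
  · rw [hW0 k n hnk]
    simp
  · have h2 := h k n hkn (t n f)
    have ht0 : 0 ≤ G.tnorm τ' (t n f) := apply_nonneg _ _
    calc _ ≤ (k.factorial : ℝ) ^ γ * L ^ n * L ^ n *
          ((n.factorial / k.factorial : ℝ) * (2 * C ^ n) * G.tnorm τ' (t n f)) := by
          gcongr
      _ = 2 * (((k.factorial : ℝ) ^ γ * (n.factorial / k.factorial : ℝ)) * (L * L * C) ^ n *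
          G.tnorm τ' (t n f)) := by
          rw [mul_pow, mul_pow]
          ring
      _ ≤ 2 * ((n.factorial : ℝ) ^ γ * (L * L * C) ^ n * G.tnorm τ' (t n f)) := by
          gcongr
          exact factorial_rpow_mul_le hγ hkn
      _ ≤ _ := by gcongr

theorem taylorDiag_polyFun (hα : α ∈ Set.Icc (0 : ℝ) 1)
    (V : ∀ k n : ℕ, G.symPow n →L[ℂ] G.symPow k) (n : ℕ) (φ : G.symPow n) (j : ℕ) (ω : G.Dual) :
    taylorDiag j (polyFun hα V n φ).1 ω =
      if j ∈ Finset.range (n + 1) then G.dpow ω j (V j n φ) else 0 := by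
  have h := (iteratedDeriv_eq_of_hasSum
    (c := fun j => if j ∈ Finset.range (n + 1) then G.dpow ω j (V j n φ) else 0)
    (g := fun z : ℂ => (polyFun hα V n φ).1 (z • ω)) (fun z _ => by
      have h1 : (polyFun hα V n φ).1 (z • ω) = ∑ j ∈ Finset.range (n + 1),
          (if j ∈ Finset.range (n + 1) then G.dpow ω j (V j n φ) else 0) * z ^ j := by
        refine (polyFun_apply hα V n φ (z • ω)).trans (Finset.sum_congr rfl fun j hj => ?_)
        rw [if_pos hj, dpow_smul, smul_apply, smul_eq_mul, mul_comm]
      rw [h1]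
      exact hasSum_sum_of_ne_finset_zero fun j hj => by rw [if_neg hj, zero_mul])).2 j
  have hj : (j.factorial : ℂ) ≠ 0 := by exact_mod_cast j.factorial_ne_zero
  rw [taylorDiag, h, inv_mul_cancel_left₀ hj]

/-- The coordinates of functions in `E^α_min(Φ')` with respect to a Sheffer sequence. -/
theorem IsSheffer.exists_coordinates {S : ∀ n : ℕ, G.Dual → G.SymDual n}
    {A B : G.FormalSeries G.Phi} {ρ : G.FormalSeries ℂ} (hS : IsSheffer S A ρ)
    (hρ : HolomorphicNearZero ρ) (hAB : IsCompInverse A B) (hA : QuasiHolomorphic A)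
    (hB : QuasiHolomorphic B) (hα : α ∈ Set.Icc (0 : ℝ) 1) :
    ∃ (t : ∀ n, G.symPow n → G.Emin α) (D : ∀ n, G.Emin α →ₗ[ℂ] G.symPow n),
      (∀ n φ ω, t n φ ω = S n ω φ) ∧
      (∀ i : orders α × T × ℕ, ∃ (γ : ℝ) (τ' : T) (L : ℝ), 1 ≤ γ ∧ 1 / γ ∈ orders α ∧ 0 ≤ L ∧
        ∀ (n : ℕ) (φ : G.symPow n), G.growthNorm α i (t n φ) ≤
          2 * ((n.factorial : ℝ) ^ γ * L ^ n * G.tnorm τ' φ)) ∧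
      (∀ γ : ℝ, 1 ≤ γ → 1 / γ ∈ orders α → ∀ (τ : T) (L : ℝ), 0 ≤ L → ∃ i : orders α × T × ℕ,
        ∀ f n, (n.factorial : ℝ) ^ γ * L ^ n * G.tnorm τ (D n f) ≤ 4 * G.growthNorm α i f) ∧
      (∀ f ω, HasSum (fun n => S n ω (D n f)) (f ω)) ∧
      ∀ k n φ, D k (t n φ) = deltaOp k n φ := by
  obtain ⟨V, W, hV, hVb, hW0, hSW, hWV, hWb⟩ := hS.exists_operators hρ hAB hA hB
  obtain ⟨c, hc, hcb⟩ := exists_taylorCoeff (G := G) hα.1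
  have hWf := fun (γ : ℝ) (hγ : 1 ≤ γ) (hγα : 1 / γ ∈ orders α) (τ : T) (L : ℝ) (hL : 1 ≤ L) =>
    exists_invOp_taylor_bound hcb hW0 hWb hγ hγα τ hL
  -- Using the weight 2 max(L, 1) in place of L gains 2^{−k} 2^{−n}, which makes the double series
  -- in k and n absolutely convergent.
  have hhalf : ∀ (γ : ℝ), 1 ≤ γ → 1 / γ ∈ orders α → ∀ (τ : T) (L : ℝ), 0 ≤ L →
      ∃ i : orders α × T × ℕ, ∀ f k n, (k.factorial : ℝ) ^ γ * L ^ k *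
        G.tnorm τ (W k n (c n f)) ≤ 2 * G.growthNorm α i f * (1 / 2) ^ k * (1 / 2) ^ n := by
    intro γ hγ hγα τ L hL
    have hmax : 1 ≤ max L 1 := le_max_right _ _
    obtain ⟨i, hi⟩ := hWf γ hγ hγα τ (2 * max L 1) (by linarith)
    refine ⟨i, fun f k n => ?_⟩
    have h1 := hi f k n
    have ht0 : 0 ≤ G.tnorm τ (W k n (c n f)) := apply_nonneg _ _
    rw [one_div, inv_pow, inv_pow, ← div_eq_mul_inv, ← div_eq_mul_inv, le_div_iff₀ (by positivity),
      le_div_iff₀ (by positivity)]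
    refine le_trans ?_ h1
    calc _ = (k.factorial : ℝ) ^ γ * (2 * L) ^ k * (2 * 1) ^ n * G.tnorm τ (W k n (c n f)) := by
          rw [mul_pow]
          ring
      _ ≤ _ := by
          gcongr
          exact le_max_left _ _
  obtain ⟨γ₀, hγ₀, hγ₀α⟩ := exists_exponent hα
  have hsummable : ∀ k f τ, Summable fun n => G.tnorm τ (W k n (c n f)) := fun k f τ => by
    obtain ⟨i, hi⟩ := hhalf γ₀ hγ₀ hγ₀α τ 1 zero_le_one
    have hk : (0 : ℝ) < (k.factorial : ℝ) ^ γ₀ * 1 ^ k := by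
      have : (0 : ℝ) < k.factorial := by exact_mod_cast k.factorial_pos
      positivity
    rw [← summable_mul_left_iff hk.ne']
    exact Summable.of_nonneg_of_le (fun n => mul_nonneg hk.le (apply_nonneg _ _)) (hi f k)
      (summable_geometric_two.mul_left _)
  choose D₀ hD₀ hD₀b using fun k f => exists_hasSum_symPow (hsummable k f)
  let D : ∀ n, G.Emin α →ₗ[ℂ] G.symPow n := fun k =>
    { toFun := D₀ k
      map_add' := fun f g => by
        refine symPow_hasSum_unique (hD₀ k (f + g)) ?_
        simpa only [map_add] using (hD₀ k f).add (hD₀ k g)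
      map_smul' := fun a f => by
        refine symPow_hasSum_unique (hD₀ k (a • f)) ?_
        simpa only [map_smul, RingHom.id_apply] using (hD₀ k f).const_smul a }
  have hD : ∀ k f, HasSum (fun n => W k n (c n f)) (D k f) := hD₀
  have ht : ∀ n φ ω, polyFun hα V n φ ω = S n ω φ := fun n φ ω => by
    rw [polyFun_apply, hV]
  have hR := exists_growthNorm_polyFun_le (G := G) hα hVb
  refine ⟨polyFun hα V, D, ht, hR, fun γ hγ hγα τ L hL => ?_, fun f ω => ?_, fun k n φ => ?_⟩
  · obtain ⟨i, hi⟩ := hhalf γ hγ hγα τ L hL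
    refine ⟨i, fun f k => ?_⟩
    have hp := apply_nonneg (G.growthNorm α i) f
    have hk : (0 : ℝ) ≤ (k.factorial : ℝ) ^ γ * L ^ k := by positivity
    calc _ ≤ (k.factorial : ℝ) ^ γ * L ^ k * ∑' n, G.tnorm τ (W k n (c n f)) := by
          gcongr
          exact hD₀b k f τ
      _ = ∑' n, (k.factorial : ℝ) ^ γ * L ^ k * G.tnorm τ (W k n (c n f)) := tsum_mul_left.symm
      _ ≤ ∑' n : ℕ, 2 * G.growthNorm α i f * (1 / 2) ^ n := by
          refine ((hsummable k f τ).mul_left _).tsum_le_tsum (fun n => (hi f k n).trans ?_)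
            (summable_geometric_two.mul_left _)
          refine mul_le_mul_of_nonneg_right (mul_le_of_le_one_right (by positivity) ?_) (by positivity)
          exact pow_le_one₀ (by norm_num) (by norm_num)
      _ = _ := by
          rw [tsum_mul_left, tsum_geometric_two]
          ring
  · obtain ⟨τ₀, x, hx⟩ := G.exists_riesz ω
    obtain ⟨β₀, hβ₀⟩ := orders_nonempty α
    obtain ⟨γ, τ', L, hγ, hγα, hL, hR⟩ := hR (⟨β₀, hβ₀⟩, τ₀, 0)
    obtain ⟨i, hi⟩ := hhalf γ hγ hγα τ' L hL
    have hSb : ∀ k φ, ‖S k ω φ‖ ≤ 2 * ((k.factorial : ℝ) ^ γ * L ^ k * G.tnorm τ' φ) *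
        Real.exp (((2 : ℝ) ^ 0)⁻¹ * ‖innerSL ℂ x‖ ^ β₀) := fun k φ => by
      have h := norm_apply_le_growthNorm (polyFun hα V k φ) (⟨β₀, hβ₀⟩, τ₀, 0) (innerSL ℂ x)
      rw [ht, show G.dualIncl τ₀ (innerSL ℂ x) = ω from hx] at h
      refine h.trans ?_
      gcongr
      exact hR k φ
    set E := Real.exp (((2 : ℝ) ^ 0)⁻¹ * ‖innerSL ℂ x‖ ^ β₀) with hE
    have hE0 : 0 ≤ E := Real.exp_nonneg _
    -- Summed over k first, this double series gives the Taylor series of f, since W expresses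
    -- monomials by the Sheffer sequence. Summed over n first, it gives the series of ⟨S^{(k)}(ω),
    -- D_k f⟩.
    have hsum : Summable fun p : ℕ × ℕ => S p.1 ω (W p.1 p.2 (c p.2 f)) := by
      have hg : Summable fun p : ℕ × ℕ => (1 / 2 : ℝ) ^ p.1 * (1 / 2 : ℝ) ^ p.2 :=
        summable_geometric_two.mul_of_nonneg summable_geometric_two (fun n => by positivity)
          fun n => by positivity
      refine Summable.of_norm_bounded (hg.mul_left (4 * G.growthNorm α i f * E)) fun p => ?_
      refine (hSb _ _).trans ?_
      have h := hi f p.1 p.2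
      calc _ ≤ 2 * (2 * G.growthNorm α i f * (1 / 2) ^ p.1 * (1 / 2) ^ p.2) * E := by gcongr
        _ = _ := by ring
    have h1 := hsum.hasSum.prod_fiberwise fun k => (hD k f).mapL (S k ω)
    have h2 : HasSum (fun n => taylorDiag n f.1 ω)
        (∑' p : ℕ × ℕ, S p.1 ω (W p.1 p.2 (c p.2 f))) := by
      refine ((Equiv.prodComm ℕ ℕ).hasSum_iff.2 hsum.hasSum).prod_fiberwise fun n => ?_
      have h3 : taylorDiag n f.1 ω = ∑ k ∈ Finset.range (n + 1), S k ω (W k n (c n f)) := by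
        rw [hSW, dpow_apply, hc]
      rw [h3]
      refine hasSum_sum_of_ne_finset_zero fun k hk => ?_
      change S k ω (W k n (c n f)) = 0
      rw [hW0 k n (by rw [Finset.mem_range] at hk; omega)]
      simp
    rw [(hasSum_taylorDiag f.mem_entireSubmodule ω).unique h2]
    exact h1
  -- The Taylor coefficients of ⟨S^{(n)}, φ⟩ are the V_{j,n} φ, so the claim reduces to W being a
  -- left inverse of V.
  · have hcj : ∀ j, c j (polyFun hα V n φ) = if j ∈ Finset.range (n + 1) then V j n φ else 0 :=
      fun j => symPow_ext fun ω => by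
        rw [hc, taylorDiag_polyFun]
        split_ifs <;> rfl
    refine symPow_hasSum_unique (hD k (polyFun hα V n φ)) ?_
    rw [← hWV k n φ]
    have h : ∑ j ∈ Finset.range (n + 1), W k j (V j n φ) =
        ∑ j ∈ Finset.range (n + 1), W k j (c j (polyFun hα V n φ)) :=
      Finset.sum_congr rfl fun j hj => by rw [hcj, if_pos hj]
    rw [h]
    exact hasSum_sum_of_ne_finset_zero fun j hj => by rw [hcj, if_neg hj, map_zero]

end NuclearScale
end

noncomputable section

/-! ### Projective limits of completions -/

section ProjLim

variable {V : Type*} [AddCommGroup V] [Module ℂ V]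

instance (p : Seminorm ℂ V) : T2Space (NormCompletion p) :=
  letI := seminormUniformSpace p
  inferInstanceAs (T2Space (UniformSpace.Completion V))

theorem toNormCompletion_isInducing (p : Seminorm ℂ V) :
    @Topology.IsInducing V (NormCompletion p) (seminormUniformSpace p).toTopologicalSpace _
      (toNormCompletion p) :=
  letI := seminormUniformSpace p
  (UniformSpace.Completion.isUniformInducing_coe V).isInducing

theorem denseRange_toNormCompletion (p : Seminorm ℂ V) : DenseRange (toNormCompletion p) :=
  letI := seminormUniformSpace p
  UniformSpace.Completion.denseRange_coe

theorem continuous_connectingMap (p q : Seminorm ℂ V) : Continuous (connectingMap p q) :=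
  @UniformSpace.Completion.continuous_map V (seminormUniformSpace q) V (seminormUniformSpace p) id

theorem exists_nhds_toNormCompletion (p : Seminorm ℂ V) (y : NormCompletion p) {ε : ℝ} (hε : 0 < ε) :
    ∃ O ∈ 𝓝 y, ∀ a b, toNormCompletion p a ∈ O → toNormCompletion p b ∈ O → p (a - b) < ε := by
  let := AddGroupSeminorm.toSeminormedAddCommGroup p.toAddGroupSeminorm
  have h1 : {q : V × V | dist q.1 q.2 < ε} ∈ uniformity V := Metric.dist_mem_uniformity hε
  rw [← (UniformSpace.Completion.isUniformInducing_coe V).comap_uniformity] at h1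
  obtain ⟨E, hE, hsub⟩ := h1
  have h2 : 𝓝 y ×ˢ 𝓝 y ≤ uniformity (UniformSpace.Completion V) := (cauchy_nhds (a := y)).2
  obtain ⟨O, hO, hOE⟩ := Filter.mem_prod_same_iff.1 (h2 hE)
  refine ⟨O, hO, fun a b ha hb => ?_⟩
  have h3 : dist a b < ε := @hsub (a, b) (hOE (Set.mk_mem_prod ha hb))
  rw [dist_eq_norm] at h3
  exact h3

variable {ι : Type*} {p : ι → Seminorm ℂ V}

instance : T2Space (ProjLim p) :=
  inferInstanceAs (T2Space {x : ∀ i, NormCompletion (p i) //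
    ∀ (i j : ι) (C : ℝ), (∀ v, p i v ≤ C * p j v) → connectingMap (p i) (p j) (x j) = x i})

theorem ProjLim.isInducing_val :
    Topology.IsInducing (Subtype.val : ProjLim p → ∀ i, NormCompletion (p i)) := ⟨rfl⟩

/-- The topology of V is the infimum of its seminorm topologies, each induced from the corresponding
completion, and the product topology has the same description. -/
theorem isInducing_toProjLim [TopologicalSpace V] [Nonempty ι] (hp : WithSeminorms p) :
    Topology.IsInducing (toProjLim p) := by
  have := hp.topologicalAddGroup
  refine (ProjLim.isInducing_val.of_comp_iff (f := toProjLim p)).1 ⟨?_⟩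
  rw [(SeminormFamily.withSeminorms_iff_topologicalSpace_eq_iInf p).1 hp]
  simp only [Pi.topologicalSpace, induced_iInf, induced_compose]
  exact iInf_congr fun i => @Topology.IsInducing.eq_induced _ _
    (seminormUniformSpace (p i)).toTopologicalSpace _ _ (toNormCompletion_isInducing (p i))

/-- A basic neighborhood restricts finitely many coordinates. By directedness all of them are
continuous images of one coordinate k, so approximating in that single completion is enough. -/
theorem denseRange_toProjLim [Nonempty ι]
    (hdir : ∀ i j, ∃ (k : ι) (C : ℝ), (∀ v, p i v ≤ C * p k v) ∧ ∀ v, p j v ≤ C * p k v) :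
    DenseRange (toProjLim p) := by
  classical
  have hdir' : ∀ s : Finset ι, ∃ k, ∀ i ∈ s, ∃ C : ℝ, ∀ v, p i v ≤ C * p k v := fun s => by
    induction s using Finset.induction_on with
    | empty => exact ⟨Classical.arbitrary ι, by simp⟩
    | insert a s _ ih =>
      obtain ⟨j, hj⟩ := ih
      obtain ⟨k, C, h1, h2⟩ := hdir a j
      refine ⟨k, fun i hi => ?_⟩
      rcases Finset.mem_insert.1 hi with rfl | hi
      · exact ⟨C, h1⟩
      · obtain ⟨D, hD⟩ := hj i hi
        refine ⟨|D| * C, fun v => (hD v).trans ?_⟩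
        have h3 := apply_nonneg (p j) v
        calc D * p j v ≤ |D| * p j v := by gcongr; exact le_abs_self D
          _ ≤ |D| * (C * p k v) := by gcongr; exact h2 v
          _ = _ := by ring
  intro x
  rw [mem_closure_iff]
  intro U hU hxU
  obtain ⟨W, hW, rfl⟩ := ProjLim.isInducing_val.isOpen_iff.1 hU
  obtain ⟨s, u, hu, hsu⟩ := isOpen_pi_iff.1 hW x.1 hxU
  obtain ⟨k, hk⟩ := hdir' s
  choose! C hC using hk
  have hO : IsOpen (⋂ i ∈ s, connectingMap (p i) (p k) ⁻¹' u i) :=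
    isOpen_biInter_finset fun i hi => (hu i hi).1.preimage (continuous_connectingMap _ _)
  have hx : x.1 k ∈ ⋂ i ∈ s, connectingMap (p i) (p k) ⁻¹' u i := by
    simp only [Set.mem_iInter, Set.mem_preimage]
    intro i hi
    rw [x.2 i k (C i) (hC i hi)]
    exact (hu i hi).2
  obtain ⟨v, hv⟩ := (denseRange_toNormCompletion (p k)).exists_mem_open hO ⟨_, hx⟩
  refine ⟨toProjLim p v, hsu fun i hi => ?_, v, rfl⟩
  simp only [Set.mem_iInter, Set.mem_preimage] at hv
  have h1 := hv i hi
  rwa [connectingMap_coe (p i) (p k) (C i) (hC i hi)] at h1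

/-- A complete Hausdorff locally convex space is the projective limit of its completions in a
directed family of seminorms. -/
theorem isHomeomorph_toProjLim [TopologicalSpace V] [Nonempty ι] (hp : WithSeminorms p)
    (hdir : ∀ i j, ∃ (k : ι) (C : ℝ), (∀ v, p i v ≤ C * p k v) ∧ ∀ v, p j v ≤ C * p k v)
    (hsep : ∀ v, (∀ i, p i v = 0) → v = 0)
    (hcomplete : ∀ F : Filter V, F.NeBot → (∀ i, ∀ ε > (0 : ℝ), ∃ s ∈ F, ∀ a ∈ s, ∀ b ∈ s,
      p i (a - b) < ε) → ∃ f, F ≤ 𝓝 f) :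
    IsHomeomorph (toProjLim p) := by
  have hgrp := hp.topologicalAddGroup
  have hind := isInducing_toProjLim hp
  have hT1 : T1Space V := hp.T1_of_separating fun v hv => by
    by_contra! h
    exact hv (hsep v h)
  rw [isHomeomorph_iff_isEmbedding_surjective]
  refine ⟨⟨hind, hind.injective⟩, fun x => ?_⟩
  -- The trace on V of the neighborhood filter of x is proper by density and Cauchy in every
  -- seminorm. Its limit maps to x because the projective limit is Hausdorff.
  have hne : (Filter.comap (toProjLim p) (𝓝 x)).NeBot :=
    Filter.comap_neBot_iff.2 fun t ht => by
      obtain ⟨y, hy, v, rfl⟩ := mem_closure_iff_nhds.1 (denseRange_toProjLim hdir x) t ht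
      exact ⟨v, hy⟩
  obtain ⟨f, hf⟩ := hcomplete (Filter.comap (toProjLim p) (𝓝 x)) hne fun i ε hε => by
    obtain ⟨O, hO, h⟩ := exists_nhds_toNormCompletion (p i) (x.1 i) hε
    have hc : Continuous fun y : ProjLim p => y.1 i :=
      (continuous_apply i).comp ProjLim.isInducing_val.continuous
    exact ⟨toProjLim p ⁻¹' ((fun y : ProjLim p => y.1 i) ⁻¹' O),
      Filter.preimage_mem_comap (hc.continuousAt hO), fun a ha b hb => h a b ha hb⟩
  exact ⟨f, tendsto_nhds_unique ((hind.continuous.tendsto f).mono_left hf) Filter.tendsto_comap⟩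

end ProjLim

namespace NuclearScale

variable {T : Type*} {G : NuclearScale T} {α : ℝ}

/-! ### Completeness of `E^α_min(Φ')` -/

theorem growthNorm_withSeminorms (α : ℝ) : WithSeminorms (G.growthNorm α) := ⟨rfl⟩

/-- `E^α_min(Φ')` is complete. -/
theorem Emin.exists_limit (hα : 0 ≤ α) (F : Filter (G.Emin α)) (hF : F.NeBot)
    (h : ∀ i, ∀ ε > (0 : ℝ), ∃ s ∈ F, ∀ f ∈ s, ∀ g ∈ s, G.growthNorm α i (f - g) < ε) :
    ∃ f, F ≤ 𝓝 f := by
  have hsub : ∀ (f g : G.Emin α) ω, f ω - g ω = (f - g) ω := fun _ _ _ => rfl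
  have hlim : ∀ ω : G.Dual, ∃ y : ℂ, Filter.Tendsto (fun f : G.Emin α => f ω) F (𝓝 y) := fun ω => by
    obtain ⟨τ, x, hx⟩ := G.exists_riesz ω
    obtain ⟨β, hβ⟩ := orders_nonempty α
    refine CompleteSpace.complete (f := F.map fun f : G.Emin α => f ω)
      (Metric.cauchy_iff.2 ⟨hF.map _, fun ε hε => ?_⟩)
    set E := Real.exp (((2 : ℝ) ^ 0)⁻¹ * ‖innerSL ℂ x‖ ^ β) with hE
    have hE0 : 0 < E := Real.exp_pos _
    obtain ⟨s, hs, hfg⟩ := h (⟨β, hβ⟩, τ, 0) (ε / E) (by positivity)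
    refine ⟨_, Filter.image_mem_map hs, ?_⟩
    rintro _ ⟨f, hf, rfl⟩ _ ⟨g, hg, rfl⟩
    have h1 := norm_apply_le_growthNorm (f - g) (⟨β, hβ⟩, τ, 0) (innerSL ℂ x)
    have h2 := hfg f hf g hg
    rw [lt_div_iff₀ hE0] at h2
    rw [dist_eq_norm, hsub]
    rw [show G.dualIncl τ (innerSL ℂ x) = ω from hx] at h1
    exact h1.trans_lt h2
  choose L hL using hlim
  have hunif : ∀ (i : orders α × T × ℕ) (ε : ℝ), 0 < ε → ∀ᶠ f in F, ∀ ω : G.H i.2.1 →L[ℂ] ℂ,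
      ‖f (G.dualIncl i.2.1 ω) - L (G.dualIncl i.2.1 ω)‖ ≤
        ε * Real.exp (((2 : ℝ) ^ i.2.2)⁻¹ * ‖ω‖ ^ (i.1 : ℝ)) := fun i ε hε => by
    obtain ⟨s, hs, hfg⟩ := h i ε hε
    filter_upwards [hs] with f hf ω
    refine le_of_tendsto (tendsto_const_nhds.sub (hL (G.dualIncl i.2.1 ω))).norm ?_
    filter_upwards [hs] with g hg
    rw [hsub]
    refine (norm_apply_le_growthNorm (f - g) i ω).trans ?_
    gcongr
    exact (hfg f hf g hg).le
  -- The exponential weight is bounded on balls of H_{-τ}, so convergence in one growth norm is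
  -- locally uniform, and the limit inherits continuity and holomorphy.
  have hloc : ∀ τ, TendstoLocallyUniformly
      (fun (f : G.Emin α) (ω : G.H τ →L[ℂ] ℂ) => f (G.dualIncl τ ω))
      (fun ω => L (G.dualIncl τ ω)) F := fun τ => by
    obtain ⟨β, hβ⟩ := orders_nonempty α
    rw [Metric.tendstoLocallyUniformly_iff]
    intro ε hε ω₀
    have hβ0 : 0 ≤ β := (orders_pos hα hβ).le
    set E := Real.exp (((2 : ℝ) ^ 0)⁻¹ * (‖ω₀‖ + 1) ^ β) with hE
    have hE0 : 0 < E := Real.exp_pos _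
    refine ⟨Metric.ball ω₀ 1, Metric.ball_mem_nhds _ one_pos, ?_⟩
    filter_upwards [hunif (⟨β, hβ⟩, τ, 0) (ε / (2 * E)) (by positivity)] with f hf ω hω
    have h1 : ‖ω‖ ≤ ‖ω₀‖ + 1 := by
      have h2 := norm_sub_norm_le ω ω₀
      rw [← dist_eq_norm] at h2
      linarith [Metric.mem_ball.1 hω]
    rw [dist_comm, dist_eq_norm]
    calc ‖f (G.dualIncl τ ω) - L (G.dualIncl τ ω)‖
        ≤ ε / (2 * E) * Real.exp (((2 : ℝ) ^ 0)⁻¹ * ‖ω‖ ^ β) := hf ω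
      _ ≤ ε / (2 * E) * E := by rw [hE]; gcongr
      _ = ε / 2 := by field_simp
      _ < ε := by linarith
  have hmem : L ∈ G.eminSubmodule α := fun β hβ τ => by
    have hc : Continuous fun ω : G.H τ →L[ℂ] ℂ => L (G.dualIncl τ ω) :=
      (hloc τ).continuous (Filter.Eventually.of_forall
        fun f => f.mem_entireSubmodule.1 τ).frequently
    refine ⟨⟨hc.continuousOn, fun ξ _ η => ⟨1, one_pos, ?_⟩⟩, fun l => ?_⟩
    · have hl : Continuous fun z : ℂ => ξ + z • η := by fun_prop
      have h1 := ((hloc τ).comp (fun z : ℂ => ξ + z • η) hl)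
      have h2 := (tendstoLocallyUniformlyOn_univ.2 h1).differentiableOn
        (Filter.Eventually.of_forall fun f => ?_) isOpen_univ
      · exact h2.mono (Set.subset_univ _)
      · have h3 := f.mem_entireSubmodule.2 (G.dualIncl τ ξ) (G.dualIncl τ η)
        have h4 : Differentiable ℂ fun z : ℂ => f.1 (G.dualIncl τ (ξ + z • η)) := by
          simpa only [map_add, map_smul] using h3
        exact h4.differentiableOn
    · obtain ⟨f, hf⟩ := (hunif (⟨β, hβ⟩, τ, l) 1 one_pos).exists
      refine ⟨G.growthNorm α (⟨β, hβ⟩, τ, l) f + 1, ?_⟩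
      rintro _ ⟨ω, rfl⟩
      rw [weighted, neg_mul, Real.exp_neg, ← div_eq_mul_inv, div_le_iff₀ (Real.exp_pos _), add_mul]
      have h1 := norm_apply_le_growthNorm f (⟨β, hβ⟩, τ, l) ω
      have h2 := hf ω
      have h3 := norm_sub_norm_le (L (G.dualIncl τ ω)) (f (G.dualIncl τ ω))
      rw [norm_sub_rev] at h3
      linarith
  refine ⟨⟨L, hmem⟩, ?_⟩
  have h1 : Filter.Tendsto id F (𝓝 (⟨L, hmem⟩ : G.Emin α)) :=
    ((growthNorm_withSeminorms α).tendsto_nhds _ _).2 fun i ε hε => by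
      filter_upwards [hunif i (ε / 2) (by positivity)] with f hf
      refine lt_of_le_of_lt (growthNorm_le (M := ε / 2) fun ω => ?_) (by linarith)
      exact hf ω
  exact h1

end NuclearScale
end

noncomputable section

namespace NuclearScale

variable {T : Type*} {G : NuclearScale T} {α : ℝ}

/-! ### Each `‖·‖_τ` is a norm -/

/-- A vanishing norm kills φ only on the diagonal of H_{-τ}. But H_{-τ} is dense in each larger
H_{-σ'}, being the range of the adjoint of an injective inclusion, and φ is continuous there. -/
theorem eq_zero_of_tnorm_eq_zero {n : ℕ} {τ : T} {φ : G.symPow n} (h : G.tnorm τ φ = 0) :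
    φ = 0 := by
  refine symPow_ext fun ω => ?_
  obtain ⟨σ, y, rfl⟩ := G.exists_riesz ω
  obtain ⟨σ', ⟨i, hi⟩, ⟨j, hj⟩⟩ := G.directed τ σ
  have hinj : Function.Injective i := fun a b hab => G.emb_injective σ' <| by
    rw [← hi, ContinuousLinearMap.comp_apply, ContinuousLinearMap.comp_apply, hab]
  have hincl : ∀ {κ : T} {k : G.H σ' →L[ℂ] G.H κ}, G.emb κ ∘L k = G.emb σ' → ∀ x : G.H κ,
      G.riesz σ' (k.adjoint x) = G.riesz κ x := fun {κ k} hk x => by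
    ext ξ
    have h1 : k (G.incl σ' ξ) = G.incl κ ξ := by
      apply G.emb_injective κ
      rw [← ContinuousLinearMap.comp_apply, hk]
      exact (ξ.2 σ').trans (ξ.2 κ).symm
    change inner ℂ (k.adjoint x) (G.incl σ' ξ) = inner ℂ x (G.incl κ ξ)
    rw [ContinuousLinearMap.adjoint_inner_left, h1]
  have hdense : DenseRange i.adjoint := by
    have h1 : (LinearMap.range i.adjoint.toLinearMap)ᗮ = ⊥ := by
      rw [ContinuousLinearMap.orthogonal_range, ContinuousLinearMap.adjoint_adjoint]
      exact LinearMap.ker_eq_bot.2 hinj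
    have h2 := (Submodule.topologicalClosure_eq_top_iff (K := LinearMap.range i.adjoint.toLinearMap)).2 h1
    exact Submodule.dense_iff_topologicalClosure_eq_top.2 h2
  obtain ⟨F, hF⟩ := exists_continuousMultilinear σ' φ
  have hcont : Continuous fun x : G.H σ' => φ.1 fun _ => G.riesz σ' x := by
    have h1 : Continuous fun x : G.H σ' => F fun _ => innerSL ℂ x :=
      F.cont.comp (continuous_pi fun _ => (innerSL ℂ).continuous)
    simp only [hF] at h1
    exact h1
  have hzero : (fun x : G.H σ' => φ.1 fun _ => G.riesz σ' x) = fun _ => 0 :=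
    hdense.equalizer hcont continuous_const <| funext fun x => by
      have h1 := G.norm_diag_le τ x φ
      rw [h, mul_zero] at h1
      simp only [Function.comp_apply]
      rw [hincl hi]
      exact norm_le_zero_iff.1 h1
  rw [← hincl hj y]
  exact congrFun hzero _

/-! ### Convergence of series in `E^α_min(Φ')` -/

/-- Pointwise convergent series with summable growth norms converge in `E^α_min(Φ')`. -/
theorem Emin.tendsto_sum_range {t : ℕ → G.Emin α} {f : G.Emin α}
    (hsum : ∀ i, Summable fun n => G.growthNorm α i (t n))
    (hf : ∀ ω, HasSum (fun n => t n ω) (f ω)) :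
    Filter.Tendsto (fun N => ∑ n ∈ Finset.range N, t n) Filter.atTop (𝓝 f) := by
  refine ((growthNorm_withSeminorms α).tendsto_nhds _ _).2 fun i ε hε => ?_
  have h1 := tendsto_sum_nat_add fun n => G.growthNorm α i (t n)
  filter_upwards [h1.eventually_lt_const hε] with N hN
  refine lt_of_le_of_lt (growthNorm_le fun ω => ?_) hN
  have h2 : HasSum (fun n => t (n + N) (G.dualIncl i.2.1 ω))
      (f (G.dualIncl i.2.1 ω) - ∑ n ∈ Finset.range N, t n (G.dualIncl i.2.1 ω)) :=
    (hasSum_nat_add_iff' N).2 (hf _)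
  have h3 : ((∑ n ∈ Finset.range N, t n) - f) (G.dualIncl i.2.1 ω) =
      -(f (G.dualIncl i.2.1 ω) - ∑ n ∈ Finset.range N, t n (G.dualIncl i.2.1 ω)) := by
    rw [← Emin.sum_apply, neg_sub]
    rfl
  rw [h3, norm_neg, ← h2.tsum_eq, ← tsum_mul_right]
  exact tsum_of_norm_bounded (((summable_nat_add_iff N).2 (hsum i)).mul_right _).hasSum
    fun n => norm_apply_le_growthNorm (t (n + N)) i ω

theorem Emin.growthNorm_le_tsum {t : ℕ → G.Emin α} {f : G.Emin α} {i : orders α × T × ℕ}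
    {b : ℕ → ℝ} (hb : Summable b) (htb : ∀ n, G.growthNorm α i (t n) ≤ b n)
    (hf : ∀ ω, HasSum (fun n => t n ω) (f ω)) : G.growthNorm α i f ≤ ∑' n, b n := by
  refine growthNorm_le fun ω => ?_
  rw [← (hf _).tsum_eq, ← tsum_mul_right]
  refine tsum_of_norm_bounded (hb.mul_right _).hasSum fun n => ?_
  refine (norm_apply_le_growthNorm (t n) i ω).trans ?_
  gcongr
  exact htb n

/-! ### Existence and uniqueness of the Sheffer expansion -/

section Expansion

variable {S : ∀ n : ℕ, G.Dual → G.SymDual n} {t : ∀ n, G.symPow n → G.Emin α}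
  {D : ∀ n, G.Emin α →ₗ[ℂ] G.symPow n}

/-- D_k is continuous for the growth norms, and on the N-th partial sum it gives φ_k as soon as N >
k. -/
theorem eq_of_isExpansion (hα : α ∈ Set.Icc (0 : ℝ) 1) (ht : ∀ n φ ω, t n φ ω = S n ω φ)
    (hDb : ∀ γ : ℝ, 1 ≤ γ → 1 / γ ∈ orders α → ∀ (τ : T) (L : ℝ), 0 ≤ L → ∃ i : orders α × T × ℕ,
      ∀ f n, (n.factorial : ℝ) ^ γ * L ^ n * G.tnorm τ (D n f) ≤ 4 * G.growthNorm α i f)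
    (hDt : ∀ k n φ, D k (t n φ) = deltaOp k n φ)
    {f : G.Emin α} {φ : ∀ n, G.symPow n} (h : IsExpansion S f φ) : φ = fun n => D n f := by
  obtain ⟨u, hu, hlim⟩ := h
  have hut : u = fun n => t n (φ n) :=
    funext fun n => Subtype.ext <| funext fun ω => (hu n ω).trans (ht n (φ n) ω).symm
  subst hut
  obtain ⟨γ, hγ, hγα⟩ := exists_exponent hα
  funext k
  refine sub_eq_zero.1 (eq_zero_of_tnorm (n := k) fun τ => ?_)
  obtain ⟨i, hi⟩ := hDb γ hγ hγα τ 1 zero_le_one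
  have hlim' := ((growthNorm_withSeminorms α).tendsto_nhds _ _).1 hlim i
  refine le_antisymm (le_of_forall_pos_lt_add fun ε hε => ?_) (apply_nonneg (G.tnorm (n := k) τ) _)
  obtain ⟨N, hN, hkN⟩ := ((hlim' (ε / 4) (by positivity)).and (Filter.eventually_gt_atTop k)).exists
  have h1 : D k (∑ n ∈ Finset.range N, t n (φ n)) = φ k := by
    rw [map_sum, Finset.sum_eq_single k]
    · rw [hDt, deltaOp_self]
      rfl
    · intro n _ hn
      rw [hDt, deltaOp_of_ne hn]
      rfl
    · intro hk
      exact absurd (Finset.mem_range.2 hkN) hk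
  have h2 := hi ((∑ n ∈ Finset.range N, t n (φ n)) - f) k
  rw [map_sub, h1, one_pow, mul_one] at h2
  have h3 : (1 : ℝ) ≤ (k.factorial : ℝ) ^ γ :=
    Real.one_le_rpow (by exact_mod_cast k.factorial_pos) (by linarith)
  have h4 := le_mul_of_one_le_left (apply_nonneg (G.tnorm (n := k) τ) (φ k - D k f)) h3
  linarith

/-- Applying the coordinate estimate with weight 2L gains 2^{−n} over the growth of the terms, so
the series converges absolutely in every growth norm. -/
theorem isExpansion_coordinates (ht : ∀ n φ ω, t n φ ω = S n ω φ)
    (htb : ∀ i : orders α × T × ℕ, ∃ (γ : ℝ) (τ' : T) (L : ℝ), 1 ≤ γ ∧ 1 / γ ∈ orders α ∧ 0 ≤ L ∧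
      ∀ (n : ℕ) (φ : G.symPow n), G.growthNorm α i (t n φ) ≤
        2 * ((n.factorial : ℝ) ^ γ * L ^ n * G.tnorm τ' φ))
    (hDb : ∀ γ : ℝ, 1 ≤ γ → 1 / γ ∈ orders α → ∀ (τ : T) (L : ℝ), 0 ≤ L → ∃ i : orders α × T × ℕ,
      ∀ f n, (n.factorial : ℝ) ^ γ * L ^ n * G.tnorm τ (D n f) ≤ 4 * G.growthNorm α i f)
    (hsum : ∀ f ω, HasSum (fun n => S n ω (D n f)) (f ω)) (f : G.Emin α) :
    IsExpansion S f fun n => D n f := by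
  refine ⟨fun n => t n (D n f), fun n ω => ht _ _ _, Emin.tendsto_sum_range (fun i => ?_) fun ω => ?_⟩
  · obtain ⟨γ, τ', L, hγ, hγα, hL, h⟩ := htb i
    obtain ⟨j, hj⟩ := hDb γ hγ hγα τ' (2 * L) (by positivity)
    refine Summable.of_nonneg_of_le (fun n => apply_nonneg _ _) (fun n => ?_)
      (summable_geometric_two.mul_left (8 * G.growthNorm α j f))
    refine (h n _).trans ?_
    have h1 := hj f n
    rw [mul_pow] at h1
    have h2 : (1 / 2 : ℝ) ^ n * 2 ^ n = 1 := by rw [← mul_pow]; norm_num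
    calc 2 * ((n.factorial : ℝ) ^ γ * L ^ n * G.tnorm τ' (D n f))
        = 2 * (((n.factorial : ℝ) ^ γ * (2 ^ n * L ^ n) * G.tnorm τ' (D n f)) *
          (1 / 2) ^ n) := by
          linear_combination -(2 * (n.factorial : ℝ) ^ γ * L ^ n * G.tnorm τ' (D n f)) * h2
      _ ≤ 2 * ((4 * G.growthNorm α j f) * (1 / 2) ^ n) := by gcongr
      _ = _ := by ring
  · simpa only [ht] using hsum f ω

end Expansion

end NuclearScale
end

noncomputable section

namespace NuclearScale

variable {T : Type*} {G : NuclearScale T} {α : ℝ}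

/-! ### The norms `|||·|||_{τ,l,α}` -/

/-- The norm `∑ n, (n!)^{1/α} 2^{l n} ‖D n f‖_τ`. -/
def sequenceNorm {D : ∀ n, G.Emin α →ₗ[ℂ] G.symPow n} (hD : ∀ (f : G.Emin α) (i : T × ℕ),
    Summable fun n => (n.factorial : ℝ) ^ (1 / α) * 2 ^ (i.2 * n) * G.tnorm i.1 (D n f))
    (i : T × ℕ) : Seminorm ℂ (G.Emin α) :=
  Seminorm.of
    (fun f => ∑' n : ℕ, (n.factorial : ℝ) ^ (1 / α) * 2 ^ (i.2 * n) * G.tnorm i.1 (D n f))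
    (fun f g => by
      rw [← (hD f i).tsum_add (hD g i)]
      refine (hD (f + g) i).tsum_le_tsum (fun n => ?_) ((hD f i).add (hD g i))
      rw [← mul_add, map_add]
      gcongr
      exact map_add_le_add _ _ _)
    (fun c f => by
      rw [← tsum_mul_left]
      congr 1
      funext n
      rw [map_smul, map_smul_eq_mul]
      ring)

section

variable {D : ∀ n, G.Emin α →ₗ[ℂ] G.symPow n} (hD : ∀ (f : G.Emin α) (i : T × ℕ),
    Summable fun n => (n.factorial : ℝ) ^ (1 / α) * 2 ^ (i.2 * n) * G.tnorm i.1 (D n f))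

theorem hasSum_sequenceNorm (f : G.Emin α) (i : T × ℕ) :
    HasSum (fun n => (n.factorial : ℝ) ^ (1 / α) * 2 ^ (i.2 * n) * G.tnorm i.1 (D n f))
      (sequenceNorm hD i f) :=
  (hD f i).hasSum

theorem sequenceNorm_definite {S : ∀ n : ℕ, G.Dual → G.SymDual n}
    (hsum : ∀ f ω, HasSum (fun n => S n ω (D n f)) (f ω)) {i : T × ℕ} {f : G.Emin α}
    (h : sequenceNorm hD i f = 0) : f = 0 := by
  have h1 := hasSum_sequenceNorm hD f i
  rw [h, hasSum_zero_iff_of_nonneg fun n => by positivity] at h1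
  have h2 : ∀ n, D n f = 0 := fun n => by
    have h3 := congrFun h1 n
    have h4 : (0 : ℝ) < (n.factorial : ℝ) ^ (1 / α) * 2 ^ (i.2 * n) := by
      have : (0 : ℝ) < n.factorial := by exact_mod_cast n.factorial_pos
      positivity
    exact eq_zero_of_tnorm_eq_zero ((mul_eq_zero.1 h3).resolve_left h4.ne')
  refine Subtype.ext <| funext fun ω => (hsum f ω).unique ?_
  simp only [h2, map_zero]
  exact hasSum_zero

/-- Passing to a dominating index τ costs K^n, which is absorbed by raising the weight from 2^{ln}
to 2^{(l+c)n} with 2^c > K. -/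
theorem sequenceNorm_directed (i j : T × ℕ) : ∃ (k : T × ℕ) (C : ℝ),
    (∀ f, sequenceNorm hD i f ≤ C * sequenceNorm hD k f) ∧
      ∀ f, sequenceNorm hD j f ≤ C * sequenceNorm hD k f := by
  classical
  obtain ⟨τ, K, hK, h⟩ := G.exists_tnorm_le {i.1, j.1}
  obtain ⟨c, hc⟩ := pow_unbounded_of_one_lt K one_lt_two
  have key : ∀ i' : T × ℕ, i'.1 ∈ ({i.1, j.1} : Finset T) → i'.2 ≤ max i.2 j.2 → ∀ f,
      sequenceNorm hD i' f ≤ 1 * sequenceNorm hD (τ, max i.2 j.2 + c) f := fun i' h1 h2 f => by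
    rw [one_mul]
    refine hasSum_le (fun n => ?_) (hasSum_sequenceNorm hD f i') (hasSum_sequenceNorm hD f _)
    have h3 := (h i'.1 h1).2 n (D n f)
    have hK0 : (0 : ℝ) ≤ K := zero_le_one.trans hK
    calc (n.factorial : ℝ) ^ (1 / α) * 2 ^ (i'.2 * n) * G.tnorm i'.1 (D n f)
        ≤ (n.factorial : ℝ) ^ (1 / α) * 2 ^ (max i.2 j.2 * n) *
          (((2 : ℝ) ^ c) ^ n * G.tnorm τ (D n f)) := by
          gcongr
          · exact one_le_two
          · refine h3.trans ?_
            gcongr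
      _ = _ := by
          simp only [add_mul, pow_add, ← pow_mul]
          ring
  exact ⟨_, 1, key i (by simp) (le_max_left _ _), key j (by simp) (le_max_right _ _)⟩

end

/-! ### Equivalence of the norms |||·||| with the growth norms -/

section

variable {S : ∀ n : ℕ, G.Dual → G.SymDual n} {t : ∀ n, G.symPow n → G.Emin α}
  {D : ∀ n, G.Emin α →ₗ[ℂ] G.symPow n}

/-- The coordinate estimate is used with weight 2^{l+1}; the extra factor 2^n makes the terms
summable with a bound by one growth norm. -/
theorem exists_term_le (hα : α ∈ Set.Ioc (0 : ℝ) 1)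
    (hDb : ∀ γ : ℝ, 1 ≤ γ → 1 / γ ∈ orders α → ∀ (τ : T) (L : ℝ), 0 ≤ L → ∃ i : orders α × T × ℕ,
      ∀ f n, (n.factorial : ℝ) ^ γ * L ^ n * G.tnorm τ (D n f) ≤ 4 * G.growthNorm α i f)
    (i : T × ℕ) : ∃ j : orders α × T × ℕ, ∀ f n,
      (n.factorial : ℝ) ^ (1 / α) * 2 ^ (i.2 * n) * G.tnorm i.1 (D n f) ≤
        4 * G.growthNorm α j f * (1 / 2) ^ n := by
  obtain ⟨j, hj⟩ := hDb (1 / α) (by rw [le_div_iff₀ hα.1, one_mul]; exact hα.2)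
    (by simp [orders, hα.1.ne']) i.1 (2 ^ (i.2 + 1)) (by positivity)
  refine ⟨j, fun f n => ?_⟩
  have h1 : (1 / 2 : ℝ) ^ n * 2 ^ n = 1 := by rw [← mul_pow]; norm_num
  calc (n.factorial : ℝ) ^ (1 / α) * 2 ^ (i.2 * n) * G.tnorm i.1 (D n f)
      = ((n.factorial : ℝ) ^ (1 / α) * (2 ^ (i.2 + 1)) ^ n * G.tnorm i.1 (D n f)) *
        (1 / 2) ^ n := by
        rw [pow_succ, mul_pow, ← pow_mul]
        linear_combination
          -((n.factorial : ℝ) ^ (1 / α) * 2 ^ (i.2 * n) * G.tnorm i.1 (D n f)) * h1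
    _ ≤ _ := mul_le_mul_of_nonneg_right (hj f n) (by positivity)

/-- Sum the growth norms of the terms of the expansion. For α > 0 the only admissible exponent is γ
= 1/α, which matches the weights of |||·|||, and 2^l > L absorbs the geometric factor. -/
theorem exists_growthNorm_le_sequenceNorm (hα : α ∈ Set.Ioc (0 : ℝ) 1)
    (hD : ∀ (f : G.Emin α) (i : T × ℕ),
      Summable fun n => (n.factorial : ℝ) ^ (1 / α) * 2 ^ (i.2 * n) * G.tnorm i.1 (D n f))
    (ht : ∀ n φ ω, t n φ ω = S n ω φ)
    (htb : ∀ i : orders α × T × ℕ, ∃ (γ : ℝ) (τ' : T) (L : ℝ), 1 ≤ γ ∧ 1 / γ ∈ orders α ∧ 0 ≤ L ∧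
      ∀ (n : ℕ) (φ : G.symPow n), G.growthNorm α i (t n φ) ≤
        2 * ((n.factorial : ℝ) ^ γ * L ^ n * G.tnorm τ' φ))
    (hsum : ∀ f ω, HasSum (fun n => S n ω (D n f)) (f ω)) (i : orders α × T × ℕ) :
    ∃ j : T × ℕ, ∀ f, G.growthNorm α i f ≤ 2 * sequenceNorm hD j f := by
  obtain ⟨γ, τ, L, hγ, hγα, hL, h⟩ := htb i
  have hγ' : γ = 1 / α := by
    rw [orders, if_neg hα.1.ne', Set.mem_singleton_iff] at hγα
    rw [← hγα, one_div_one_div]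
  subst hγ'
  obtain ⟨l, hl⟩ := pow_unbounded_of_one_lt L one_lt_two
  refine ⟨(τ, l), fun f => ?_⟩
  have h1 := (hasSum_sequenceNorm hD f (τ, l)).mul_left 2
  rw [← h1.tsum_eq]
  refine Emin.growthNorm_le_tsum (t := fun n => t n (D n f)) h1.summable (fun n => ?_) fun ω => ?_
  · refine (h n _).trans ?_
    rw [pow_mul]
    gcongr
  · simpa only [ht] using hsum f ω

end

end NuclearScale
end

/-! ### The main theorem -/

theorem corollary3p2 {T : Type*} (G : NuclearScale T)
    (S : ∀ n : ℕ, G.Dual → G.SymDual n) (A B : G.FormalSeries G.Phi) (ρ : G.FormalSeries ℂ)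
    (hS : NuclearScale.IsSheffer S A ρ)
    (hρ : NuclearScale.HolomorphicNearZero ρ)
    (hAB : NuclearScale.IsCompInverse A B)
    (hA : NuclearScale.QuasiHolomorphic A) (hB : NuclearScale.QuasiHolomorphic B) :
    (∀ α ∈ Set.Icc (0 : ℝ) 1, ∀ f : G.Emin α,
      ∃! φ : ∀ n : ℕ, G.symPow n, NuclearScale.IsExpansion S f φ) ∧
    (∀ α ∈ Set.Ioc (0 : ℝ) 1, ∃ N : T × ℕ → Seminorm ℂ (G.Emin α),
      (∀ (f : G.Emin α) (φ : ∀ n : ℕ, G.symPow n), NuclearScale.IsExpansion S f φ → ∀ τ l,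
        HasSum (fun n => (n.factorial : ℝ) ^ (1 / α) * 2 ^ (l * n) * G.tnorm τ (φ n))
          (N (τ, l) f)) ∧
      (∀ i f, N i f = 0 → f = 0) ∧
      IsHomeomorph (toProjLim N)) := by
  refine ⟨fun α hα f => ?_, fun α hα => ?_⟩
  · obtain ⟨t, D, ht, htb, hDb, hsum, hDt⟩ := hS.exists_coordinates hρ hAB hA hB hα
    exact ⟨_, NuclearScale.isExpansion_coordinates ht htb hDb hsum f,
      fun φ hφ => NuclearScale.eq_of_isExpansion hα ht hDb hDt hφ⟩
  · have hα' : α ∈ Set.Icc (0 : ℝ) 1 := ⟨hα.1.le, hα.2⟩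
    obtain ⟨t, D, ht, htb, hDb, hsum, hDt⟩ := hS.exists_coordinates hρ hAB hA hB hα'
    have hterm := NuclearScale.exists_term_le hα hDb
    have hD : ∀ (f : G.Emin α) (i : T × ℕ),
        Summable fun n => (n.factorial : ℝ) ^ (1 / α) * 2 ^ (i.2 * n) * G.tnorm i.1 (D n f) :=
      fun f i => by
        obtain ⟨j, hj⟩ := hterm i
        exact Summable.of_nonneg_of_le (fun n => by positivity) (hj f)
          (summable_geometric_two.mul_left _)
    have hle : ∀ i : T × ℕ, ∃ j, ∀ f,
        NuclearScale.sequenceNorm hD i f ≤ 8 * G.growthNorm α j f := fun i => by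
      obtain ⟨j, hj⟩ := hterm i
      refine ⟨j, fun f => ?_⟩
      have h1 := hasSum_le (hj f) (NuclearScale.hasSum_sequenceNorm hD f i)
        (hasSum_geometric_two.mul_left (4 * G.growthNorm α j f))
      linarith
    have hge := NuclearScale.exists_growthNorm_le_sequenceNorm hα hD ht htb hsum
    -- Each family dominates the other, so the norms |||·||| define the given topology, and
    -- completeness carries over to Cauchy filters for these norms.
    have hws : WithSeminorms (NuclearScale.sequenceNorm hD) :=
      (NuclearScale.growthNorm_withSeminorms α).congr
        (Seminorm.IsBounded.of_real fun i => by
          obtain ⟨j, hj⟩ := hle i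
          exact ⟨{j}, 8, fun f => by simpa using hj f⟩)
        (Seminorm.IsBounded.of_real fun i => by
          obtain ⟨j, hj⟩ := hge i
          exact ⟨{j}, 2, fun f => by simpa using hj f⟩)
    have : Nonempty (T × ℕ) := ⟨(G.center, 0)⟩
    refine ⟨NuclearScale.sequenceNorm hD, fun f φ hφ τ l => ?_,
      fun i f hf => NuclearScale.sequenceNorm_definite hD hsum hf,
      isHomeomorph_toProjLim hws (NuclearScale.sequenceNorm_directed hD)
        (fun f hf => NuclearScale.sequenceNorm_definite hD hsum (hf (G.center, 0)))
        fun F hF h => NuclearScale.Emin.exists_limit hα.1.le F hF fun i ε hε => ?_⟩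
    · rw [NuclearScale.eq_of_isExpansion hα' ht hDb hDt hφ]
      exact NuclearScale.hasSum_sequenceNorm hD f (τ, l)
    · obtain ⟨j, hj⟩ := hge i
      obtain ⟨s, hs, hfg⟩ := h j (ε / 2) (by positivity)
      refine ⟨s, hs, fun f hf g hg => (hj _).trans_lt ?_⟩
      have := hfg f hf g hg
      linarith
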